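/- Let $(S,\omega)$ be a translation surface, i.e. a compact connected Riemann surface $S$ of genus $g\ge 1$ with a nonzero holomorphic $1$-form $\omega$; equivalently, a compact connected Hausdorff space with a translation atlas (charts to $\mathbb C$ whose transition maps are locally translations) on the complement of a finite set $\Sigma$ of cone points of angles $2\pi k$, $k\ge 2$. Its Veech group $\mathrm{SL}(\omega)<\mathrm{SL}(2,\mathbb R)$ is the group of derivatives of its orientation-preserving affine automorphisms of determinant $1$ (equivalently, the stabilizer of the isomorphism class of $(S,\omega)$), and its trace field $K$ is the subfield of $\mathbb R$ generated by the traces of the elements of $\mathrm{SL}(\omega)$. The surface is a prelattice (or bouillabaisse) surface if $\mathrm{SL}(\omega)$ contains two transverse parabolic elements, i.e. parabolic elements with distinct invariant lines. A direction $\alpha\in\mathbb P^1(\mathbb R)$ is completely periodic if every regular leaf in direction $\alpha$ (every bi-infinite straight line in that direction avoiding $\Sigma$) is closed. For distinct completely periodic directions $\alpha\neq\beta$, let $C^\alpha_1,\dots,C^\alpha_r$ and $C^\beta_1,\dots,C^\beta_s$ be the flat cylinders in these directions, and let $E^\omega(\alpha,\beta)$ be the $r\times s$ matrix whose $(i,j)$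 entry is the intersection number of the positively oriented waist curves of $C^\alpha_i$ and $C^\beta_j$, that is, the number of their intersection points. The homological rank $r(\omega)$ is the maximum of the ranks of the matrices $E^\omega(\alpha,\beta)$ over all pairs of distinct completely periodic directions. Then for every prelattice surface $(S,\omega)$ the trace field $K$ is a finite extension of $\mathbb Q$ and $$[K:\mathbb Q]\le r(\omega).$$ Consequently, if a prelattice surface of genus $g$ is algebraically primitive, i.e. $[K:\mathbb Q]=g$, then it has maximal homological rank, i.e. $r(\omega)=g$. -/

import Mathlib

open Filter Topology

/-- The natural linear action of a `2 × 2` real matrix on the plane `ℂ = ℝ²`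
(in the basis `1, i`). -/
noncomputable def planeAct (A : Matrix (Fin 2) (Fin 2) ℝ) : ℂ →ₗ[ℝ] ℂ :=
  Matrix.toLin Complex.basisOneI Complex.basisOneI A

/-- A translation structure on `S`: a finite set `sing` of singular points, an atlas of charts to
`ℂ` on the complement of `sing` whose transition maps are locally translations and, at every
singular point, a cone point of angle `2πk` for some `k ≥ 2`.  For `S` compact, connected and
Hausdorff this is the same thing as a nonzero holomorphic `1`-form `ω` on a compact
connected Riemann surface: `ω = dz` in the charts of the atlas, and `ω = d(φ ^ k)` (a zero of order
`k - 1`) in a local coordinate `φ` centred at a singular point. -/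
structure TranslationStructure (S : Type*) [TopologicalSpace S] where
  /-- the singular points (the zeros of the differential) -/
  sing : Set S
  finite_sing : sing.Finite
  /-- the translation atlas -/
  charts : Set (OpenPartialHomeomorph S ℂ)
  source_subset : ∀ e ∈ charts, e.source ⊆ singᶜ
  exists_chart : ∀ x, x ∉ sing → ∃ e ∈ charts, x ∈ e.source
  transition : ∀ e ∈ charts, ∀ e' ∈ charts, ∀ x ∈ e.source ∩ e'.source,
    ∃ c : ℂ, ∀ᶠ y in 𝓝 x, e' y = e y + c
  cone : ∀ p ∈ sing, ∃ k : ℕ, 2 ≤ k ∧ ∃ φ : OpenPartialHomeomorph S ℂ,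
    p ∈ φ.source ∧ φ p = 0 ∧ φ.source ∩ sing = {p} ∧
    ∀ e ∈ charts, ∀ x ∈ φ.source ∩ e.source, ∃ c : ℂ, ∀ᶠ y in 𝓝 x, e y = φ y ^ k + c

/-- The first Betti number of a connected space, the rank of `H₁(S, ℤ) = π₁(S)ᵃᵇ`. -/
noncomputable def firstBetti (S : Type*) [TopologicalSpace S] [Nonempty S] : ℕ :=
  Module.finrank ℤ (Additive (Abelianization (FundamentalGroup S (Classical.arbitrary S))))

/-- The genus of a closed connected orientable surface: half of its first Betti number. -/
noncomputable def surfaceGenus (S : Type*) [TopologicalSpace S] [Nonempty S] : ℕ :=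
  firstBetti S / 2

namespace TranslationStructure

variable {S : Type*} [TopologicalSpace S] (X : TranslationStructure S)

/-- `f` is an affine automorphism with derivative `A`: it preserves the singular set, and in
translation charts it is locally of the form `z ↦ A z + c`. -/
def IsAffineAut (A : Matrix (Fin 2) (Fin 2) ℝ) (f : S ≃ₜ S) : Prop :=
  (∀ x, f x ∈ X.sing ↔ x ∈ X.sing) ∧
    ∀ e ∈ X.charts, ∀ e' ∈ X.charts, ∀ x ∈ e.source, f x ∈ e'.source →
      ∃ c : ℂ, ∀ᶠ y in 𝓝 x, e' (f y) = planeAct A (e y) + c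

/-- The Veech group: the derivatives in `SL(2, ℝ)` of the affine automorphisms; equivalently the
stabilizer of the isomorphism class of the surface under the action of `SL(2, ℝ)`. -/
def veechGroup : Subgroup (Matrix.SpecialLinearGroup (Fin 2) ℝ) where
  carrier := {A | ∃ f : S ≃ₜ S, X.IsAffineAut A f}
  one_mem' := by
    refine ⟨Homeomorph.refl S, fun x => Iff.rfl, fun e he e' he' x hx hx' => ?_⟩
    obtain ⟨c, hc⟩ := X.transition e he e' he' x ⟨hx, hx'⟩
    exact ⟨c, by simpa [planeAct] using hc⟩
  mul_mem' := by
    rintro A B ⟨f, hf, hf'⟩ ⟨g, hg, hg'⟩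
    refine ⟨g.trans f, fun x => by simp [hf, hg], fun e he e' he' x hx hx' => ?_⟩
    have hgx : g x ∉ X.sing := by
      rw [hg]; exact X.source_subset e he hx
    obtain ⟨d, hd, hxd⟩ := X.exists_chart _ hgx
    obtain ⟨c₁, h₁⟩ := hg' e he d hd x hx hxd
    obtain ⟨c₂, h₂⟩ := hf' d hd e' he' (g x) hxd hx'
    refine ⟨planeAct A c₁ + c₂, ?_⟩
    filter_upwards [h₁, g.continuous.continuousAt.eventually h₂] with y hy₁ hy₂
    have : planeAct (A.1 * B.1) = planeAct A ∘ₗ planeAct B := by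
      simp [planeAct, Matrix.toLin_mul Complex.basisOneI Complex.basisOneI Complex.basisOneI]
    simp only [Homeomorph.trans_apply, Matrix.SpecialLinearGroup.coe_mul]
    rw [hy₂, hy₁, this, map_add, LinearMap.comp_apply, add_assoc]
  inv_mem' := by
    rintro A ⟨f, hf, hf'⟩
    refine ⟨f.symm, fun x => by rw [← hf, f.apply_symm_apply], fun e he e' he' x hx hx' => ?_⟩
    obtain ⟨c, h⟩ := hf' e' he' e he (f.symm x) hx' (by simpa using hx)
    refine ⟨-planeAct (A⁻¹ : Matrix.SpecialLinearGroup (Fin 2) ℝ) c, ?_⟩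
    filter_upwards [f.symm.continuous.continuousAt.eventually h] with y hy
    have : planeAct (A⁻¹ : Matrix.SpecialLinearGroup (Fin 2) ℝ) ∘ₗ planeAct A
        = LinearMap.id := by
      rw [planeAct, planeAct, ← Matrix.toLin_mul, ← Matrix.SpecialLinearGroup.coe_mul]
      simp
    have h2 := LinearMap.congr_fun this (e' (f.symm y))
    simp only [LinearMap.comp_apply, LinearMap.id_apply] at h2
    rw [Homeomorph.apply_symm_apply] at hy
    rw [hy, map_add, h2]
    ring

/-- The trace field: the subfield of `ℝ` generated by the traces of the elements of the Veech
group. -/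
noncomputable def traceField : IntermediateField ℚ ℝ :=
  IntermediateField.adjoin ℚ
    {x : ℝ | ∃ A ∈ X.veechGroup, x = Matrix.trace (A : Matrix (Fin 2) (Fin 2) ℝ)}

/-- Prelattice (bouillabaisse) surface: the Veech group contains two parabolic elements which are
transverse, that is, have distinct invariant lines. -/
def IsPrelattice : Prop :=
  ∃ P ∈ X.veechGroup, ∃ Q ∈ X.veechGroup,
    (P : Matrix (Fin 2) (Fin 2) ℝ).IsParabolic ∧ (Q : Matrix (Fin 2) (Fin 2) ℝ).IsParabolic ∧
    ¬ ∃ (v : ℂ) (a b : ℝ), Module.End.HasEigenvector (planeAct P) a v ∧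
      Module.End.HasEigenvector (planeAct Q) b v

/-- `γ` is a bi-infinite straight line with constant velocity `v` which avoids the singular points.
For `v ≠ 0` these are the parametrizations of the regular leaves in the direction of `v`. -/
def IsStraightLine (v : ℂ) (γ : ℝ → S) : Prop :=
  Continuous γ ∧ (∀ t, γ t ∉ X.sing) ∧
    ∀ t, ∀ e ∈ X.charts, γ t ∈ e.source →
      ∀ᶠ s in 𝓝 t, e (γ s) = e (γ t) + (s - t) • v

/-- The direction spanned by the nonzero vector `v` is completely periodic: every regular leaf in
this direction is closed. -/
def IsCompletelyPeriodic (v : ℂ) : Prop :=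
  v ≠ 0 ∧ ∀ γ : ℝ → S, X.IsStraightLine v γ → ∃ T > 0, Function.Periodic γ T

/-- The regular leaf through `x` in the direction of `v` (empty if the leaf through `x` runs into a
singular point). -/
def leaf (v : ℂ) (x : S) : Set S :=
  {y | ∃ γ : ℝ → S, X.IsStraightLine v γ ∧ γ 0 = x ∧ y ∈ Set.range γ}

/-- The union of the closed regular leaves in the direction of `v`. -/
def periodicPart (v : ℂ) : Set S :=
  {x | ∃ γ : ℝ → S, X.IsStraightLine v γ ∧ γ 0 = x ∧ ∃ T > 0, Function.Periodic γ T}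

/-- The (maximal, open) flat cylinders in the direction of `v`, as the connected components of the
union of the closed regular leaves. On a torus there is a single one, the whole surface. -/
abbrev Cylinder (v : ℂ) : Type _ := ConnectedComponents (X.periodicPart v)

/-- A waist curve of a cylinder: one of the closed leaves that fill it. -/
noncomputable def waist (v : ℂ) (C : X.Cylinder v) : Set S :=
  X.leaf v (Function.surjInv ConnectedComponents.surjective_coe C : X.periodicPart v)

/-- The intersection matrix of two transverse directions. The waist curves of two transverse
cylinders cross at every common point and always with the same sign, so that the
number of their common points is their intersection number; it is also the number of parallelograms
that make up the intersection of the two cylinders. -/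
noncomputable def intersectionMatrix (v w : ℂ) : Matrix (X.Cylinder v) (X.Cylinder w) ℚ :=
  Matrix.of fun C D => ((X.waist v C ∩ X.waist w D).ncard : ℚ)

/-- The homological rank: the maximal rank of the intersection matrices of pairs of distinct
completely periodic directions. -/
noncomputable def homologicalRank : ℕ∞ :=
  ⨆ (v : ℂ) (w : ℂ) (_ : X.IsCompletelyPeriodic v) (_ : X.IsCompletelyPeriodic w)
    (_ : LinearIndependent ℝ ![v, w]), (X.intersectionMatrix v w).eRank

/-- Algebraic primitivity: the degree of the trace field over `ℚ` equals the genus. -/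
def IsAlgebraicallyPrimitive [Nonempty S] : Prop :=
  Module.finrank ℚ X.traceField = surfaceGenus S

/-- Maximal homological rank: the homological rank equals the genus. -/
def HasMaximalHomologicalRank [Nonempty S] : Prop :=
  X.homologicalRank = surfaceGenus S

end TranslationStructure

/-! Let `v` and `w` span the invariant lines of two transverse parabolic elements. A suitable power
of each lifts to an affine map which shears along its line and fixes every regular point whose leaf
in that direction runs into a singular point (`exists_twist`): for a given small hitting time there
are boundedly many such points, and the map permutes them. If a leaf did not close up, two of its
near returns would give a closed geodesic almost parallel to the line; shearing it by one of two
opposite twists makes it shorter than the systole without killing it. Hence both directions are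
completely periodic (`Twist.isCompletelyPeriodic`), with finitely many cylinders
(`Twist.finite_cylinder`).

Let `c` and `k` be the circumferences and heights of the `v`-cylinders, `d` and `η` those of the
`w`-cylinders, lengths being measured in multiples of `v` and `w`. A closed line of velocity `v + e
• w` crosses the `w`-cylinders, so its period is an integral combination of the `η`; for the waist
curves this reads `c = E η`, with `E` the intersection matrix. A twist acts on each cylinder as a
multiple Dehn twist, so `t * k C` is an integral multiple of `c C` (`Twist.exists_height`). The same
holds with the two directions exchanged. Comparing dimensions over `ℚ` gives `span c = span η = W`,
`span d = span k = U` and `t U = W` (`Submodule.span_range_eq_of_mul_mem`).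

Now let an affine automorphism have the diagonal entries `a`, `a'` in the basis `v, w`. It maps a
waist curve of circumference `c C` to a closed line which, rescaled, has velocity `v + e • w` and
period `|a| * c C`; so `a W ⊆ W`. Likewise `a' U ⊆ U`, hence `a' W ⊆ W`. All traces, and then the
whole trace field, act on the nonzero space `W`, whose dimension is at most the rank of `E`
(`Twist.finrank_traceField_le`).

For the consequence it remains to bound the rank of any intersection matrix by the genus. Collapsing
the complement of a strip around a waist curve gives a map to the circle, whose winding number
counts intersections with that curve. Waist curves in one direction pair to zero with each other, so
`n` independent rows and columns of `E` yield `2 * n` independent homology classes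
(`eRank_intersectionMatrix_le`).

The geometry is carried by the relation `Seg x z y`: "the straight segment from `x` with
displacement `z` exists and ends at `y`". Neither the flat metric nor the holomorphic structure is
used. -/

set_option linter.unusedSectionVars false

/-- The open-and-closed argument in the form used throughout: to propagate a property along a
connected set, its truth value has to be locally constant. -/
theorem IsPreconnected.imp_of_eventually_iff {α : Type*} [TopologicalSpace α] {s : Set α}
    (hs : IsPreconnected s) {p : α → Prop} (h : ∀ x ∈ s, ∀ᶠ y in 𝓝[s] x, p y ↔ p x)
    {x y : α} (hx : x ∈ s) (hy : y ∈ s) (hp : p x) : p y :=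
  hs.induction₂' (fun a b => p a → p b)
    (fun a ha => (h a ha).mono fun _ hb => ⟨hb.2, hb.1⟩)
    (fun _ _ _ _ _ _ h₁ h₂ h₃ => h₂ (h₁ h₃)) hx hy hp

/-! ### Flat maps and straight segments. -/

namespace TranslationStructure

open Set Metric

section Flat

variable {S : Type*} [TopologicalSpace S] (X : TranslationStructure S)
  {Z Z' : Type*} [TopologicalSpace Z'] [TopologicalSpace Z]

/-- `Φ` is flat at `z` along `s`, with developing map `d`: it is continuous, avoids the singular
points, and in the charts it agrees with `d` up to a translation. -/
def FlatAt (d : Z → ℂ) (Φ : Z → S) (s : Set Z) (z : Z) : Prop :=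
  Φ z ∉ X.sing ∧ ContinuousWithinAt Φ s z ∧ ∀ e ∈ X.charts, Φ z ∈ e.source →
    ∀ᶠ y in 𝓝[s] z, e (Φ y) = e (Φ z) + (d y - d z)

/-- A map which is flat at all points of `s`. -/
def IsFlatOn (d : Z → ℂ) (Φ : Z → S) (s : Set Z) : Prop := ∀ z ∈ s, X.FlatAt d Φ s z

variable {X} {d d' : Z → ℂ} {Φ Ψ : Z → S} {s t : Set Z} {z : Z}

/-- One chart suffices, because transition maps are local translations. -/
theorem FlatAt.of_chart {e : OpenPartialHomeomorph S ℂ} (he : e ∈ X.charts) (hz : Φ z ∈ e.source)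
    (hc : ContinuousWithinAt Φ s z)
    (h : ∀ᶠ z' in 𝓝[s] z, e (Φ z') = e (Φ z) + (d z' - d z)) : X.FlatAt d Φ s z := by
  refine ⟨X.source_subset e he hz, hc, fun e' he' hz' => ?_⟩
  obtain ⟨c, hcc⟩ := X.transition e he e' he' (Φ z) ⟨hz, hz'⟩
  filter_upwards [hc.eventually hcc, h] with z' h₁ h₂
  rw [h₁, h₂, hcc.self_of_nhds]
  ring

theorem FlatAt.mono (h : X.FlatAt d Φ t z) (hst : s ⊆ t) : X.FlatAt d Φ s z :=
  ⟨h.1, h.2.1.mono hst, fun e he hz => (h.2.2 e he hz).filter_mono (nhdsWithin_mono _ hst)⟩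

theorem IsFlatOn.mono (h : X.IsFlatOn d Φ t) (hst : s ⊆ t) : X.IsFlatOn d Φ s :=
  fun z hz => (h z (hst hz)).mono hst

theorem FlatAt.comp {h : Z' → Z} {s' : Set Z'} {z' : Z'} (hΦ : X.FlatAt d Φ s (h z'))
    (hh : ContinuousWithinAt h s' z') (hm : MapsTo h s' s) :
    X.FlatAt (d ∘ h) (Φ ∘ h) s' z' := by
  have ht : Tendsto h (𝓝[s'] z') (𝓝[s] (h z')) := hh.tendsto_nhdsWithin hm
  exact ⟨hΦ.1, hΦ.2.1.comp hh hm, fun e he hz => ht.eventually (hΦ.2.2 e he hz)⟩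

theorem IsFlatOn.comp {h : Z' → Z} {s' : Set Z'} (hΦ : X.IsFlatOn d Φ s)
    (hh : ContinuousOn h s') (hm : MapsTo h s' s) : X.IsFlatOn (d ∘ h) (Φ ∘ h) s' :=
  fun z hz => (hΦ _ (hm hz)).comp (hh z hz) hm

theorem IsFlatOn.congr_dev (hΦ : X.IsFlatOn d Φ s) {c : ℂ} (h : ∀ z ∈ s, d' z = d z + c) :
    X.IsFlatOn d' Φ s := by
  refine fun z hz => ⟨(hΦ z hz).1, (hΦ z hz).2.1, fun e he hx => ?_⟩
  filter_upwards [(hΦ z hz).2.2 e he hx, self_mem_nhdsWithin] with z' h₁ h₂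
  rw [h₁, h z hz, h z' h₂]
  ring

theorem IsFlatOn.continuousOn (h : X.IsFlatOn d Φ s) : ContinuousOn Φ s := fun z hz => (h z hz).2.1

theorem FlatAt.eventually_mem_source (h : X.FlatAt d Φ s z) {e : OpenPartialHomeomorph S ℂ}
    (hz : Φ z ∈ e.source) : ∀ᶠ z' in 𝓝[s] z, Φ z' ∈ e.source :=
  h.2.1.eventually (e.open_source.mem_nhds hz)

/-- Unique continuation: charts are injective, so the set of coincidence is open, and it is closed
because `S` is Hausdorff. The uniqueness of end points of segments is a special case. -/
theorem IsFlatOn.eqOn [T2Space S] (hs : IsPreconnected s) (hΦ : X.IsFlatOn d Φ s)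
    (hΨ : X.IsFlatOn d Ψ s) {a : Z} (ha : a ∈ s) (h : Φ a = Ψ a) : EqOn Φ Ψ s := by
  intro b hb
  refine hs.imp_of_eventually_iff (p := fun z => Φ z = Ψ z) (fun z hz => ?_) ha hb h
  by_cases hzz : Φ z = Ψ z
  · obtain ⟨e, he, hx⟩ := X.exists_chart _ (hΦ z hz).1
    filter_upwards [(hΦ z hz).2.2 e he hx, (hΨ z hz).2.2 e he (hzz ▸ hx),
      (hΦ z hz).eventually_mem_source hx, (hΨ z hz).eventually_mem_source (hzz ▸ hx)]
      with y h₁ h₂ h₃ h₄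
    simp only [hzz, iff_true]
    exact e.injOn h₃ h₄ (by rw [h₁, h₂, hzz])
  · obtain ⟨u, v, hu, hv, hxu, hyv, huv⟩ := t2_separation hzz
    filter_upwards [(hΦ z hz).2.1.eventually (hu.mem_nhds hxu),
      (hΨ z hz).2.1.eventually (hv.mem_nhds hyv)] with y h₁ h₂
    simp only [hzz, iff_false]
    exact fun h => huv.le_bot ⟨h₁, h ▸ h₂⟩

theorem isFlatOn_chart_symm {e : OpenPartialHomeomorph S ℂ} (he : e ∈ X.charts) (w : ℂ)
    {s : Set ℂ} (hs : ∀ ζ ∈ s, w + ζ ∈ e.target) :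
    X.IsFlatOn id (fun ζ => e.symm (w + ζ)) s := by
  intro ζ hζ
  have ht := hs ζ hζ
  refine FlatAt.of_chart he (e.map_target ht) ?_ ?_
  · have : ContinuousAt e.symm (w + ζ) := e.continuousAt_symm ht
    exact ContinuousAt.continuousWithinAt
      (ContinuousAt.comp (f := fun ζ => w + ζ) this (by fun_prop))
  · filter_upwards [self_mem_nhdsWithin] with ζ' hζ'
    rw [e.right_inv ht, e.right_inv (hs ζ' hζ')]
    simp only [id]
    ring

theorem exists_ball_subset_target {e : OpenPartialHomeomorph S ℂ} {x : S} (hx : x ∈ e.source) :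
    ∃ r > 0, ∀ ζ ∈ ball (0 : ℂ) r, e x + ζ ∈ e.target := by
  obtain ⟨r, hr, h⟩ := Metric.isOpen_iff.1 e.open_target (e x) (e.map_source hx)
  exact ⟨r, hr, fun ζ hζ => h (by simpa using hζ)⟩

/-- Straight segments: `Seg x z y` says that the segment with initial point `x` and displacement
`z` exists and ends at `y`. -/
def Seg (X : TranslationStructure S) (x : S) (z : ℂ) (y : S) : Prop :=
  ∃ γ : ℝ → S, X.IsFlatOn (fun t : ℝ => t • z) γ (Icc 0 1) ∧ γ 0 = x ∧ γ 1 = y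

theorem IsFlatOn.seg (hΦ : X.IsFlatOn d Φ s) {h : ℝ → Z} (hh : ContinuousOn h (Icc 0 1))
    (hm : MapsTo h (Icc 0 1) s) {ζ : ℂ} (hd : ∀ t ∈ Icc (0 : ℝ) 1, d (h t) = d (h 0) + t • ζ) :
    X.Seg (Φ (h 0)) ζ (Φ (h 1)) := by
  refine ⟨Φ ∘ h, (hΦ.comp hh hm).congr_dev (c := - d (h 0)) fun t ht => ?_, rfl, rfl⟩
  simp only [Function.comp, hd t ht]
  ring

/-- A flat map on a convex set of a real vector space, with an affine developing map. -/
theorem IsFlatOn.seg_of_convex {E : Type*} [AddCommGroup E] [Module ℝ E] [TopologicalSpace E]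
    [IsTopologicalAddGroup E] [ContinuousSMul ℝ E] {d : E → ℂ} {Φ : E → S} {s : Set E}
    (hΦ : X.IsFlatOn d Φ s) {a b : E} (hs : segment ℝ a b ⊆ s)
    (hd : ∀ t : ℝ, d (a + t • (b - a)) = d a + t • (d b - d a)) :
    X.Seg (Φ a) (d b - d a) (Φ b) := by
  have := hΦ.seg (h := fun t : ℝ => a + t • (b - a)) (by fun_prop) (fun t ht => hs ?_)
    (ζ := d b - d a) (fun t _ => by simp [hd])
  · simpa using this
  · rw [segment_eq_image']
    exact ⟨t, ht, rfl⟩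

theorem Seg.left_notMem {x y : S} {ζ : ℂ} (h : X.Seg x ζ y) : x ∉ X.sing := by
  obtain ⟨γ, hγ, rfl, rfl⟩ := h
  exact (hγ 0 (by simp)).1

theorem Seg.refl {x : S} (hx : x ∉ X.sing) : X.Seg x 0 x := by
  refine ⟨fun _ => x, fun t _ => ⟨hx, continuousWithinAt_const, fun e _ _ => ?_⟩, rfl, rfl⟩
  simp

theorem Seg.symm {x y : S} {ζ : ℂ} (h : X.Seg x ζ y) : X.Seg y (-ζ) x := by
  obtain ⟨γ, hγ, rfl, rfl⟩ := h
  have := hγ.seg (h := fun t : ℝ => 1 - t) (by fun_prop)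
    (fun t ht => ⟨by linarith [ht.2], by linarith [ht.1]⟩) (ζ := -ζ)
    (fun t _ => by simp; ring)
  simpa using this

theorem Seg.right_notMem {x y : S} {ζ : ℂ} (h : X.Seg x ζ y) : y ∉ X.sing := h.symm.left_notMem

theorem Seg.unique [T2Space S] {x y y' : S} {ζ : ℂ} (h : X.Seg x ζ y) (h' : X.Seg x ζ y') :
    y = y' := by
  obtain ⟨γ, hγ, rfl, rfl⟩ := h
  obtain ⟨γ', hγ', h0, rfl⟩ := h'
  exact hγ.eqOn isPreconnected_Icc hγ' (a := 0) (by simp) h0.symm (by simp)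

theorem Seg.unique_left [T2Space S] {x x' y : S} {ζ : ℂ} (h : X.Seg x ζ y) (h' : X.Seg x' ζ y) :
    x = x' := h.symm.unique h'.symm

theorem Seg.prefix {x y : S} {ζ : ℂ} (h : X.Seg x ζ y) {t : ℝ} (ht : t ∈ Icc (0 : ℝ) 1) :
    ∃ m, X.Seg x (t • ζ) m := by
  obtain ⟨γ, hγ, rfl, rfl⟩ := h
  refine ⟨γ t, ?_⟩
  have := hγ.seg (h := fun r : ℝ => r * t) (by fun_prop)
    (fun r hr => ⟨mul_nonneg hr.1 ht.1, mul_le_one₀ hr.2 ht.1 ht.2⟩) (ζ := t • ζ)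
    (fun r _ => by simp [mul_smul])
  simpa using this

/-- Short segments, in a chart. -/
theorem Seg.chart_of_le {e : OpenPartialHomeomorph S ℂ} (he : e ∈ X.charts) {x y : S} {ζ : ℂ}
    [T2Space S] (hx : x ∈ e.source) (h : X.Seg x ζ y) {r : ℝ}
    (hr : ∀ ζ ∈ ball (0 : ℂ) r, e x + ζ ∈ e.target) (hζ : ‖ζ‖ < r) :
    y ∈ e.source ∧ e y = e x + ζ ∧ y = e.symm (e x + ζ) := by
  have hζ' : ζ ∈ ball (0 : ℂ) r := by simpa using hζ
  have hb := (isFlatOn_chart_symm he (e x) hr).seg_of_convex (a := 0) (b := ζ)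
    ((convex_ball (0 : ℂ) r).segment_subset (by simpa using (norm_nonneg ζ).trans_lt hζ) hζ')
    (fun t => by simp)
  simp only [id, sub_zero, add_zero, e.left_inv hx] at hb
  have := h.unique hb
  subst this
  exact ⟨e.map_target (hr _ hζ'), e.right_inv (hr _ hζ'), rfl⟩

theorem seg_chart_symm {e : OpenPartialHomeomorph S ℂ} (he : e ∈ X.charts) {w : ℂ} {r : ℝ}
    (hr : ∀ ζ ∈ ball (0 : ℂ) r, w + ζ ∈ e.target) {a b : ℂ}
    (ha : ‖a‖ < r) (hb : ‖b‖ < r) :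
    X.Seg (e.symm (w + a)) (b - a) (e.symm (w + b)) :=
  (isFlatOn_chart_symm he w hr).seg_of_convex (a := a) (b := b)
    ((convex_ball (0 : ℂ) r).segment_subset (by simpa using ha) (by simpa using hb))
    (fun t => by simp)

theorem exists_short_seg {x : S} (hx : x ∉ X.sing) :
    ∃ ε > 0, ∀ ζ : ℂ, ‖ζ‖ < ε → ∃ y, X.Seg x ζ y := by
  obtain ⟨e, he, hxe⟩ := X.exists_chart x hx
  obtain ⟨r, hr, h⟩ := exists_ball_subset_target hxe
  refine ⟨r, hr, fun ζ hζ => ⟨e.symm (e x + ζ), ?_⟩⟩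
  have := seg_chart_symm he h (a := 0) (b := ζ) (by simpa) hζ
  simpa [e.left_inv hxe] using this

theorem eventually_short_seg {x : S} (hx : x ∉ X.sing) {ε : ℝ} (hε : 0 < ε) :
    ∀ᶠ y in 𝓝 x, ∃ ζ : ℂ, ‖ζ‖ < ε ∧ X.Seg x ζ y := by
  obtain ⟨e, he, hxe⟩ := X.exists_chart x hx
  obtain ⟨r, hr, h⟩ := exists_ball_subset_target hxe
  have h1 : ∀ᶠ y in 𝓝 x, e y ∈ ball (e x) (min ε r) :=
    (e.continuousAt hxe).eventually (ball_mem_nhds _ (lt_min hε hr))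
  filter_upwards [h1, e.open_source.mem_nhds hxe] with y hy hys
  have hy' : ‖e y - e x‖ < min ε r := by simpa [dist_eq_norm] using hy
  refine ⟨e y - e x, hy'.trans_le (min_le_left _ _), ?_⟩
  have := seg_chart_symm he h (a := 0) (b := e y - e x) (by simpa)
    (hy'.trans_le (min_le_right _ _))
  simpa [e.left_inv hxe, e.left_inv hys] using this

/-- Flatness in terms of segments. -/
theorem FlatAt.eventually_seg [T2Space S] (h : X.FlatAt d Φ s z) :
    ∀ᶠ z' in 𝓝[s] z, X.Seg (Φ z) (d z' - d z) (Φ z') := by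
  obtain ⟨e, he, hxe⟩ := X.exists_chart _ h.1
  obtain ⟨r, hr, hb⟩ := exists_ball_subset_target hxe
  have h1 : ∀ᶠ z' in 𝓝[s] z, e (Φ z') ∈ ball (e (Φ z)) r :=
    ((e.continuousAt hxe).comp_continuousWithinAt h.2.1).eventually (ball_mem_nhds _ hr)
  filter_upwards [h1, h.2.2 e he hxe, h.eventually_mem_source hxe] with z' h₁ h₂ h₃
  have h4 : ‖d z' - d z‖ < r := by simpa [dist_eq_norm, h₂] using h₁
  have := seg_chart_symm he hb (a := 0) (b := d z' - d z) (by simpa) h4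
  rw [← h₂] at this
  simpa [e.left_inv hxe, e.left_inv h₃] using this

/-- Converse of `FlatAt.eventually_seg`. Short segments are unique, hence visible in a chart, so
flatness can be checked without mentioning charts. -/
theorem FlatAt.of_eventually_seg [T2Space S] (hz : Φ z ∉ X.sing) (hd : ContinuousWithinAt d s z)
    (h : ∀ᶠ z' in 𝓝[s] z, X.Seg (Φ z) (d z' - d z) (Φ z')) : X.FlatAt d Φ s z := by
  obtain ⟨e, he, hxe⟩ := X.exists_chart _ hz
  obtain ⟨r, hr, hb⟩ := exists_ball_subset_target hxe
  have h1 : ∀ᶠ z' in 𝓝[s] z, ‖d z' - d z‖ < r := by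
    have : Tendsto (fun z' => ‖d z' - d z‖) (𝓝[s] z) (𝓝 ‖d z - d z‖) :=
      (Tendsto.sub_const hd _).norm
    exact this.eventually_lt_const (by simpa using hr)
  have h2 : ∀ᶠ z' in 𝓝[s] z, Φ z' = e.symm (e (Φ z) + (d z' - d z)) := by
    filter_upwards [h, h1] with z' h₁ h₂ using (h₁.chart_of_le he hxe hb h₂).2.2
  refine FlatAt.of_chart he hxe ?_ ?_
  · have h3 : ContinuousWithinAt (fun z' => e.symm (e (Φ z) + (d z' - d z))) s z := by
      have h4 : ContinuousAt e.symm (e (Φ z) + (d z - d z)) :=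
        e.continuousAt_symm (by simpa using e.map_source hxe)
      exact ContinuousAt.comp_continuousWithinAt (f := fun z' => e (Φ z) + (d z' - d z)) h4
        (continuousWithinAt_const.add (hd.sub continuousWithinAt_const))
    exact h3.congr_of_eventuallyEq h2 (by simp [e.left_inv hxe])
  · filter_upwards [h, h1] with z' h₁ h₂ using (h₁.chart_of_le he hxe hb h₂).2.1

end Flat

end TranslationStructure

/-! ### The calculus of segments: thickening, triangles, lines. -/

namespace TranslationStructure

open Set Metric

section Segments

variable {S : Type*} [TopologicalSpace S] {X : TranslationStructure S}
  {Z : Type*} [TopologicalSpace Z] {d : Z → ℂ} {Φ : Z → S} {s : Set Z}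

theorem exists_uniform_flat_ball {K : Set S} (hK : IsCompact K) (hs : ∀ x ∈ K, x ∉ X.sing) :
    ∃ r > 0, ∀ x ∈ K, ∃ b : ℂ → S, b 0 = x ∧ X.IsFlatOn id b (ball 0 r) := by
  refine hK.induction_on (p := fun K => ∃ r > 0, ∀ x ∈ K, ∃ b : ℂ → S, b 0 = x ∧
    X.IsFlatOn id b (ball 0 r)) ⟨1, one_pos, by simp⟩ ?_ ?_ ?_
  · rintro s t hst ⟨r, hr, h⟩
    exact ⟨r, hr, fun x hx => h x (hst hx)⟩
  · rintro s t ⟨r, hr, h⟩ ⟨r', hr', h'⟩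
    refine ⟨min r r', lt_min hr hr', fun x hx => ?_⟩
    rcases hx with hx | hx
    · obtain ⟨b, h0, hb⟩ := h x hx
      exact ⟨b, h0, hb.mono (ball_subset_ball (min_le_left _ _))⟩
    · obtain ⟨b, h0, hb⟩ := h' x hx
      exact ⟨b, h0, hb.mono (ball_subset_ball (min_le_right _ _))⟩
  · intro x hx
    obtain ⟨e, he, hxe⟩ := X.exists_chart x (hs x hx)
    obtain ⟨r, hr, hb⟩ := exists_ball_subset_target hxe
    have h1 : ∀ᶠ y in 𝓝 x, e y ∈ ball (e x) (r / 2) :=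
      (e.continuousAt hxe).eventually (ball_mem_nhds _ (half_pos hr))
    refine ⟨_, mem_nhdsWithin_of_mem_nhds (h1.and (e.open_source.mem_nhds hxe)), r / 2,
      half_pos hr, ?_⟩
    rintro y ⟨hy, hye⟩
    refine ⟨fun ζ => e.symm (e y + ζ), by simp [e.left_inv hye],
      isFlatOn_chart_symm he _ fun ζ hζ => ?_⟩
    have h2 : e y + ζ = e x + ((e y - e x) + ζ) := by ring
    rw [h2]
    apply hb
    rw [mem_ball, dist_eq_norm] at hy
    rw [mem_ball, dist_zero_right] at hζ ⊢
    linarith [norm_add_le (e y - e x) ζ]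

variable [T2Space S]

/-- The end point of a segment depends continuously, and by translations, on the segment. -/
theorem Seg.exists_thickening {x y : S} {z : ℂ} (h : X.Seg x z y) :
    ∃ ε > 0, ∀ (δ η : ℂ) (x' : S), ‖δ‖ < ε → ‖η‖ < ε → X.Seg x δ x' →
      ∃ y', X.Seg y (δ + η) y' ∧ X.Seg x' (z + η) y' := by
  obtain ⟨γ, hγ, rfl, rfl⟩ := h
  obtain ⟨r, hr, H⟩ := exists_uniform_flat_ball (isCompact_Icc.image_of_continuousOn
    hγ.continuousOn) (by rintro _ ⟨t, ht, rfl⟩; exact (hγ t ht).1)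
  have H' : ∀ t, ∃ b : ℂ → S, t ∈ Icc (0 : ℝ) 1 → b 0 = γ t ∧ X.IsFlatOn id b (ball 0 r) := by
    intro t
    by_cases ht : t ∈ Icc (0 : ℝ) 1
    · obtain ⟨b, hb⟩ := H _ (mem_image_of_mem γ ht)
      exact ⟨b, fun _ => hb⟩
    · exact ⟨fun _ => γ 0, fun h => (ht h).elim⟩
  choose b hb using H'
  -- The flat balls around the points `γ t` fit together to an immersed strip along the segment. The
  -- perturbed segment is then the image of the straight segment from `(0, δ)` to `(1, δ + η)`.
  have hflat : X.IsFlatOn (fun p : ℝ × ℂ => p.1 • z + p.2) (fun p => b p.1 p.2)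
      (Icc 0 1 ×ˢ ball 0 r) := by
    rintro ⟨t₀, ξ₀⟩ ⟨ht₀, hξ₀⟩
    obtain ⟨hb0, hbf⟩ := hb t₀ ht₀
    have hξ₀' : ‖ξ₀‖ < r := by simpa using hξ₀
    set ρ := (r - ‖ξ₀‖) / 2 with hρ
    have hρ0 : 0 < ρ := by simp only [hρ]; linarith
    refine FlatAt.of_eventually_seg (hbf _ hξ₀).1 (by fun_prop) ?_
    have h1 : ∀ᶠ p : ℝ × ℂ in 𝓝[Icc 0 1 ×ˢ ball 0 r] (t₀, ξ₀),
        X.Seg (γ t₀) (p.1 • z - t₀ • z) (γ p.1) := by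
      have : Tendsto (fun p : ℝ × ℂ => p.1) (𝓝[Icc 0 1 ×ˢ ball 0 r] (t₀, ξ₀))
          (𝓝[Icc 0 1] t₀) :=
        ContinuousWithinAt.tendsto_nhdsWithin (by fun_prop) fun p hp => hp.1
      exact this.eventually (hγ t₀ ht₀).eventually_seg
    have h2 : ∀ᶠ p : ℝ × ℂ in 𝓝[Icc 0 1 ×ˢ ball 0 r] (t₀, ξ₀), ‖p.1 • z - t₀ • z‖ < ρ := by
      have : Continuous fun p : ℝ × ℂ => ‖p.1 • z - t₀ • z‖ := by fun_prop
      exact nhdsWithin_le_nhds (this.continuousAt.eventually_lt continuousAt_const (by simpa))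
    have h3 : ∀ᶠ p : ℝ × ℂ in 𝓝[Icc 0 1 ×ˢ ball 0 r] (t₀, ξ₀), ‖p.2‖ < ‖ξ₀‖ + ρ := by
      have : Continuous fun p : ℝ × ℂ => ‖p.2‖ := by fun_prop
      exact nhdsWithin_le_nhds (this.continuousAt.eventually_lt continuousAt_const (by simpa))
    filter_upwards [h1, h2, h3, self_mem_nhdsWithin] with p hp1 hp2 hp3 hp4
    obtain ⟨t, ξ⟩ := p
    simp only at hp1 hp2 hp3 ⊢
    obtain ⟨hbt0, hbtf⟩ := hb t hp4.1
    set c := t • z - t₀ • z with hc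
    have hball : ∀ ζ ∈ ball (0 : ℂ) (‖ξ₀‖ + ρ), ζ + c ∈ ball (0 : ℂ) r := by
      intro ζ hζ
      rw [mem_ball, dist_zero_right] at hζ ⊢
      have := norm_add_le ζ c
      simp only [hρ] at *
      linarith
    have hgc : γ t = b t₀ c := by
      have h4 := hbf.seg_of_convex (a := 0) (b := c) ((convex_ball (0 : ℂ) r).segment_subset
        (by simpa) (by have := hball 0 (by simp; positivity); simpa using this))
        (fun t => by simp)
      simp only [hb0, id, sub_zero] at h4
      exact hp1.unique h4
    -- By unique continuation the ball at `γ t` is a translate of the one at `γ t₀` wherever both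
    -- are defined; they agree at the centre `γ t`.
    have heq : EqOn (b t) (fun ζ => b t₀ (ζ + c)) (ball 0 (‖ξ₀‖ + ρ)) := by
      refine IsFlatOn.eqOn (convex_ball _ _).isPreconnected
        (hbtf.mono (ball_subset_ball ?_)) ((hbf.comp (h := fun ζ => ζ + c) (by fun_prop)
          hball).congr_dev (c := -c) (d' := id) fun ζ _ => by simp) (a := 0)
          (by simp; positivity) ?_
      · simp only [hρ]; linarith
      · simp [hbt0, hgc]
    rw [heq (by simpa using hp3)]
    have := hbf.seg_of_convex (a := ξ₀) (b := ξ + c) ((convex_ball (0 : ℂ) r).segment_subset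
        hξ₀ (hball ξ (by simpa using hp3))) (fun t => by simp)
    convert this using 1
    simp only [id, hc]
    ring
  refine ⟨r / 2, half_pos hr, fun δ η x' hδ hη hx' => ⟨b 1 (δ + η), ?_, ?_⟩⟩
  · obtain ⟨h0, h1⟩ := hb 1 (by simp)
    have hn := norm_add_le δ η
    have := h1.seg_of_convex (a := 0) (b := δ + η) ((convex_ball (0 : ℂ) r).segment_subset
      (by simpa) (by simp only [mem_ball, dist_zero_right]; linarith)) (fun t => by simp)
    simpa [h0] using this
  · obtain ⟨h0, h1⟩ := hb 0 (by simp)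
    have hn := norm_add_le δ η
    have h2 := h1.seg_of_convex (a := 0) (b := δ) ((convex_ball (0 : ℂ) r).segment_subset
      (by simpa) (by simp only [mem_ball, dist_zero_right]; linarith)) (fun t => by simp)
    have h3 : x' = b 0 δ := hx'.unique (by simpa [h0] using h2)
    have := hflat.seg_of_convex (a := (0, δ)) (b := (1, δ + η))
      (((convex_Icc (0 : ℝ) 1).prod (convex_ball (0 : ℂ) r)).segment_subset
        ⟨by simp, by simp only [mem_ball, dist_zero_right]; linarith⟩
        ⟨by simp, by simp only [mem_ball, dist_zero_right]; linarith⟩)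
      (fun t => by simp; ring)
    rw [h3]
    convert this using 1
    simp; ring

/-- The end points of a continuous family of segments with flat initial points are flat. -/
theorem IsFlatOn.of_seg {Ψ : Z → S} {a : Z → ℂ} (hΨ : X.IsFlatOn d Ψ s) (hd : ContinuousOn d s)
    (ha : ContinuousOn a s) (h : ∀ z ∈ s, X.Seg (Ψ z) (a z) (Φ z)) :
    X.IsFlatOn (fun z => d z + a z) Φ s := by
  intro z hz
  obtain ⟨ε, hε, H⟩ := (h z hz).exists_thickening
  refine FlatAt.of_eventually_seg (h z hz).right_notMem ((hd z hz).add (ha z hz)) ?_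
  have small : ∀ {f : Z → ℂ}, ContinuousOn f s → ∀ᶠ z' in 𝓝[s] z, ‖f z' - f z‖ < ε := by
    intro f hf
    have : Tendsto (fun z' => ‖f z' - f z‖) (𝓝[s] z) (𝓝 ‖f z - f z‖) :=
      (Tendsto.sub_const (hf z hz) _).norm
    exact this.eventually_lt_const (by simpa using hε)
  filter_upwards [small hd, small ha, (hΨ z hz).eventually_seg, self_mem_nhdsWithin]
    with z' h₁ h₂ h₃ h₄
  obtain ⟨y', hy', hy⟩ := H _ _ _ h₁ h₂ h₃
  rw [add_sub_cancel] at hy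
  rw [(h z' h₄).unique hy]
  convert hy' using 1
  ring

theorem isFlatOn_const {x : S} (hx : x ∉ X.sing) : X.IsFlatOn (fun _ : Z => (0 : ℂ))
    (fun _ => x) s :=
  fun t _ => ⟨hx, continuousWithinAt_const, fun e _ _ => by simp⟩

theorem IsFlatOn.of_seg_const {x : S} {a : Z → ℂ} (hx : x ∉ X.sing)
    (ha : ContinuousOn a s) (h : ∀ z ∈ s, X.Seg x (a z) (Φ z)) : X.IsFlatOn a Φ s := by
  have := (isFlatOn_const hx).of_seg continuousOn_const ha h
  simpa using this

/-- Segments with a common initial point span a triangle. -/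
theorem Seg.sub {x y₁ y₂ : S} {ζ₁ ζ₂ : ℂ} (h₁ : X.Seg x ζ₁ y₁) (h₂ : X.Seg x ζ₂ y₂)
    (h : ∀ ζ ∈ segment ℝ ζ₁ ζ₂, ∃ y, X.Seg x ζ y) : X.Seg y₁ (ζ₂ - ζ₁) y₂ := by
  have : ∀ ζ, ∃ y, (∃ y, X.Seg x ζ y) → X.Seg x ζ y := fun ζ => by
    by_cases hζ : ∃ y, X.Seg x ζ y
    · exact ⟨hζ.choose, fun _ => hζ.choose_spec⟩
    · exact ⟨x, fun h => (hζ h).elim⟩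
  choose F hF using this
  have hflat : X.IsFlatOn id F {ζ | ∃ y, X.Seg x ζ y} :=
    IsFlatOn.of_seg_const h₁.left_notMem continuousOn_id fun ζ hζ => hF ζ hζ
  have := hflat.seg_of_convex (a := ζ₁) (b := ζ₂) h (fun t => by simp)
  rwa [(hF ζ₁ ⟨_, h₁⟩).unique h₁, (hF ζ₂ ⟨_, h₂⟩).unique h₂] at this

theorem Seg.exists_smul_of_mem {x y : S} {ζ : ℂ} {a c : ℝ} (h : X.Seg x (a • ζ) y)
    (hc : c ∈ uIcc 0 a) : ∃ m, X.Seg x (c • ζ) m := by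
  rcases eq_or_ne a 0 with rfl | ha
  · have : c = 0 := by simpa using hc
    exact ⟨y, this ▸ h⟩
  · have : c / a ∈ Icc (0 : ℝ) 1 := by
      rcases le_total 0 a with h0 | h0
      · rw [uIcc_of_le h0] at hc
        exact ⟨div_nonneg hc.1 h0, div_le_one_of_le₀ hc.2 h0⟩
      · rw [uIcc_of_ge h0] at hc
        exact ⟨div_nonneg_of_nonpos hc.2 h0, div_le_one_of_ge hc.1 h0⟩
    obtain ⟨m, hm⟩ := h.prefix this
    refine ⟨m, ?_⟩
    rwa [smul_smul, div_mul_cancel₀ _ ha] at hm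

/-- A degenerate triangle: every number between `a` and `b` lies between `0` and `a` or between `0`
and `b`, so the intermediate segments required by `Seg.sub` are parts of the given ones. -/
theorem Seg.sub_smul {x y₁ y₂ : S} {ζ : ℂ} {a b : ℝ} (h₁ : X.Seg x (a • ζ) y₁)
    (h₂ : X.Seg x (b • ζ) y₂) : X.Seg y₁ ((b - a) • ζ) y₂ := by
  rw [_root_.sub_smul]
  refine h₁.sub h₂ fun ξ hξ => ?_
  rw [segment_eq_image'] at hξ
  obtain ⟨t, ht, rfl⟩ := hξ
  have hc : a • ζ + t • (b • ζ - a • ζ) = (a + t * (b - a)) • ζ := by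
    simp only [Complex.real_smul]; push_cast; ring
  simp only [hc]
  have hmem : a + t * (b - a) ∈ uIcc 0 a ∪ uIcc 0 b := by
    apply uIcc_subset_uIcc_union_uIcc (b := 0) (a := a) (c := b) |>.trans _
    · rcases le_total a b with hab | hab
      · rw [uIcc_of_le hab]; constructor <;> nlinarith [ht.1, ht.2]
      · rw [uIcc_of_ge hab]; constructor <;> nlinarith [ht.1, ht.2]
    · rw [uIcc_comm a 0]
  rcases hmem with hm | hm
  · exact h₁.exists_smul_of_mem hm
  · exact h₂.exists_smul_of_mem hm

theorem Seg.trans_smul {x y w : S} {ζ : ℂ} {a b : ℝ} (h₁ : X.Seg x (a • ζ) y)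
    (h₂ : X.Seg y (b • ζ) w) : X.Seg x ((a + b) • ζ) w := by
  have h3 : X.Seg y ((-a) • ζ) x := by simpa using h₁.symm
  have := h3.sub_smul h₂
  rwa [sub_neg_eq_add, add_comm] at this

theorem IsStraightLine.isFlatOn {v : ℂ} {γ : ℝ → S} (h : X.IsStraightLine v γ) :
    X.IsFlatOn (fun t : ℝ => t • v) γ univ := by
  refine fun t _ => ⟨h.2.1 t, h.1.continuousWithinAt, fun e he hx => ?_⟩
  rw [nhdsWithin_univ]
  filter_upwards [h.2.2 t e he hx] with s hs
  rw [hs, _root_.sub_smul]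

theorem IsFlatOn.isStraightLine {v : ℂ} {γ : ℝ → S} (h : X.IsFlatOn (fun t : ℝ => t • v) γ univ) :
    X.IsStraightLine v γ := by
  refine ⟨continuousOn_univ.1 h.continuousOn, fun t => (h t trivial).1, fun t e he hx => ?_⟩
  have := (h t trivial).2.2 e he hx
  rw [nhdsWithin_univ] at this
  filter_upwards [this] with s hs
  rw [hs, _root_.sub_smul]

theorem IsFlatOn.seg_line {v : ℂ} {γ : ℝ → S} {I : Set ℝ} (hI : I.OrdConnected)
    (h : X.IsFlatOn (fun t : ℝ => t • v) γ I) {a b : ℝ} (ha : a ∈ I) (hb : b ∈ I) :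
    X.Seg (γ a) ((b - a) • v) (γ b) := by
  have := h.seg_of_convex (a := a) (b := b) (hI.convex.segment_subset ha hb)
    (fun t => by simp; ring)
  rwa [← _root_.sub_smul] at this

theorem IsStraightLine.seg {v : ℂ} {γ : ℝ → S} (h : X.IsStraightLine v γ) (a b : ℝ) :
    X.Seg (γ a) ((b - a) • v) (γ b) :=
  h.isFlatOn.seg_line ordConnected_univ trivial trivial

theorem IsFlatOn.of_seg_line {v : ℂ} {γ : ℝ → S} {I : Set ℝ} {x : S} (hx : x ∉ X.sing)
    (c : ℝ) (h : ∀ t ∈ I, X.Seg x ((t - c) • v) (γ t)) :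
    X.IsFlatOn (fun t : ℝ => t • v) γ I :=
  (IsFlatOn.of_seg_const hx (a := fun t : ℝ => (t - c) • v) (by fun_prop) h).congr_dev
    (c := c • v) fun t _ => by rw [_root_.sub_smul]; ring

end Segments

end TranslationStructure

/-! ### Local primitives of the differential, trapping near a point, and the systole. -/

namespace TranslationStructure

open Set Metric

section LocalPrimitive

variable {S : Type*} [TopologicalSpace S] (X : TranslationStructure S)

/-- A local primitive of the differential on a neighbourhood `U` of a (possibly singular) point. -/
structure LocalPrimitive (p : S) (U : Set S) (f : S → ℂ) : Prop where
  isOpen : IsOpen U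
  mem : p ∈ U
  continuousOn : ContinuousOn f U
  map_self : f p = 0
  eq_of_map_eq_zero : ∀ x ∈ U, f x = 0 → x = p
  fibre : ∃ N : ℕ, ∀ ζ, ∃ F : Finset S, F.card ≤ N ∧ ∀ x ∈ U, f x = ζ → x ∈ F
  chart : ∀ e ∈ X.charts, ∀ x ∈ U, x ∈ e.source → ∃ c : ℂ, ∀ᶠ y in 𝓝 x, e y = f y + c

/-- At a cone point the primitive is `φ ^ k`, whose fibres are bounded by the number of `k`-th
roots; at a regular point it is a chart, normalised to vanish at `p`. -/
theorem exists_localPrimitive (p : S) : ∃ U f, X.LocalPrimitive p U f := by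
  by_cases hp : p ∈ X.sing
  · obtain ⟨k, hk, φ, hpφ, h0, -, hφ⟩ := X.cone p hp
    refine ⟨φ.source, fun x => φ x ^ k, φ.open_source, hpφ, φ.continuousOn.pow k, ?_, ?_, ?_, ?_⟩
    · simp [h0]; omega
    · intro x hx h
      exact φ.injOn hx hpφ (by rw [h0]; exact pow_eq_zero_iff (by omega) |>.1 h)
    · refine ⟨k, fun ζ => ?_⟩
      classical
      refine ⟨((Polynomial.nthRoots k ζ).toFinset).image φ.symm, ?_, fun x hx h => ?_⟩
      · exact Finset.card_image_le.trans
          ((Multiset.toFinset_card_le _).trans (Polynomial.card_nthRoots k ζ))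
      · rw [Finset.mem_image]
        refine ⟨φ x, ?_, φ.left_inv hx⟩
        rw [Multiset.mem_toFinset, Polynomial.mem_nthRoots (by omega)]
        exact h
    · exact fun e he x hx hxe => hφ e he x ⟨hx, hxe⟩
  · obtain ⟨e, he, hxe⟩ := X.exists_chart p hp
    refine ⟨e.source, fun x => e x - e p, e.open_source, hxe, by
      exact e.continuousOn.sub continuousOn_const, by simp, ?_, ?_, ?_⟩
    · exact fun x hx h => e.injOn hx hxe (sub_eq_zero.1 h)
    · refine ⟨1, fun ζ => ⟨{e.symm (ζ + e p)}, by simp, fun x hx h => ?_⟩⟩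
      simp [← h, e.left_inv hx]
    · intro e' he' x hx hx'
      obtain ⟨c, hc⟩ := X.transition e he e' he' x ⟨hx, hx'⟩
      refine ⟨c + e p, hc.mono fun y hy => ?_⟩
      rw [hy]; ring

variable {X} {Z : Type*} [TopologicalSpace Z] {d : Z → ℂ} {Φ : Z → S} {s : Set Z}
  {p : S} {U : Set S} {f : S → ℂ}

theorem LocalPrimitive.eventually_sub_eq (hf : X.LocalPrimitive p U f) {z : Z}
    (h : X.FlatAt d Φ s z) (hz : Φ z ∈ U) :
    ∀ᶠ z' in 𝓝[s] z, f (Φ z') - f (Φ z) = d z' - d z := by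
  obtain ⟨e, he, hxe⟩ := X.exists_chart _ h.1
  obtain ⟨c, hc⟩ := hf.chart e he _ hz hxe
  filter_upwards [h.2.2 e he hxe, h.2.1.eventually hc] with z' h₁ h₂
  have h₃ := hc.self_of_nhds
  linear_combination h₁ - h₂ + h₃

theorem LocalPrimitive.sub_eq (hf : X.LocalPrimitive p U f) (hs : IsPreconnected s)
    (h : X.IsFlatOn d Φ s) (hU : MapsTo Φ s U) {a b : Z} (ha : a ∈ s) (hb : b ∈ s) :
    f (Φ b) - f (Φ a) = d b - d a := by
  have := hs.imp_of_eventually_iff (p := fun z => f (Φ z) - f (Φ a) = d z - d a)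
    (fun z hz => ?_) ha hb (by simp)
  · exact this
  · filter_upwards [hf.eventually_sub_eq (h z hz) (hU hz)] with y hy
    constructor <;> intro heq
    · linear_combination heq - hy
    · linear_combination heq + hy

/-- A flat map which starts close to `p` and has small displacements stays close to `p`. -/
theorem exists_trap [T2Space S] [CompactSpace S] (X : TranslationStructure S) (p : S) {W : Set S}
    (hW : W ∈ 𝓝 p) : ∃ V ∈ 𝓝 p, ∃ η > 0, ∀ (d : ℝ → ℂ) (Φ : ℝ → S) (s : Set ℝ) (a : ℝ),
      IsPreconnected s → X.IsFlatOn d Φ s → a ∈ s → Φ a ∈ V → (∀ b ∈ s, ‖d b - d a‖ < η) →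
      MapsTo Φ s W := by
  obtain ⟨U, f, hf⟩ := X.exists_localPrimitive p
  obtain ⟨K, hK, hKc, hKW⟩ := exists_mem_nhds_isClosed_subset
    (inter_mem hW (hf.isOpen.mem_nhds hf.mem))
  set N := interior K
  have hNp : p ∈ N := mem_interior_iff_mem_nhds.2 hK
  have hNK : closure N ⊆ K := hKc.closure_interior_subset
  -- On the compact frontier `f` has no zero. A path starting where `‖f‖ < η` and moving by less
  -- than `η` keeps `‖f‖ < 2 * η`, so it cannot cross the frontier.
  obtain ⟨η, hη, hfr⟩ : ∃ η > 0, ∀ x ∈ frontier N, 2 * η ≤ ‖f x‖ := by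
    rcases (frontier N).eq_empty_or_nonempty with h | h
    · exact ⟨1, one_pos, by simp [h]⟩
    · have hsub : frontier N ⊆ U := fun x hx => (hKW (hNK hx.1)).2
      obtain ⟨x, hx, hmin⟩ := (isClosed_frontier (s := N)).isCompact.exists_isMinOn h
        ((hf.continuousOn.mono hsub).norm)
      refine ⟨‖f x‖ / 2, half_pos (norm_pos_iff.2 fun h0 => ?_), fun y hy => ?_⟩
      · have := hf.eq_of_map_eq_zero x (hsub hx) h0
        rw [this, isOpen_interior.frontier_eq] at hx
        exact hx.2 hNp
      · have : ‖f x‖ ≤ ‖f y‖ := hmin hy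
        linarith
  have hfp : ContinuousAt f p := hf.continuousOn.continuousAt (hf.isOpen.mem_nhds hf.mem)
  refine ⟨N ∩ {x | ‖f x‖ < η}, inter_mem (isOpen_interior.mem_nhds hNp) ?_, η, hη, ?_⟩
  · exact hfp.norm.eventually_lt continuousAt_const (by simpa [hf.map_self])
  intro d Φ s a hs hΦ ha hV hd b hb
  -- Being in `N` is propagated together with the identity between `f` and the developing map, which
  -- is what excludes frontier points.
  have key := hs.imp_of_eventually_iff
    (p := fun z => Φ z ∈ N ∧ f (Φ z) - f (Φ a) = d z - d a) (fun z hz => ?_) ha hb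
    ⟨hV.1, by simp⟩
  · exact (hKW (hNK (subset_closure key.1))).1
  by_cases hzN : Φ z ∈ N
  · filter_upwards [hf.eventually_sub_eq (hΦ z hz) (hKW (hNK (subset_closure hzN))).2,
      (hΦ z hz).2.1.eventually (isOpen_interior.mem_nhds hzN)] with y hy hyN
    refine and_congr (iff_of_true hyN hzN) ⟨fun heq => ?_, fun heq => ?_⟩
    · linear_combination heq - hy
    · linear_combination heq + hy
  by_cases hzU : Φ z ∈ U
  swap
  · have : Φ z ∉ closure N := fun h => hzU (hKW (hNK h)).2
    filter_upwards [(hΦ z hz).2.1.eventually (isClosed_closure.isOpen_compl.mem_nhds this)]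
      with y hy
    exact iff_of_false (fun h => hy (subset_closure h.1)) (fun h => hzN h.1)
  by_cases hzc : Φ z ∈ closure N
  · have h2 : 2 * η ≤ ‖f (Φ z)‖ := hfr _ (by
      rw [isOpen_interior.frontier_eq]; exact ⟨hzc, hzN⟩)
    have h3 : f (Φ z) - f (Φ a) ≠ d z - d a := by
      intro h
      have h4 : f (Φ z) = f (Φ a) + (d z - d a) := by linear_combination h
      have h5 := norm_add_le (f (Φ a)) (d z - d a)
      have h6 : ‖f (Φ a)‖ < η := hV.2
      rw [← h4] at h5
      linarith [hd z hz]
    filter_upwards [hf.eventually_sub_eq (hΦ z hz) hzU] with y hy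
    refine iff_of_false (fun h => h3 ?_) (fun h => h3 h.2)
    linear_combination h.2 - hy
  · filter_upwards [(hΦ z hz).2.1.eventually (isClosed_closure.isOpen_compl.mem_nhds hzc)]
      with y hy
    exact iff_of_false (fun h => hy (subset_closure h.1)) (fun h => hzN h.1)

theorem exists_seg_trap [T2Space S] [CompactSpace S] (X : TranslationStructure S) (p : S)
    {W : Set S} (hW : W ∈ 𝓝 p) : ∃ V ∈ 𝓝 p, ∃ η > 0, ∀ (x y : S) (ζ : ℂ), x ∈ V →
      X.Seg x ζ y → ‖ζ‖ < η → ∃ γ : ℝ → S, X.IsFlatOn (fun t : ℝ => t • ζ) γ (Icc 0 1) ∧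
        γ 0 = x ∧ γ 1 = y ∧ MapsTo γ (Icc 0 1) W := by
  obtain ⟨V, hV, η, hη, H⟩ := X.exists_trap p hW
  refine ⟨V, hV, η, hη, ?_⟩
  rintro _ _ ζ hx ⟨γ, hγ, rfl, rfl⟩ hζ
  refine ⟨γ, hγ, rfl, rfl, H _ γ _ 0 isPreconnected_Icc hγ (by simp) hx fun b hb => ?_⟩
  simp only [zero_smul, sub_zero, norm_smul, Real.norm_eq_abs, abs_of_nonneg hb.1]
  nlinarith [hb.2, norm_nonneg ζ]

/-- There are no short closed geodesics. -/
theorem exists_systole [T2Space S] [CompactSpace S] (X : TranslationStructure S) :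
    ∃ η > 0, ∀ (x : S) (ζ : ℂ), X.Seg x ζ x → ‖ζ‖ < η → ζ = 0 := by
  have := (isCompact_univ (X := S)).induction_on
    (p := fun K => ∃ η > 0, ∀ x ∈ K, ∀ (ζ : ℂ), X.Seg x ζ x → ‖ζ‖ < η → ζ = 0)
    ⟨1, one_pos, by simp⟩ ?_ ?_ ?_
  · simpa using this
  · rintro s t hst ⟨r, hr, h⟩
    exact ⟨r, hr, fun x hx => h x (hst hx)⟩
  · rintro s t ⟨r, hr, h⟩ ⟨r', hr', h'⟩
    refine ⟨min r r', lt_min hr hr', fun x hx ζ hs hζ => ?_⟩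
    rcases hx with hx | hx
    · exact h x hx ζ hs (hζ.trans_le (min_le_left _ _))
    · exact h' x hx ζ hs (hζ.trans_le (min_le_right _ _))
  · intro p _
    obtain ⟨U, f, hf⟩ := X.exists_localPrimitive p
    -- A short closed segment stays in the domain of a local primitive, and its displacement is the
    -- difference of the equal end values.
    obtain ⟨V, hV, η, hη, H⟩ := X.exists_seg_trap p (hf.isOpen.mem_nhds hf.mem)
    refine ⟨V, mem_nhdsWithin_of_mem_nhds hV, η, hη, fun x hx ζ hs hζ => ?_⟩
    obtain ⟨γ, hγ, h0, h1, hU⟩ := H x x ζ hx hs hζ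
    have := hf.sub_eq isPreconnected_Icc hγ hU (a := 0) (b := 1) (by simp) (by simp)
    simpa [h0, h1, eq_comm] using this

end LocalPrimitive

/-! ### Affine maps in terms of segments. -/

section Affine

variable {S : Type*} [TopologicalSpace S] (X : TranslationStructure S)

/-- `g` is affine with linear part `L`, in terms of segments. -/
def IsAffine (L : ℂ →ₗ[ℝ] ℂ) (g : S ≃ₜ S) : Prop :=
  (∀ x, g x ∈ X.sing ↔ x ∈ X.sing) ∧ ∀ x ζ y, X.Seg x ζ y → X.Seg (g x) (L ζ) (g y)

variable {X}

theorem IsAffineAut.isAffine {A : Matrix (Fin 2) (Fin 2) ℝ} {g : S ≃ₜ S}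
    (h : X.IsAffineAut A g) : X.IsAffine (planeAct A) g := by
  refine ⟨h.1, ?_⟩
  rintro _ ζ _ ⟨γ, hγ, rfl, rfl⟩
  refine ⟨g ∘ γ, fun t ht => ?_, rfl, rfl⟩
  have hsing : g (γ t) ∉ X.sing := by rw [h.1]; exact (hγ t ht).1
  obtain ⟨e, he, hxe⟩ := X.exists_chart _ (hγ t ht).1
  obtain ⟨e', he', hxe'⟩ := X.exists_chart _ hsing
  obtain ⟨c, hc⟩ := h.2 e he e' he' _ hxe hxe'
  refine FlatAt.of_chart he' hxe'
    (g.continuous.continuousAt.comp_continuousWithinAt (hγ t ht).2.1) ?_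
  filter_upwards [(hγ t ht).2.1.eventually hc, (hγ t ht).2.2 e he hxe] with t' h₁ h₂
  simp only [Function.comp] at *
  rw [h₁, h₂, hc.self_of_nhds, map_add, map_sub, map_smul, map_smul]
  ring

theorem IsAffine.comp {L L' : ℂ →ₗ[ℝ] ℂ} {g g' : S ≃ₜ S} (h : X.IsAffine L g)
    (h' : X.IsAffine L' g') : X.IsAffine (L ∘ₗ L') (g'.trans g) :=
  ⟨fun x => (h.1 _).trans (h'.1 x), fun _ _ _ hs => h.2 _ _ _ (h'.2 _ _ _ hs)⟩

theorem IsAffine.isStraightLine [T2Space S] {L : ℂ →ₗ[ℝ] ℂ} {g : S ≃ₜ S} (h : X.IsAffine L g)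
    {v : ℂ} {γ : ℝ → S} (hγ : X.IsStraightLine v γ) : X.IsStraightLine (L v) (g ∘ γ) := by
  refine IsFlatOn.isStraightLine (IsFlatOn.of_seg_line (x := g (γ 0)) ?_ 0 fun t _ => ?_)
  · rw [h.1]; exact hγ.2.1 0
  · have := h.2 _ _ _ (hγ.seg 0 t)
    rwa [map_smul] at this

end Affine

/-! ### Rays: running into a singular point or infinite. -/

section Hits

variable {S : Type*} [TopologicalSpace S] [T2Space S] [CompactSpace S] (X : TranslationStructure S)

/-- The straight ray from `x` with velocity `v` runs into a singular point at time `T`. -/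
def HitsAt (v : ℂ) (x : S) (T : ℝ) : Prop :=
  ∃ γ : ℝ → S, (∀ t ∈ Ico 0 T, X.Seg x (t • v) (γ t)) ∧ ∃ p ∈ X.sing, Tendsto γ (𝓝[<] T) (𝓝 p)

variable {X}

/-- Compactness gives a cluster point, and the trap upgrades it to a limit: once the ray is close to
it with little time left, it cannot leave again. -/
theorem exists_tendsto_of_seg {x : S} {v : ℂ} {γ : ℝ → S} {T : ℝ} (hT : 0 < T)
    (h : ∀ t ∈ Ico 0 T, X.Seg x (t • v) (γ t)) : ∃ p, Tendsto γ (𝓝[<] T) (𝓝 p) := by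
  obtain ⟨p, -, hp⟩ := (isCompact_univ (X := S)).exists_mapClusterPt (f := 𝓝[<] T) (u := γ)
    (by simp)
  refine ⟨p, fun W hW => ?_⟩
  obtain ⟨V, hV, η, hη, H⟩ := X.exists_trap p hW
  have hx : x ∉ X.sing := (h 0 (by simp [hT])).left_notMem
  have h1 : ∀ᶠ t in 𝓝[<] T, (T - t) * ‖v‖ < η := by
    have : Continuous fun t => (T - t) * ‖v‖ := by fun_prop
    exact nhdsWithin_le_nhds (this.continuousAt.eventually_lt continuousAt_const (by simpa))
  have h2 : ∀ᶠ t in 𝓝[<] T, t ∈ Ioo 0 T := Ioo_mem_nhdsLT hT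
  obtain ⟨a, haV, ha1, ha2⟩ := ((hp.frequently hV).and_eventually (h1.and h2)).exists
  have hflat : X.IsFlatOn (fun t : ℝ => t • v) γ (Ico a T) :=
    IsFlatOn.of_seg_line hx 0 fun t ht => by simpa using h t ⟨ha2.1.le.trans ht.1, ht.2⟩
  have := H _ γ _ a isPreconnected_Ico hflat (by simp [ha2.2]) haV fun b hb => ?_
  · exact mem_map.2 (mem_of_superset (Ico_mem_nhdsLT ha2.2) this)
  · rw [← _root_.sub_smul, norm_smul, Real.norm_eq_abs, abs_of_nonneg (by linarith [hb.1])]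
    refine lt_of_le_of_lt ?_ ha1
    gcongr
    exact hb.2.le

theorem eventually_exists_seg {p : S} (hp : p ∉ X.sing) :
    ∃ ε > 0, ∀ᶠ y in 𝓝 p, ∀ ζ : ℂ, ‖ζ‖ < ε → ∃ w, X.Seg y ζ w := by
  obtain ⟨e, he, hxe⟩ := X.exists_chart p hp
  obtain ⟨r, hr, h⟩ := exists_ball_subset_target hxe
  refine ⟨r / 2, half_pos hr, ?_⟩
  have h1 : ∀ᶠ y in 𝓝 p, e y ∈ ball (e p) (r / 2) :=
    (e.continuousAt hxe).eventually (ball_mem_nhds _ (half_pos hr))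
  filter_upwards [h1, e.open_source.mem_nhds hxe] with y hy hys ζ hζ
  have hy' : ‖e y - e p‖ < r / 2 := by simpa [dist_eq_norm] using hy
  have h3 := norm_add_le (e y - e p) ζ
  have := seg_chart_symm he h (a := e y - e p) (b := (e y - e p) + ζ) (by linarith) (by linarith)
  rw [add_sub_cancel, add_sub_cancel_left, e.left_inv hys] at this
  exact ⟨_, this⟩

theorem exists_seg_of_tendsto {x p : S} {v : ℂ} {γ : ℝ → S} {T : ℝ} (hT : 0 < T)
    (h : ∀ t ∈ Ico 0 T, X.Seg x (t • v) (γ t)) (hp : p ∉ X.sing)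
    (hγ : Tendsto γ (𝓝[<] T) (𝓝 p)) : ∃ ε > 0, ∀ t < T + ε, 0 ≤ t → ∃ y, X.Seg x (t • v) y := by
  obtain ⟨ε, hε, H⟩ := eventually_exists_seg hp
  have h1 : ∀ᶠ t in 𝓝[<] T, (T - t) * ‖v‖ < ε := by
    have : Continuous fun t => (T - t) * ‖v‖ := by fun_prop
    exact nhdsWithin_le_nhds (this.continuousAt.eventually_lt continuousAt_const (by simpa))
  have h2 : ∀ᶠ t in 𝓝[<] T, t ∈ Ioo 0 T := Ioo_mem_nhdsLT hT
  obtain ⟨a, ha, ha1, ha2⟩ := ((hγ.eventually H).and (h1.and h2)).exists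
  obtain ⟨b, hb, hbT⟩ : ∃ b, (b - a) * ‖v‖ < ε ∧ T < b := by
    have : Continuous fun b => (b - a) * ‖v‖ := by fun_prop
    have h3 : ∀ᶠ b in 𝓝[>] T, (b - a) * ‖v‖ < ε :=
      nhdsWithin_le_nhds (this.continuousAt.eventually_lt continuousAt_const ha1)
    exact (h3.and self_mem_nhdsWithin).exists
  refine ⟨b - T, by linarith, fun t ht h0 => ?_⟩
  rcases lt_or_ge t T with htT | htT
  · exact ⟨_, h t ⟨h0, htT⟩⟩
  obtain ⟨w, hw⟩ := ha ((t - a) • v) (by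
    rw [norm_smul, Real.norm_eq_abs, abs_of_nonneg (by linarith [ha2.2])]
    refine lt_of_le_of_lt ?_ hb
    gcongr; linarith)
  refine ⟨w, ?_⟩
  have := (h a ⟨ha2.1.le, ha2.2⟩).trans_smul hw
  rwa [add_sub_cancel] at this

/-- A straight ray either runs into a singular point, or it is infinite. -/
theorem hitsAt_or_forall_seg {x : S} (hx : x ∉ X.sing) (v : ℂ) :
    (∃ T > 0, X.HitsAt v x T) ∨ ∀ T : ℝ, 0 ≤ T → ∃ y, X.Seg x (T • v) y := by
  by_contra! hcon
  obtain ⟨h1, T₁, hT₁, hn⟩ := hcon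
  -- At the supremum of the times of existence the ray has a limit. A regular limit would allow the
  -- ray to be continued, so the limit is singular.
  set A := {T : ℝ | 0 ≤ T ∧ ∃ y, X.Seg x (T • v) y} with hA
  have h0 : (0 : ℝ) ∈ A := ⟨le_rfl, x, by simpa using Seg.refl hx⟩
  have hdown : ∀ a ∈ A, ∀ b, 0 ≤ b → b ≤ a → b ∈ A := by
    rintro a ⟨ha, y, hy⟩ b hb hba
    exact ⟨hb, hy.exists_smul_of_mem (by rw [uIcc_of_le ha]; exact ⟨hb, hba⟩)⟩
  have hub : ∀ a ∈ A, a ≤ T₁ := by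
    intro a ha
    by_contra! hlt
    obtain ⟨-, y, hy⟩ := hdown a ha T₁ hT₁ hlt.le
    exact hn y hy
  have hbdd : BddAbove A := ⟨T₁, hub⟩
  set T := sSup A
  have hlt : ∀ t, 0 ≤ t → t < T → t ∈ A := fun t ht0 ht => by
    obtain ⟨a, ha, hta⟩ := exists_lt_of_lt_csSup ⟨0, h0⟩ ht
    exact hdown a ha t ht0 hta.le
  have hTpos : 0 < T := by
    obtain ⟨ε, hε, H⟩ := exists_short_seg hx
    have hv : 0 < ‖v‖ + 1 := by positivity
    have : ε / 2 / (‖v‖ + 1) ∈ A := by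
      refine ⟨by positivity, H _ ?_⟩
      rw [norm_smul, Real.norm_eq_abs, abs_of_nonneg (by positivity), div_mul_eq_mul_div,
        div_lt_iff₀ hv]
      nlinarith [norm_nonneg v]
    exact lt_of_lt_of_le (by positivity) (le_csSup hbdd this)
  have hex : ∀ t, ∃ y, t ∈ Ico 0 T → X.Seg x (t • v) y := fun t => by
    by_cases ht : t ∈ Ico 0 T
    · obtain ⟨-, y, hy⟩ := hlt t ht.1 ht.2
      exact ⟨y, fun _ => hy⟩
    · exact ⟨x, fun h => (ht h).elim⟩
  choose γ hγ using hex
  obtain ⟨p, hp⟩ := exists_tendsto_of_seg hTpos hγ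
  by_cases hps : p ∈ X.sing
  · exact h1 T hTpos ⟨γ, hγ, p, hps, hp⟩
  · obtain ⟨ε, hε, H⟩ := exists_seg_of_tendsto hTpos hγ hps hp
    have : T + ε / 2 ∈ A := ⟨by linarith, H _ (by linarith) (by linarith)⟩
    linarith [le_csSup hbdd this]

/-- If the rays in both directions are infinite, they form a line. -/
theorem exists_isStraightLine {x : S} {v : ℂ} (hx : x ∉ X.sing)
    (h : ∀ T > 0, ¬ X.HitsAt v x T) (h' : ∀ T > 0, ¬ X.HitsAt (-v) x T) :
    ∃ γ, X.IsStraightLine v γ ∧ γ 0 = x := by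
  have h1 : ∀ T : ℝ, 0 ≤ T → ∃ y, X.Seg x (T • v) y :=
    (hitsAt_or_forall_seg hx v).resolve_left fun ⟨T, hT, hh⟩ => h T hT hh
  have h2 : ∀ T : ℝ, 0 ≤ T → ∃ y, X.Seg x (T • -v) y :=
    (hitsAt_or_forall_seg hx (-v)).resolve_left fun ⟨T, hT, hh⟩ => h' T hT hh
  have h3 : ∀ t : ℝ, ∃ y, X.Seg x (t • v) y := fun t => by
    rcases le_total 0 t with ht | ht
    · exact h1 t ht
    · simpa using h2 (-t) (by linarith)
  choose γ hγ using h3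
  refine ⟨γ, (IsFlatOn.of_seg_line hx 0 fun t _ => by simpa using hγ t).isStraightLine, ?_⟩
  exact (hγ 0).unique (by simpa using Seg.refl hx)

end Hits

end TranslationStructure

/-! ### An iterate fixing all points whose rays hit a singular point. -/

/-- By pigeonhole the point has a period at most `N`, which divides `N!`. The exponent depends only
on the bound `N`, so one iterate serves for all finite sets of that size. -/
theorem iterate_factorial_eq_self {α : Type*} {g : α → α} (hg : Function.Injective g)
    {F : Finset α} {N : ℕ} (hF : F.card ≤ N) {x : α} (hx : ∀ n, g^[n] x ∈ F) :
    g^[N.factorial] x = x := by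
  obtain ⟨i, hi, j, hj, hij, h⟩ := Finset.exists_ne_map_eq_of_card_lt_of_maps_to
    (s := Finset.range (N + 1)) (t := F) (by simpa using Nat.lt_succ_of_le hF)
    (f := fun n => g^[n] x) fun n _ => hx n
  wlog hlt : i < j generalizing i j
  · exact this j hj i hi hij.symm h.symm (lt_of_le_of_ne (not_lt.1 hlt) hij.symm)
  have hper : g^[j - i] x = x := by
    have h2 : g^[i] (g^[j - i] x) = g^[i] x := by
      rw [← Function.iterate_add_apply, Nat.add_sub_cancel' hlt.le]
      exact h.symm
    exact hg.iterate i h2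
  have hdvd : j - i ∣ N.factorial :=
    Nat.dvd_factorial (by omega) (by simp only [Finset.mem_range] at hj; omega)
  obtain ⟨c, hc⟩ := hdvd
  rw [hc]
  exact (Function.IsPeriodicPt.mul_const (show Function.IsPeriodicPt g (j - i) x from hper) c)

/-- Coordinates with respect to a real basis of the plane. -/
theorem exists_plane_coords {v w : ℂ} (h : LinearIndependent ℝ ![v, w]) :
    ∃ α β : ℂ →L[ℝ] ℝ, (∀ ζ, ζ = α ζ • v + β ζ • w) ∧ α v = 1 ∧ β v = 0 ∧ α w = 0 ∧ β w = 1 := by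
  let B := basisOfLinearIndependentOfCardEqFinrank h (by simp)
  have hv : B 0 = v := by simp [B]
  have hw : B 1 = w := by simp [B]
  refine ⟨LinearMap.toContinuousLinearMap (B.coord 0), LinearMap.toContinuousLinearMap (B.coord 1),
    fun ζ => ?_, ?_, ?_, ?_, ?_⟩
  · have := B.sum_repr ζ
    rw [Fin.sum_univ_two, hv, hw] at this
    simpa using this.symm
  · change B.coord 0 v = 1
    rw [← hv]; simp
  · change B.coord 1 v = 0
    rw [← hv]; simp
  · change B.coord 0 w = 0
    rw [← hw]; simp
  · change B.coord 1 w = 1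
    rw [← hw]; simp

namespace TranslationStructure

open Set Metric

section HitsFinite

variable {S : Type*} [TopologicalSpace S] [T2Space S] [CompactSpace S] {X : TranslationStructure S}

theorem HitsAt.map {L : ℂ →ₗ[ℝ] ℂ} {g : S ≃ₜ S} (h : X.IsAffine L g) {v : ℂ} (hv : L v = v)
    {x : S} {T : ℝ} (hx : X.HitsAt v x T) : X.HitsAt v (g x) T := by
  obtain ⟨γ, hγ, p, hp, hlim⟩ := hx
  refine ⟨g ∘ γ, fun t ht => ?_, g p, (h.1 p).2 hp, (g.continuous.tendsto p).comp hlim⟩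
  have := h.2 _ _ _ (hγ t ht)
  rwa [map_smul, hv] at this

theorem HitsAt.of_lt {v : ℂ} {x : S} {T r : ℝ} (h : X.HitsAt v x T) (hr : 0 < r) (hrT : r < T) :
    ∃ y, X.Seg x ((T - r) • v) y ∧ X.HitsAt v y r := by
  obtain ⟨γ, hγ, p, hp, hlim⟩ := h
  refine ⟨γ (T - r), hγ _ ⟨by linarith, by linarith⟩, fun t => γ (T - r + t), fun t ht => ?_,
    p, hp, hlim.comp ?_⟩
  · have := (hγ (T - r) ⟨by linarith, by linarith⟩).sub_smul
      (hγ (T - r + t) ⟨by linarith [ht.1], by linarith [ht.2]⟩)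
    rwa [add_sub_cancel_left] at this
  · have h1 : Tendsto (fun t => T - r + t) (𝓝[<] r) (𝓝 (T - r + r)) :=
      (Continuous.tendsto (by fun_prop) r).mono_left nhdsWithin_le_nhds
    rw [sub_add_cancel] at h1
    refine tendsto_nhdsWithin_iff.2 ⟨h1, ?_⟩
    filter_upwards [self_mem_nhdsWithin] with t ht
    simp only [mem_Iio] at *
    linarith

/-- A ray reaching `q` in a short time `T` lies in the domain of a local primitive `f` at `q`, so
its starting point satisfies `f x = -(T • v)`. The fibres of `f` are bounded, uniformly in `T`. -/
theorem exists_finset_hitsAt (X : TranslationStructure S) (v : ℂ) : ∃ r > 0, ∃ N : ℕ, ∀ T, 0 < T →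
    T ≤ r → ∃ F : Finset S, F.card ≤ N ∧ ∀ x, X.HitsAt v x T → x ∈ F := by
  classical
  have key : ∀ s : Finset S, ∃ r > 0, ∃ N : ℕ, ∀ T, 0 < T → T ≤ r → ∃ F : Finset S,
      F.card ≤ N ∧ ∀ x, ∀ p ∈ s, ∀ γ : ℝ → S, (∀ t ∈ Ico 0 T, X.Seg x (t • v) (γ t)) →
        Tendsto γ (𝓝[<] T) (𝓝 p) → x ∈ F := by
    intro s
    induction s using Finset.induction_on with
    | empty => exact ⟨1, one_pos, 0, fun T _ _ => ⟨∅, by simp, by simp⟩⟩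
    | insert p s _ ih =>
      obtain ⟨r, hr, N, H⟩ := ih
      obtain ⟨U, f, hf⟩ := X.exists_localPrimitive p
      obtain ⟨V, hV, η, hη, htrap⟩ := X.exists_trap p (hf.isOpen.mem_nhds hf.mem)
      obtain ⟨M, hM⟩ := hf.fibre
      have hv : 0 < ‖v‖ + 1 := by positivity
      refine ⟨min r (η / (‖v‖ + 1)), lt_min hr (by positivity), N + M, fun T hT hTr => ?_⟩
      obtain ⟨F, hFN, hF⟩ := H T hT (hTr.trans (min_le_left _ _))
      obtain ⟨G, hGM, hG⟩ := hM (-(T • v))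
      refine ⟨F ∪ G, (Finset.card_union_le _ _).trans (add_le_add hFN hGM),
        fun x q hq γ hγ hlim => ?_⟩
      rw [Finset.mem_union]
      rcases Finset.mem_insert.1 hq with rfl | hq
      swap
      · exact Or.inl (hF x q hq γ hγ hlim)
      right
      have hx : x ∉ X.sing := (hγ 0 (by simp [hT])).left_notMem
      have hγ0 : γ 0 = x := (hγ 0 (by simp [hT])).unique (by simpa using Seg.refl hx)
      have hTη : T * ‖v‖ < η := by
        have h1 := hTr.trans (min_le_right _ _)
        rw [le_div_iff₀ hv] at h1
        nlinarith
      have h2 : ∀ᶠ t in 𝓝[<] T, t ∈ Ioo 0 T := Ioo_mem_nhdsLT hT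
      obtain ⟨a, haV, ha⟩ := ((hlim.eventually hV).and h2).exists
      have hflat : X.IsFlatOn (fun t : ℝ => t • v) γ (Ico 0 T) :=
        IsFlatOn.of_seg_line hx 0 fun t ht => by simpa using hγ t ht
      -- The trap is entered at a time `a` close to `T`, and confines the ray also backwards to its
      -- starting point.
      have hU := htrap _ γ _ a isPreconnected_Ico hflat ⟨ha.1.le, ha.2⟩ haV fun b hb => by
        rw [← _root_.sub_smul, norm_smul, Real.norm_eq_abs]
        refine lt_of_le_of_lt ?_ hTη
        gcongr
        rw [abs_le]; constructor <;> linarith [hb.1, hb.2, ha.1, ha.2]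
      have hsub : ∀ t ∈ Ico 0 T, f (γ t) = f x + t • v := fun t ht => by
        have := hf.sub_eq isPreconnected_Ico hflat hU (a := 0) (by simp [hT]) ht
        rw [hγ0, zero_smul, sub_zero] at this
        rw [← this]; ring
      have hfq : ContinuousAt f q := hf.continuousOn.continuousAt (hf.isOpen.mem_nhds hf.mem)
      have hl1 : Tendsto (fun t => f (γ t)) (𝓝[<] T) (𝓝 (f q)) := hfq.tendsto.comp hlim
      have hl2 : Tendsto (fun t : ℝ => f x + t • v) (𝓝[<] T) (𝓝 (f x + T • v)) :=
        (Continuous.tendsto (by fun_prop) T).mono_left nhdsWithin_le_nhds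
      have hl3 : f q = f x + T • v := tendsto_nhds_unique hl1 (hl2.congr' (by
        filter_upwards [h2] with t ht using (hsub t ⟨ht.1.le, ht.2⟩).symm))
      rw [hf.map_self] at hl3
      refine hG x ?_ (by linear_combination -hl3)
      rw [← hγ0]
      exact hU ⟨le_rfl, hT⟩
  obtain ⟨r, hr, N, H⟩ := key X.finite_sing.toFinset
  refine ⟨r, hr, N, fun T hT hTr => ?_⟩
  obtain ⟨F, hFN, hF⟩ := H T hT hTr
  refine ⟨F, hFN, ?_⟩
  rintro x ⟨γ, hγ, p, hp, hlim⟩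
  exact hF x p (by simpa using hp) γ hγ hlim

theorem IsAffine.iterate {L : ℂ →ₗ[ℝ] ℂ} {g : S ≃ₜ S} (h : X.IsAffine L g) (n : ℕ) :
    ∃ g' : S ≃ₜ S, X.IsAffine (L ^ n) g' ∧ ∀ x, g' x = g^[n] x := by
  induction n with
  | zero => exact ⟨Homeomorph.refl S, ⟨fun x => Iff.rfl, fun _ _ _ h => by simpa using h⟩,
      fun x => rfl⟩
  | succ n ih =>
    obtain ⟨g', hg', hx⟩ := ih
    refine ⟨g.trans g', ?_, fun x => ?_⟩
    · rw [pow_succ]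
      exact hg'.comp h
    · rw [Homeomorph.trans_apply, hx, Function.iterate_succ_apply]

/-- Since `L v = v`, the map preserves hitting times, so for `T ≤ r` it maps a set of at most `N`
points into itself. For larger `T`, slide along the ray until the remaining time is `r`; that point
is fixed, and so is the segment leading to it. -/
theorem IsAffine.exists_iterate_fixed {L : ℂ →ₗ[ℝ] ℂ} {g : S ≃ₜ S} (h : X.IsAffine L g) {v : ℂ}
    (hv : L v = v) : ∃ n > 0, ∀ x T, 0 < T → X.HitsAt v x T → g^[n] x = x := by
  obtain ⟨r, hr, N, H⟩ := X.exists_finset_hitsAt v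
  have hit : ∀ n x T, X.HitsAt v x T → X.HitsAt v (g^[n] x) T := by
    intro n
    induction n with
    | zero => exact fun x T h => h
    | succ n ih =>
      intro x T hx
      rw [Function.iterate_succ_apply]
      exact ih _ _ (hx.map h hv)
  have small : ∀ x T, 0 < T → T ≤ r → X.HitsAt v x T → g^[N.factorial] x = x := by
    intro x T hT hTr hx
    obtain ⟨F, hFN, hF⟩ := H T hT hTr
    exact iterate_factorial_eq_self g.injective hFN fun n => hF _ (hit n x T hx)
  refine ⟨N.factorial, Nat.factorial_pos N, fun x T hT hx => ?_⟩
  rcases le_or_gt T r with hTr | hTr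
  · exact small x T hT hTr hx
  · obtain ⟨y, hxy, hy⟩ := hx.of_lt hr hTr
    obtain ⟨g', hg', hgx⟩ := h.iterate N.factorial
    have h1 := hg'.2 _ _ _ hxy
    have hLv : ∀ n : ℕ, (L ^ n) v = v := fun n => by
      induction n with
      | zero => simp
      | succ n ih => rw [pow_succ, Module.End.mul_apply, hv, ih]
    rw [map_smul, hLv, hgx, hgx, small y r hr le_rfl hy] at h1
    exact h1.unique_left hxy

end HitsFinite

/-! ### Straight lines: local injectivity and recurrence. -/

section Lines

variable {S : Type*} [TopologicalSpace S] [T2Space S] [CompactSpace S] {X : TranslationStructure S}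

theorem IsStraightLine.periodic_of_eq {v : ℂ} {γ : ℝ → S} (h : X.IsStraightLine v γ) {a b : ℝ}
    (hab : γ a = γ b) : Function.Periodic γ (b - a) := by
  intro t
  have h1 := h.seg b (t + (b - a))
  have h2 := h.seg a t
  rw [hab] at h2
  have : t + (b - a) - b = t - a := by ring
  rw [this] at h1
  exact h1.unique h2

theorem IsStraightLine.ext {v : ℂ} {γ γ' : ℝ → S} (h : X.IsStraightLine v γ)
    (h' : X.IsStraightLine v γ') {a : ℝ} (hab : γ a = γ' a) : γ = γ' := by
  funext t
  have h1 := h.seg a t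
  rw [hab] at h1
  exact h1.unique (h'.seg a t)

theorem IsStraightLine.comp_add {v : ℂ} {γ : ℝ → S} (h : X.IsStraightLine v γ) (c : ℝ) :
    X.IsStraightLine v (fun t => γ (c + t)) := by
  refine IsFlatOn.isStraightLine (IsFlatOn.of_seg_line (h.2.1 (c + 0)) 0 fun t _ => ?_)
  have := h.seg (c + 0) (c + t)
  rwa [add_sub_add_left_eq_sub] at this

theorem IsStraightLine.comp_mul {v : ℂ} {γ : ℝ → S} (h : X.IsStraightLine v γ) (c : ℝ) :
    X.IsStraightLine (c • v) (fun t => γ (c * t)) := by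
  refine IsFlatOn.isStraightLine (IsFlatOn.of_seg_line (h.2.1 (c * 0)) 0 fun t _ => ?_)
  have := h.seg (c * 0) (c * t)
  rwa [← mul_sub, mul_comm c (t - 0), mul_smul] at this

theorem seg_mem_nhds {x : S} (hx : x ∉ X.sing) {W : Set S} (hW : W ∈ 𝓝 x) :
    ∃ ε > 0, ∀ (ζ : ℂ) (y : S), ‖ζ‖ < ε → X.Seg x ζ y → y ∈ W := by
  obtain ⟨e, he, hxe⟩ := X.exists_chart x hx
  obtain ⟨r, hr, h⟩ := exists_ball_subset_target hxe
  have hc : ContinuousAt (fun ζ => e.symm (e x + ζ)) 0 := by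
    have : ContinuousAt e.symm (e x + 0) := e.continuousAt_symm (by simpa using e.map_source hxe)
    exact ContinuousAt.comp (f := fun ζ => e x + ζ) this (by fun_prop)
  obtain ⟨ε, hε, hb⟩ := Metric.mem_nhds_iff.1 (hc (by simpa [e.left_inv hxe] using hW))
  refine ⟨min ε r, lt_min hε hr, fun ζ y hζ hs => ?_⟩
  rw [(hs.chart_of_le he hxe h (hζ.trans_le (min_le_right _ _))).2.2]
  exact hb (by simpa using hζ.trans_le (min_le_left _ _))

theorem seg_injective {x : S} (hx : x ∉ X.sing) :
    ∃ ε > 0, ∀ (ζ ζ' : ℂ) (y : S), ‖ζ‖ < ε → ‖ζ'‖ < ε → X.Seg x ζ y → X.Seg x ζ' y → ζ = ζ' := by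
  obtain ⟨e, he, hxe⟩ := X.exists_chart x hx
  obtain ⟨r, hr, h⟩ := exists_ball_subset_target hxe
  refine ⟨r, hr, fun ζ ζ' y h₁ h₂ hs hs' => ?_⟩
  have h3 := (hs.chart_of_le he hxe h h₁).2.1
  have h4 := (hs'.chart_of_le he hxe h h₂).2.1
  rw [h3] at h4
  exact add_left_cancel h4

/-- Segments with small displacements from a regular point behave as in the plane. -/
theorem exists_seg_sub_of_small {x : S} (hx : x ∉ X.sing) :
    ∃ ε > 0, (∀ ζ : ℂ, ‖ζ‖ < ε → ∃ y, X.Seg x ζ y) ∧ ∀ (ζ ζ' : ℂ) (y y' : S), ‖ζ‖ < ε →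
      ‖ζ'‖ < ε → X.Seg x ζ y → X.Seg x ζ' y' → X.Seg y (ζ' - ζ) y' := by
  obtain ⟨ε, hε, h⟩ := exists_short_seg hx
  refine ⟨ε, hε, h, fun ζ ζ' y y' h₁ h₂ hs hs' => hs.sub hs' fun ξ hξ => h ξ ?_⟩
  have := (convex_ball (0 : ℂ) ε).segment_subset (by simpa using h₁) (by simpa using h₂) hξ
  simpa using this

/-- Straight lines return to a compact set of regular points. -/
theorem exists_isCompact_regular (X : TranslationStructure S) :
    ∃ K : Set S, IsCompact K ∧ (∀ x ∈ K, x ∉ X.sing) ∧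
      ∀ (v : ℂ) (γ : ℝ → S), v ≠ 0 → X.IsStraightLine v γ → ∀ a, ∃ t ≥ a, γ t ∈ K := by
  obtain ⟨D, hD, hDdisj⟩ := X.finite_sing.t2_separation
  -- No line stays near `p` for ever: a local primitive grows linearly along the line, but is
  -- bounded near `p`.
  have hW : ∀ p, ∃ W : Set S, IsOpen W ∧ p ∈ W ∧ W ⊆ D p ∧
      ∀ (v : ℂ) (γ : ℝ → S), v ≠ 0 → X.IsStraightLine v γ → ∀ a, ¬ ∀ t ≥ a, γ t ∈ W := by
    intro p
    obtain ⟨U, f, hf⟩ := X.exists_localPrimitive p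
    have hfp : ContinuousAt f p := hf.continuousOn.continuousAt (hf.isOpen.mem_nhds hf.mem)
    have h1 : ∀ᶠ x in 𝓝 p, ‖f x‖ < 1 :=
      hfp.norm.eventually_lt continuousAt_const (by simp [hf.map_self])
    obtain ⟨W, hWs, hWo, hpW⟩ := mem_nhds_iff.1 (inter_mem h1 (inter_mem
      (hf.isOpen.mem_nhds hf.mem) ((hD p).2.mem_nhds (hD p).1)))
    refine ⟨W, hWo, hpW, fun x hx => (hWs hx).2.2, fun v γ hv hγ a h => ?_⟩
    have hv' : 0 < ‖v‖ := norm_pos_iff.2 hv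
    -- After the time `3 / ‖v‖` the displacement has norm `3`, while two values of `f` on `W` differ
    -- by less than `2`.
    have hb : a + 3 / ‖v‖ ∈ Ici a := by
      simp only [mem_Ici, le_add_iff_nonneg_right]; positivity
    have h2 := hf.sub_eq (isPreconnected_Ici (a := a)) (hγ.isFlatOn.mono (subset_univ _))
      (fun t ht => (hWs (h t ht)).2.1) (a := a) (b := a + 3 / ‖v‖) (mem_Ici.2 le_rfl) hb
    have h3 : ‖f (γ a)‖ < 1 := (hWs (h a le_rfl)).1
    have h4 : ‖f (γ (a + 3 / ‖v‖))‖ < 1 := (hWs (h _ hb)).1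
    have h5 := norm_sub_le (f (γ (a + 3 / ‖v‖))) (f (γ a))
    rw [h2, ← _root_.sub_smul, add_sub_cancel_left, norm_smul, Real.norm_eq_abs,
      abs_of_nonneg (by positivity), div_mul_cancel₀ _ hv'.ne'] at h5
    linarith
  choose W hWo hpW hWD hWγ using hW
  refine ⟨(⋃ p ∈ X.sing, W p)ᶜ, (isOpen_biUnion fun p _ => hWo p).isClosed_compl.isCompact,
    fun x hx hxs => hx (mem_biUnion hxs (hpW x)), fun v γ hv hγ a => ?_⟩
  by_contra! hcon
  simp only [mem_compl_iff, not_not, mem_iUnion] at hcon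
  obtain ⟨p, hp, hap⟩ := hcon a le_rfl
  refine hWγ p v γ hv hγ a ?_
  -- The neighbourhoods of distinct singular points are disjoint, so a ray covered by their union
  -- stays in one of them.
  have hpre : IsPreconnected (γ '' Ici a) := isPreconnected_Ici.image _ hγ.1.continuousOn
  have hsub := hpre.subset_left_of_subset_union (hWo p)
    (isOpen_biUnion (s := X.sing \ {p}) fun q _ => hWo q) ?_ ?_
    ⟨γ a, mem_image_of_mem γ (mem_Ici.2 le_rfl), hap⟩
  · exact fun t ht => hsub ⟨t, ht, rfl⟩
  · rw [disjoint_iUnion₂_right]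
    exact fun q hq => (hDdisj hp hq.1 (fun h => hq.2 h.symm)).mono (hWD p) (hWD q)
  · rintro _ ⟨t, ht, rfl⟩
    obtain ⟨q, hq, htq⟩ := hcon t ht
    by_cases hqp : q = p
    · exact Or.inl (hqp ▸ htq)
    · exact Or.inr (mem_biUnion ⟨hq, hqp⟩ htq)

end Lines

end TranslationStructure

/-! ### Parabolic elements, twists and complete periodicity. -/

/-- A parabolic linear map acts as a shear, up to sign, in every basis that starts with an
eigenvector. -/
theorem Matrix.IsParabolic.exists_eigenvector {P : Matrix (Fin 2) (Fin 2) ℝ} (h : P.IsParabolic)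
    (hdet : P.det = 1) : ∃ v : ℂ, v ≠ 0 ∧ ∃ a : ℝ, a ^ 2 = 1 ∧ planeAct P v = a • v ∧
      ∀ w, LinearIndependent ℝ ![v, w] → ∃ c : ℝ, c ≠ 0 ∧ planeAct P w = a • w + c • v := by
  set a := P.parabolicEigenvalue with ha
  have ha2 : a ^ 2 = 1 := by
    have := h.2
    rw [Matrix.discr_fin_two, hdet] at this
    simp only [ha, Matrix.parabolicEigenvalue]
    linarith
  -- The nilpotent part of `P`: it is nonzero with square zero, so any nonzero value of it is an
  -- eigenvector of `P`.
  set M := planeAct (P - Matrix.scalar _ a) with hM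
  have hMP : ∀ z, M z = planeAct P z - a • z := by
    intro z
    simp only [hM, planeAct, map_sub, LinearMap.sub_apply]
    congr 1
    have : (Matrix.scalar (Fin 2)) a = a • (1 : Matrix (Fin 2) (Fin 2) ℝ) := by
      rw [Matrix.scalar_apply, Matrix.smul_one_eq_diagonal]
    rw [this, map_smul, Matrix.toLin_one]
    simp
  have hM2 : ∀ z, M (M z) = 0 := by
    intro z
    have : M ∘ₗ M = 0 := by
      rw [hM, planeAct, ← Matrix.toLin_mul, ← sq, h.sub_eigenvalue_sq_eq_zero, map_zero]
    exact LinearMap.congr_fun this z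
  have hM0 : M ≠ 0 := by
    intro h0
    have h1 : P - Matrix.scalar _ a = 0 :=
      (Matrix.toLin Complex.basisOneI Complex.basisOneI).map_eq_zero_iff.1 h0
    exact h.1 ⟨a, (sub_eq_zero.1 h1).symm⟩
  obtain ⟨u, hu⟩ : ∃ u, M u ≠ 0 := by
    by_contra! hcon
    exact hM0 (LinearMap.ext hcon)
  refine ⟨M u, hu, a, ha2, ?_, fun w hw => ?_⟩
  · have := hMP (M u)
    rw [hM2] at this
    exact (sub_eq_zero.1 this.symm)
  · obtain ⟨α, β, hαβ, -⟩ := exists_plane_coords hw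
    have hMw : M w = α (M w) • M u + β (M w) • w := hαβ _
    -- Applying `M` once more to the expansion of `M w` isolates the coefficient of `w`, which
    -- therefore vanishes.
    have h1 : β (M w) • M w = 0 := by
      have := congrArg M hMw
      rwa [hM2, map_add, map_smul, map_smul, hM2, smul_zero, zero_add, eq_comm] at this
    have hMw0 : M w ≠ 0 := by
      intro h0
      have := congrArg M (hαβ u)
      rw [map_add, map_smul, map_smul, hM2, h0, smul_zero, smul_zero, add_zero] at this
      exact hu this
    have h2 : β (M w) = 0 := (smul_eq_zero.1 h1).resolve_right hMw0
    rw [h2, zero_smul, add_zero] at hMw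
    refine ⟨α (M w), fun h0 => hMw0 (by rw [hMw, h0, zero_smul]), ?_⟩
    rw [← hMw, hMP]
    ring

namespace TranslationStructure

open Set Metric

section Twists

variable {S : Type*} [TopologicalSpace S] [T2Space S] [CompactSpace S] (X : TranslationStructure S)

/-- The ray from `x` in one of the directions `v`, `-v` runs into a singular point. -/
def Hits (v : ℂ) (x : S) : Prop := ∃ T > 0, X.HitsAt v x T ∨ X.HitsAt (-v) x T

/-- An affine map which fixes all the regular points whose leaf in the direction `v` runs into a
singular point, and whose derivative is a shear in the direction `v`. -/
structure Twist (v w : ℂ) (t : ℝ) (L : ℂ →ₗ[ℝ] ℂ) (g : S ≃ₜ S) : Prop where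
  affine : X.IsAffine L g
  map_left : L v = v
  map_right : L w = w + t • v
  ne_zero : t ≠ 0
  fixed : ∀ x, X.Hits v x → g x = x

variable {X}

/-- Squaring removes a possible eigenvalue `-1`; the product of two exponents handles the rays in
the directions `v` and `-v` together. The sign of `t` is recorded because a parabolic element and
its inverse have to supply twists of opposite signs. -/
theorem exists_twist {L : ℂ →ₗ[ℝ] ℂ} {g : S ≃ₜ S} (h : X.IsAffine L g) {v w : ℂ} {a c : ℝ}
    (ha : a ^ 2 = 1) (hc : c ≠ 0) (hv : L v = a • v) (hw : L w = a • w + c • v) :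
    ∃ (t : ℝ) (L' : ℂ →ₗ[ℝ] ℂ) (g' : S ≃ₜ S), 0 < t * (a * c) ∧ X.Twist v w t L' g' := by
  have hac : a * c ≠ 0 := mul_ne_zero (by rintro rfl; norm_num at ha) hc
  obtain ⟨g₂, hg₂, hgx⟩ := h.iterate 2
  have hv2 : (L ^ 2) v = v := by
    rw [sq, Module.End.mul_apply, hv, map_smul, hv, smul_smul, ← sq, ha, one_smul]
  have hw2 : (L ^ 2) w = w + (2 * (a * c)) • v := by
    rw [sq, Module.End.mul_apply, hw, map_add, map_smul, map_smul, hv, hw, smul_add, smul_smul,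
      ← sq, ha, one_smul, smul_smul, smul_smul, add_assoc, ← add_smul]
    congr 2; ring
  obtain ⟨n, hn, hfn⟩ := hg₂.exists_iterate_fixed hv2
  obtain ⟨m, hm, hfm⟩ := hg₂.exists_iterate_fixed (v := -v) (by rw [map_neg, hv2])
  obtain ⟨g', hg', hg'x⟩ := hg₂.iterate (n * m)
  have hpow : ∀ k : ℕ, ((L ^ 2) ^ k) v = v ∧ ((L ^ 2) ^ k) w = w + (k * (2 * (a * c))) • v := by
    intro k
    induction k with
    | zero => simp
    | succ k ih =>
      rw [pow_succ, Module.End.mul_apply, Module.End.mul_apply, hv2, hw2, map_add, map_smul, ih.1,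
        ih.2, add_assoc, ← add_smul]
      refine ⟨rfl, ?_⟩
      congr 2; push_cast; ring
  have hnm : (0 : ℝ) < (n * m : ℕ) := by exact_mod_cast Nat.mul_pos hn hm
  refine ⟨(n * m : ℕ) * (2 * (a * c)), (L ^ 2) ^ (n * m), g', ?_, hg', (hpow _).1, (hpow _).2,
    ?_, ?_⟩
  · have := mul_self_pos.2 hac
    nlinarith [mul_pos hnm this]
  · exact mul_ne_zero hnm.ne' (mul_ne_zero two_ne_zero hac)
  · rintro x ⟨T, hT, hx | hx⟩
    · rw [hg'x]
      exact Function.IsPeriodicPt.mul_const (show Function.IsPeriodicPt g₂ n x from hfn x T hT hx) m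
    · rw [hg'x]
      exact Function.IsPeriodicPt.const_mul (show Function.IsPeriodicPt g₂ m x from hfm x T hT hx) n

theorem not_hits_exists_line {v : ℂ} {x : S} (hx : x ∉ X.sing) (h : ¬ X.Hits v x) :
    ∃ γ, X.IsStraightLine v γ ∧ γ 0 = x :=
  exists_isStraightLine hx (fun T hT h' => h ⟨T, hT, Or.inl h'⟩)
    (fun T hT hit => h ⟨T, hT, Or.inr hit⟩)

/-- Close to a regular point, the fixed points of a twist lie on a single leaf. -/
theorem Twist.fixed_isolated {v w : ℂ} {t : ℝ} {L : ℂ →ₗ[ℝ] ℂ} {g : S ≃ₜ S}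
    (h : X.Twist v w t L g) {y : S} (hy : y ∉ X.sing) :
    ∃ ε > 0, ∀ (ζ : ℂ) (m : S), ‖ζ‖ < ε → X.Seg y ζ m → g m = m → L ζ = ζ := by
  by_cases hgy : g y = y
  · obtain ⟨ε, hε, H⟩ := seg_injective hy
    have h1 : ∀ᶠ ζ : ℂ in 𝓝 0, ‖L ζ‖ < ε := by
      have : Continuous L := L.continuous_of_finiteDimensional
      exact (this.norm.continuousAt).eventually_lt continuousAt_const (by simpa)
    obtain ⟨ρ, hρ, hb⟩ := Metric.mem_nhds_iff.1 h1
    refine ⟨min ε ρ, lt_min hε hρ, fun ζ m hζ hs hm => ?_⟩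
    have h2 := h.affine.2 _ _ _ hs
    rw [hgy, hm] at h2
    refine H _ _ _ (hb ?_) (hζ.trans_le (min_le_left _ _)) h2 hs
    simpa using hζ.trans_le (min_le_right _ _)
  · have hW : {x | g x ≠ x} ∈ 𝓝 y :=
      (isClosed_eq g.continuous continuous_id).isOpen_compl.mem_nhds hgy
    obtain ⟨ε, hε, H⟩ := seg_mem_nhds hy hW
    exact ⟨ε, hε, fun ζ m hζ hs hm => (H ζ m hζ hs hm).elim⟩

theorem Twist.map_eq_self_iff {v w : ℂ} {t : ℝ} {L : ℂ →ₗ[ℝ] ℂ} {g : S ≃ₜ S}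
    (h : X.Twist v w t L g) (hv : v ≠ 0) (a b : ℝ) :
    L (a • v + b • w) = a • v + b • w ↔ b = 0 := by
  rw [map_add, map_smul, map_smul, h.map_left, h.map_right, smul_add, ← add_assoc,
    add_eq_left, smul_smul]
  simp [hv, h.ne_zero]

/-- A line which does not close up comes back to a transversal through some regular point. -/
theorem IsStraightLine.exists_return {v w : ℂ} (hvw : LinearIndependent ℝ ![v, w]) {γ : ℝ → S}
    (hγ : X.IsStraightLine v γ) : ∃ y, y ∉ X.sing ∧
      ∀ ε > 0, ∃ᶠ t in atTop, ∃ β : ℝ, |β| < ε ∧ X.Seg y (β • w) (γ t) := by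
  have hv : v ≠ 0 := hvw.ne_zero 0
  obtain ⟨K, hK, hKs, H⟩ := X.exists_isCompact_regular
  have hfr : ∃ᶠ t in atTop, γ t ∈ K := by
    rw [frequently_atTop]
    exact fun a => H v γ hv hγ a
  -- The line returns to a compact set of regular points for arbitrarily large times, so it
  -- accumulates at one of them.
  obtain ⟨y, hyK, hy⟩ := hK.exists_mapClusterPt_of_frequently hfr
  refine ⟨y, hKs y hyK, fun ε hε => ?_⟩
  obtain ⟨α, β, hαβ, -⟩ := exists_plane_coords hvw
  obtain ⟨ε₁, hε₁, hex, hsub⟩ := exists_seg_sub_of_small (hKs y hyK)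
  have h1 : ∀ᶠ ζ : ℂ in 𝓝 0, |β ζ| < ε ∧ ‖β ζ • w‖ < ε₁ ∧ |α ζ| < 1 ∧ ‖ζ‖ < ε₁ := by
    refine Eventually.and ?_ (Eventually.and ?_ (Eventually.and ?_ ?_))
    · exact ContinuousAt.eventually_lt (by fun_prop) continuousAt_const (by simpa)
    · exact ContinuousAt.eventually_lt (by fun_prop) continuousAt_const (by simpa)
    · exact ContinuousAt.eventually_lt (by fun_prop) continuousAt_const (by simp)
    · exact ContinuousAt.eventually_lt (by fun_prop) continuousAt_const (by simpa)
  obtain ⟨ρ, hρ, hb⟩ := Metric.mem_nhds_iff.1 h1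
  rw [frequently_atTop]
  intro a
  obtain ⟨t, hta, ζ, hζ, hs⟩ := frequently_atTop.1
    (hy.frequently (eventually_short_seg (hKs y hyK) hρ)) (a + 1)
  obtain ⟨hb1, hb2, hb3, hb4⟩ := hb (show ζ ∈ ball 0 ρ by simpa using hζ)
  -- Moving along the line by the `v`-coordinate of the displacement puts the return exactly on the
  -- transversal through `y`.
  refine ⟨t - α ζ, by linarith [abs_lt.1 hb3], β ζ, hb1, ?_⟩
  obtain ⟨m, hm⟩ := hex _ hb2
  have h2 := hsub _ _ _ _ hb4 hb2 hs hm
  have h3 := hγ.seg t (t - α ζ)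
  have h4 : β ζ • w - ζ = (t - α ζ - t) • v := by
    have := hαβ ζ
    simp only [Complex.real_smul] at this ⊢
    push_cast
    linear_combination -this
  rw [h4] at h2
  rwa [← h2.unique h3]

/-- Two close returns of a line to a transversal, such that the leaves in between do not run into
singular points, give a closed geodesic. -/
theorem IsStraightLine.seg_of_return {v w : ℂ} {γ : ℝ → S} (hγ : X.IsStraightLine v γ) {y : S}
    (hy : y ∉ X.sing) {t₁ t₂ β₁ β₂ : ℝ} (h₁ : X.Seg y (β₁ • w) (γ t₁))
    (h₂ : X.Seg y (β₂ • w) (γ t₂))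
    (hex : ∀ β ∈ uIcc β₁ β₂, ∃ m, X.Seg y (β • w) m ∧ ¬ X.Hits v m) :
    X.Seg (γ t₂) ((β₂ - β₁) • w - (t₂ - t₁) • v) (γ t₂) := by
  have hm : ∀ β, ∃ m, β ∈ uIcc β₁ β₂ → X.Seg y (β • w) m ∧ ¬ X.Hits v m := fun β => by
    by_cases hβ : β ∈ uIcc β₁ β₂
    · obtain ⟨m, hm⟩ := hex β hβ
      exact ⟨m, fun _ => hm⟩
    · exact ⟨y, fun h => (hβ h).elim⟩
  choose m hm using hm
  have hl : ∀ β, ∃ γ' : ℝ → S, β ∈ uIcc β₁ β₂ → X.IsStraightLine v γ' ∧ γ' 0 = m β := fun β => by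
    by_cases hβ : β ∈ uIcc β₁ β₂
    · obtain ⟨γ', h'⟩ := not_hits_exists_line (hm β hβ).1.right_notMem (hm β hβ).2
      exact ⟨γ', fun _ => h'⟩
    · exact ⟨γ, fun h => (hβ h).elim⟩
  choose ℓ hℓ using hl
  -- The complete leaves through the piece of transversal form an immersed band.
  have hflat : X.IsFlatOn (fun p : ℝ × ℝ => p.2 • w + p.1 • v) (fun p => ℓ p.2 p.1)
      (univ ×ˢ uIcc β₁ β₂) := by
    refine IsFlatOn.of_seg (d := fun p : ℝ × ℝ => p.2 • w) (Ψ := fun p : ℝ × ℝ => m p.2) ?_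
      (by fun_prop) (by fun_prop) fun p hp => ?_
    · exact IsFlatOn.of_seg_const hy (by fun_prop) fun p hp => (hm p.2 hp.2).1
    · obtain ⟨h3, h4⟩ := hℓ p.2 hp.2
      have := h3.seg 0 p.1
      rwa [h4, sub_zero] at this
  -- Both ends of this segment in the parameter band represent `γ t₂`: once as the continuation of
  -- the first return, once as the second return itself.
  have key := hflat.seg_of_convex (a := (t₂ - t₁, β₁)) (b := (0, β₂))
    ((convex_univ.prod (convex_uIcc β₁ β₂)).segment_subset ⟨trivial, left_mem_uIcc⟩
      ⟨trivial, right_mem_uIcc⟩) (fun t => by simp; ring)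
  have e1 : ℓ β₁ (t₂ - t₁) = γ t₂ := by
    obtain ⟨h3, h4⟩ := hℓ β₁ left_mem_uIcc
    have h5 := h3.seg 0 (t₂ - t₁)
    rw [h4, (hm β₁ left_mem_uIcc).1.unique h₁, sub_zero] at h5
    exact h5.unique (hγ.seg t₁ t₂)
  have e2 : ℓ β₂ 0 = γ t₂ := by
    rw [(hℓ β₂ right_mem_uIcc).2, (hm β₂ right_mem_uIcc).1.unique h₂]
  simp only [e1, e2] at key
  convert key using 1
  simp only [Complex.real_smul]; push_cast; ring

/-- Closed geodesics which are almost parallel to the shear of a twist are impossible. -/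
theorem Twist.false_of_closed {v w : ℂ} {t : ℝ} {L : ℂ →ₗ[ℝ] ℂ} {g : S ≃ₜ S}
    (h : X.Twist v w t L g) (hvw : LinearIndependent ℝ ![v, w]) {η : ℝ}
    (hsys : ∀ (x : S) (ζ : ℂ), X.Seg x ζ x → ‖ζ‖ < η → ζ = 0) {κ T : ℝ} (hT : 0 ≤ T)
    (hκt : 0 < κ * t) (hκ : |κ| * (‖w‖ + |t| * ‖v‖) < η) {x : S}
    (hx : X.Seg x (κ • w - T • v) x) : False := by
  -- The `n`-th power of the twist changes the `v`-coordinate of the closed geodesic from `-T` to `n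
  -- * (κ * t) - T`, of size at most `κ * t`. The image is shorter than `η`, yet it keeps the
  -- nonzero `w`-coordinate `κ`.
  set n := ⌊T / (κ * t)⌋₊
  obtain ⟨g', hg', -⟩ := h.affine.iterate n
  have hpow : ∀ k : ℕ, (L ^ k) (κ • w - T • v) = κ • w + (k * (κ * t) - T) • v := by
    intro k
    have h1 : (L ^ k) v = v ∧ (L ^ k) w = w + (k * t) • v := by
      induction k with
      | zero => simp
      | succ k ih =>
        rw [pow_succ, Module.End.mul_apply, Module.End.mul_apply, h.map_left, h.map_right, map_add,
          map_smul, ih.1, ih.2, add_assoc, ← add_smul]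
        refine ⟨rfl, ?_⟩
        congr 2; push_cast; ring
    rw [map_sub, map_smul, map_smul, h1.1, h1.2]
    simp only [Complex.real_smul]; push_cast; ring
  have h1 := hg'.2 _ _ _ hx
  rw [hpow] at h1
  have hn1 : n * (κ * t) ≤ T := by
    rw [← le_div_iff₀ hκt]; exact Nat.floor_le (by positivity)
  have hn2 : T < (n + 1) * (κ * t) := by
    rw [← div_lt_iff₀ hκt]; exact Nat.lt_floor_add_one _
  have h2 := hsys _ _ h1 ?_
  · have h3 := LinearIndependent.pair_iff.1 hvw (n * (κ * t) - T) κ (by rw [← h2]; ring)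
    rw [h3.2] at hκt
    simp at hκt
  · refine (norm_add_le _ _).trans_lt (lt_of_le_of_lt ?_ hκ)
    rw [norm_smul, norm_smul, Real.norm_eq_abs, Real.norm_eq_abs, mul_add, ← mul_assoc |κ| |t|,
      ← abs_mul]
    have h9 : |n * (κ * t) - T| ≤ |κ * t| := by
      rw [abs_of_pos hκt, abs_le]
      constructor <;> linarith
    exact add_le_add le_rfl (mul_le_mul_of_nonneg_right h9 (norm_nonneg _))

/-- The direction of a twist is completely periodic. -/
theorem Twist.isCompletelyPeriodic {v w : ℂ} {t t' : ℝ} {L L' : ℂ →ₗ[ℝ] ℂ} {g g' : S ≃ₜ S}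
    (h : X.Twist v w t L g) (h' : X.Twist v w t' L' g') (htt : t * t' < 0)
    (hvw : LinearIndependent ℝ ![v, w]) : X.IsCompletelyPeriodic v := by
  have hv : v ≠ 0 := hvw.ne_zero 0
  have hw : w ≠ 0 := hvw.ne_zero 1
  refine ⟨hv, fun γ hγ => ?_⟩
  by_contra hper
  have hinj : Function.Injective γ := by
    intro a b hab
    by_contra hne
    rcases lt_or_gt_of_ne hne with hlt | hlt
    · exact hper ⟨b - a, by linarith, hγ.periodic_of_eq hab⟩
    · exact hper ⟨a - b, by linarith, hγ.periodic_of_eq hab.symm⟩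
  obtain ⟨y, hy, hret⟩ := hγ.exists_return hvw
  obtain ⟨η, hη, hsys⟩ := X.exists_systole
  obtain ⟨ε₀, hε₀, hfix⟩ := h.fixed_isolated hy
  obtain ⟨ε₁, hε₁, hex⟩ := exists_short_seg hy
  have hw' : 0 < ‖w‖ := norm_pos_iff.2 hw
  set M := ‖w‖ + (|t| + |t'|) * ‖v‖ with hM
  have hMpos : 0 < M := by positivity
  obtain ⟨ε, hε, hεw, hεη⟩ : ∃ ε > 0, ε * ‖w‖ < min ε₀ ε₁ ∧ 2 * ε * M < η := by
    have h1 : ∀ᶠ ε : ℝ in 𝓝 0, ε * ‖w‖ < min ε₀ ε₁ :=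
      ContinuousAt.eventually_lt (by fun_prop) continuousAt_const (by simp [hε₀, hε₁])
    have h2 : ∀ᶠ ε : ℝ in 𝓝 0, 2 * ε * M < η :=
      ContinuousAt.eventually_lt (by fun_prop) continuousAt_const (by simpa)
    have h3 := ((h1.and h2).filter_mono (nhdsWithin_le_nhds (s := Ioi 0))).and
      self_mem_nhdsWithin
    obtain ⟨ε, ⟨h4, h5⟩, h6⟩ := h3.exists
    exact ⟨ε, h6, h4, h5⟩
  -- Points hitting a singularity are fixed by the twist, and close to `y` its fixed points all have
  -- the same `w`-coordinate as `y`.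
  have key : ∀ β : ℝ, |β| < ε → β ≠ 0 → ∃ m, X.Seg y (β • w) m ∧ ¬ X.Hits v m := by
    intro β hβ hβ0
    have hn : ‖β • w‖ < min ε₀ ε₁ := by
      rw [norm_smul, Real.norm_eq_abs]
      exact lt_of_le_of_lt (by gcongr) hεw
    obtain ⟨m, hm⟩ := hex _ (hn.trans_le (min_le_right _ _))
    refine ⟨m, hm, fun hh => hβ0 ?_⟩
    have h1 := hfix _ _ (hn.trans_le (min_le_left _ _)) hm (h.fixed m hh)
    simpa using (h.map_eq_self_iff hv 0 β).1 (by simpa using h1)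
  -- Two returns on the same side of `y` span an interval of the transversal avoiding `y`, hence a
  -- closed geodesic. Of the two twists, one has the sign that shears it to a shorter one.
  have main : ∀ t₁ t₂ β₁ β₂ : ℝ, t₁ < t₂ → |β₁| < ε → |β₂| < ε → 0 < β₁ * β₂ →
      X.Seg y (β₁ • w) (γ t₁) → X.Seg y (β₂ • w) (γ t₂) → False := by
    intro t₁ t₂ β₁ β₂ ht hβ₁ hβ₂ hpos hs₁ hs₂
    have hne : β₁ ≠ β₂ := by
      rintro rfl
      exact ht.ne (hinj (hs₁.unique hs₂))
    have hc := hγ.seg_of_return hy hs₁ hs₂ fun β hβ => key β ?_ ?_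
    · have hκ : |β₂ - β₁| < 2 * ε := by
        rw [abs_lt] at *
        constructor <;> linarith [hβ₁.1, hβ₁.2, hβ₂.1, hβ₂.2]
      have hκM : |β₂ - β₁| * M < η :=
        lt_of_le_of_lt (mul_le_mul_of_nonneg_right hκ.le hMpos.le) hεη
      have hκ0 : β₂ - β₁ ≠ 0 := sub_ne_zero.2 hne.symm
      rcases lt_or_ge 0 ((β₂ - β₁) * t) with hp | hp
      · refine h.false_of_closed hvw hsys (by linarith) hp (lt_of_le_of_lt ?_ hκM) hc
        exact mul_le_mul_of_nonneg_left (by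
          nlinarith [mul_nonneg (abs_nonneg t') (norm_nonneg v)]) (abs_nonneg _)
      · refine h'.false_of_closed hvw hsys (κ := β₂ - β₁) (by linarith) ?_
          (lt_of_le_of_lt ?_ hκM) hc
        · have : 0 < (β₂ - β₁) ^ 2 := by positivity
          have h5 : ((β₂ - β₁) * t) * ((β₂ - β₁) * t') < 0 := by nlinarith
          by_contra hcon
          nlinarith [mul_nonneg_of_nonpos_of_nonpos hp (not_lt.1 hcon)]
        · exact mul_le_mul_of_nonneg_left (by
            nlinarith [mul_nonneg (abs_nonneg t) (norm_nonneg v)]) (abs_nonneg _)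
    · rw [abs_lt] at *
      rcases mem_uIcc.1 hβ with hβ | hβ <;> constructor <;>
        linarith [hβ.1, hβ.2, hβ₁.1, hβ₁.2, hβ₂.1, hβ₂.2]
    · rintro rfl
      rcases mem_uIcc.1 hβ with hβ | hβ <;> nlinarith [hβ.1, hβ.2]
  -- An injective line passes through `y` at most once, so late returns have `β ≠ 0`, and infinitely
  -- many of them lie on one side.
  have hfr : ∃ᶠ s in atTop, ∃ β : ℝ, β ≠ 0 ∧ |β| < ε ∧ X.Seg y (β • w) (γ s) := by
    have hev : ∀ᶠ s in atTop, γ s ≠ y := by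
      by_cases hyγ : ∃ s₀, γ s₀ = y
      · obtain ⟨s₀, rfl⟩ := hyγ
        filter_upwards [eventually_gt_atTop s₀] with s hs heq
        exact hs.ne' (hinj heq)
      · exact Eventually.of_forall fun s hs => hyγ ⟨s, hs⟩
    refine ((hret ε hε).and_eventually hev).mono ?_
    rintro s ⟨⟨β, hβ, hs⟩, hne⟩
    refine ⟨β, ?_, hβ, hs⟩
    rintro rfl
    exact hne (hs.unique (by simpa using Seg.refl hy))
  have hfr2 : (∃ᶠ s in atTop, ∃ β : ℝ, 0 < β ∧ |β| < ε ∧ X.Seg y (β • w) (γ s)) ∨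
      ∃ᶠ s in atTop, ∃ β : ℝ, β < 0 ∧ |β| < ε ∧ X.Seg y (β • w) (γ s) := by
    rw [← frequently_or_distrib]
    refine hfr.mono ?_
    rintro s ⟨β, hβ0, hβ⟩
    rcases lt_or_gt_of_ne hβ0 with h0 | h0
    · exact Or.inr ⟨β, h0, hβ⟩
    · exact Or.inl ⟨β, h0, hβ⟩
  rcases hfr2 with hf | hf
  · obtain ⟨s₁, β₁, h1, h2, h3⟩ := hf.exists
    obtain ⟨s₂, ⟨β₂, h4, h5, h6⟩, hlt⟩ := (hf.and_eventually (eventually_gt_atTop s₁)).exists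
    exact main s₁ s₂ β₁ β₂ hlt h2 h5 (mul_pos h1 h4) h3 h6
  · obtain ⟨s₁, β₁, h1, h2, h3⟩ := hf.exists
    obtain ⟨s₂, ⟨β₂, h4, h5, h6⟩, hlt⟩ := (hf.and_eventually (eventually_gt_atTop s₁)).exists
    exact main s₁ s₂ β₁ β₂ hlt h2 h5 (mul_pos_of_neg_of_neg h1 h4) h3 h6

end Twists

end TranslationStructure

/-! ### Closed lines and the periodic part. -/

theorem IsCompact.finite_inter_of_isolated {α : Type*} [TopologicalSpace α] {K A : Set α}
    (hK : IsCompact K) (h : ∀ x ∈ K, ∀ᶠ y in 𝓝[≠] x, y ∉ A) : (A ∩ K).Finite := by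
  by_contra hinf
  obtain ⟨x, hx, hacc⟩ := Set.Infinite.exists_accPt_of_subset_isCompact hinf hK
    Set.inter_subset_right
  rw [accPt_iff_frequently_nhdsNE] at hacc
  obtain ⟨y, hy, hyA⟩ := (hacc.and_eventually (h x hx)).exists
  exact hyA hy.1

namespace TranslationStructure

open Set Metric

section Periodic

variable {S : Type*} [TopologicalSpace S] [T2Space S] [CompactSpace S] {X : TranslationStructure S}

/-- A closed straight line with velocity `v` and minimal period `c`. -/
structure ClosedLine (X : TranslationStructure S) (v : ℂ) (γ : ℝ → S) (c : ℝ) : Prop where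
  line : X.IsStraightLine v γ
  pos : 0 < c
  eq_iff : ∀ a b, γ a = γ b ↔ ∃ n : ℤ, b - a = n * c

theorem ClosedLine.apply_add {v : ℂ} {γ : ℝ → S} {c : ℝ} (h : X.ClosedLine v γ c) (a : ℝ) (n : ℤ) :
    γ (a + n * c) = γ a :=
  ((h.eq_iff _ _).2 ⟨n, by ring⟩).symm

theorem ClosedLine.comp_add {v : ℂ} {γ : ℝ → S} {c : ℝ} (h : X.ClosedLine v γ c) (r : ℝ) :
    X.ClosedLine v (fun t => γ (r + t)) c :=
  ⟨h.line.comp_add r, h.pos, fun a b => by rw [h.eq_iff, add_sub_add_left_eq_sub]⟩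

theorem ClosedLine.comp_mul {v : ℂ} {γ : ℝ → S} {c : ℝ} (h : X.ClosedLine v γ c) {r : ℝ}
    (hr : r ≠ 0) : X.ClosedLine (r • v) (fun t => γ (r * t)) (c / |r|) := by
  refine ⟨h.line.comp_mul r, div_pos h.pos (abs_pos.2 hr), fun a b => ?_⟩
  rw [h.eq_iff]
  have key : ∀ n : ℤ, r * b - r * a = n * c ↔ b - a = n * (c / r) := fun n => by
    rw [← mul_sub, ← mul_div_assoc, eq_div_iff hr, mul_comm]
  simp only [key]
  rcases abs_choice r with h' | h' <;> rw [h']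
  constructor
  · rintro ⟨n, hn⟩; exact ⟨-n, by rw [hn]; push_cast; ring⟩
  · rintro ⟨n, hn⟩; exact ⟨-n, by rw [hn]; push_cast; ring⟩

theorem ClosedLine.map {v : ℂ} {γ : ℝ → S} {c : ℝ} (h : X.ClosedLine v γ c) {L : ℂ →ₗ[ℝ] ℂ}
    {g : S ≃ₜ S} (hg : X.IsAffine L g) : X.ClosedLine (L v) (g ∘ γ) c :=
  ⟨hg.isStraightLine h.line, h.pos, fun a b => by
    rw [← h.eq_iff]; exact g.injective.eq_iff⟩

theorem ClosedLine.exists_mem_Ico {v : ℂ} {γ : ℝ → S} {c : ℝ} (h : X.ClosedLine v γ c) (a : ℝ) :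
    ∃ b ∈ Ico 0 c, γ b = γ a := by
  refine ⟨toIcoMod h.pos 0 a, by simpa using toIcoMod_mem_Ico h.pos 0 a, (h.eq_iff _ _).2
    ⟨toIcoDiv h.pos 0 a, ?_⟩⟩
  have := toIcoMod_add_toIcoDiv_zsmul h.pos 0 a
  rw [zsmul_eq_mul] at this
  linarith

theorem ClosedLine.range_eq {v : ℂ} {γ : ℝ → S} {c : ℝ} (h : X.ClosedLine v γ c) :
    range γ = γ '' Icc 0 c := by
  refine Subset.antisymm ?_ (image_subset_range _ _)
  rintro _ ⟨a, rfl⟩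
  obtain ⟨b, hb, hba⟩ := h.exists_mem_Ico a
  exact ⟨b, ⟨hb.1, hb.2.le⟩, hba⟩

theorem ClosedLine.isCompact_range {v : ℂ} {γ : ℝ → S} {c : ℝ} (h : X.ClosedLine v γ c) :
    IsCompact (range γ) := by
  rw [h.range_eq]
  exact isCompact_Icc.image h.line.1

theorem exists_line_of_seg {v : ℂ} {x : S} {c : ℝ} (hc : 0 < c) (h : X.Seg x (c • v) x) :
    ∃ γ, X.IsStraightLine v γ ∧ γ 0 = x := by
  have hn : ∀ n : ℕ, X.Seg x ((n * c) • v) x := fun n => by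
    induction n with
    | zero => simpa using Seg.refl h.left_notMem
    | succ n ih =>
      have := ih.trans_smul h
      convert this using 2
      push_cast; ring
  have hex : ∀ t : ℝ, ∃ y, X.Seg x (t • v) y := fun t => by
    obtain ⟨n, hnt⟩ := exists_nat_ge (|t| / c)
    rw [div_le_iff₀ hc] at hnt
    rcases le_total 0 t with ht | ht
    · rw [abs_of_nonneg ht] at hnt
      exact (hn n).exists_smul_of_mem (by rw [uIcc_of_le (by positivity)]; exact ⟨ht, hnt⟩)
    · rw [abs_of_nonpos ht] at hnt
      have h1 : X.Seg x ((-(n * c)) • v) x := by simpa using (hn n).symm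
      exact h1.exists_smul_of_mem (by
        rw [uIcc_of_ge (by simpa using by positivity)]; constructor <;> linarith)
  choose γ hγ using hex
  refine ⟨γ, (IsFlatOn.of_seg_line h.left_notMem 0 fun t _ => by simpa using hγ t).isStraightLine,
    (hγ 0).unique (by simpa using Seg.refl h.left_notMem)⟩

theorem mem_periodicPart_iff {v : ℂ} {x : S} :
    x ∈ X.periodicPart v ↔ ∃ c : ℝ, 0 < c ∧ X.Seg x (c • v) x := by
  constructor
  · rintro ⟨γ, hγ, rfl, T, hT, hper⟩
    refine ⟨T, hT, ?_⟩
    have h1 := hγ.seg 0 T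
    have h2 := hper 0
    rw [zero_add] at h2
    rwa [h2, sub_zero] at h1
  · rintro ⟨c, hc, h⟩
    obtain ⟨γ, hγ, rfl⟩ := exists_line_of_seg hc h
    have : γ 0 = γ c := h.unique (by simpa using hγ.seg 0 c)
    exact ⟨γ, hγ, rfl, c, hc, by simpa using hγ.periodic_of_eq this⟩

theorem notMem_sing_of_mem_periodicPart {v : ℂ} {x : S} (h : x ∈ X.periodicPart v) :
    x ∉ X.sing := by
  obtain ⟨c, hc, h⟩ := mem_periodicPart_iff.1 h
  exact h.left_notMem

theorem exists_seg_of_mem_periodicPart {v : ℂ} {x : S} (h : x ∈ X.periodicPart v) (s : ℝ) :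
    ∃ y, X.Seg x (s • v) y := by
  obtain ⟨γ, hγ, rfl, -⟩ := h
  exact ⟨γ s, by simpa using hγ.seg 0 s⟩

theorem Seg.mem_periodicPart {v : ℂ} {x y : S} {s : ℝ} (h : X.Seg x (s • v) y)
    (hx : x ∈ X.periodicPart v) : y ∈ X.periodicPart v := by
  obtain ⟨c, hc, hx⟩ := mem_periodicPart_iff.1 hx
  refine mem_periodicPart_iff.2 ⟨c, hc, ?_⟩
  have h1 : X.Seg y ((-s) • v) x := by simpa using h.symm
  have := (h1.trans_smul hx).trans_smul h
  convert this using 2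
  ring

/-- The periods form a subgroup of `ℝ`, discrete by the bound on the systole and hence cyclic. Its
positive generator is the minimal period. -/
theorem exists_closedLine {v : ℂ} (hv : v ≠ 0) {x : S} (hx : x ∈ X.periodicPart v) :
    ∃ γ c, X.ClosedLine v γ c ∧ γ 0 = x := by
  obtain ⟨γ, hγ, rfl, T, hT, hper⟩ := hx
  let G : AddSubgroup ℝ :=
    { carrier := {r | X.Seg (γ 0) (r • v) (γ 0)}
      zero_mem' := by simpa using Seg.refl (hγ.2.1 0)
      add_mem' := fun ha hb => Seg.trans_smul ha hb
      neg_mem' := fun {a} ha => by simpa using Seg.symm ha }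
  have hG : ∀ r, r ∈ G ↔ X.Seg (γ 0) (r • v) (γ 0) := fun r => Iff.rfl
  obtain ⟨η, hη, hsys⟩ := X.exists_systole
  have hv' : 0 < ‖v‖ := norm_pos_iff.2 hv
  obtain ⟨b, hb⟩ := AddSubgroup.cyclic_of_isolated_zero (H := G) (a := η / ‖v‖) (by positivity) (by
    rw [Set.disjoint_left]
    intro r hr hr'
    have := hsys _ _ ((hG r).1 hr) (by
      rw [norm_smul, Real.norm_eq_abs, abs_of_pos hr'.1]
      exact (lt_div_iff₀ hv').1 hr'.2)
    rw [smul_eq_zero] at this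
    exact this.elim hr'.1.ne' hv)
  have hGb : ∀ r, r ∈ G ↔ ∃ n : ℤ, n * b = r := fun r => by
    rw [hb, AddSubgroup.mem_closure_singleton]; simp
  have hTG : T ∈ G := by
    rw [hG]
    have h1 := hγ.seg 0 T
    have h2 := hper 0
    rw [zero_add] at h2
    rwa [h2, sub_zero] at h1
  have hb0 : b ≠ 0 := by
    rintro rfl
    obtain ⟨n, hn⟩ := (hGb T).1 hTG
    rw [mul_zero] at hn
    exact hT.ne hn
  refine ⟨γ, |b|, ⟨hγ, abs_pos.2 hb0, fun a a' => ?_⟩, rfl⟩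
  have h1 : γ a = γ a' ↔ a' - a ∈ G := by
    rw [hG]
    constructor
    · intro h
      have h2 := hγ.periodic_of_eq h 0
      rw [zero_add] at h2
      have h3 := hγ.seg 0 (a' - a)
      rwa [h2, sub_zero] at h3
    · intro h
      have h3 := hγ.seg 0 (a' - a)
      rw [sub_zero] at h3
      have h4 := hγ.periodic_of_eq (h.unique h3) a
      rw [← h4]
      congr 1; ring
  rw [h1, hGb]
  rcases abs_choice b with h' | h' <;> rw [h']
  · simp only [eq_comm]
  · constructor
    · rintro ⟨n, hn⟩; exact ⟨-n, by rw [← hn]; push_cast; ring⟩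
    · rintro ⟨n, hn⟩; exact ⟨-n, by rw [hn]; push_cast; ring⟩

theorem leaf_eq_range {v : ℂ} {γ : ℝ → S} (h : X.IsStraightLine v γ) :
    X.leaf v (γ 0) = range γ := by
  ext y
  constructor
  · rintro ⟨γ', hγ', h0, hy⟩
    rwa [h.ext hγ' h0.symm]
  · exact fun hy => ⟨γ, h, rfl, hy⟩

theorem mem_leaf_iff {v : ℂ} {x y : S} (hx : x ∈ X.periodicPart v) :
    y ∈ X.leaf v x ↔ ∃ s : ℝ, X.Seg x (s • v) y := by
  obtain ⟨γ, hγ, rfl, -⟩ := hx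
  rw [leaf_eq_range hγ]
  constructor
  · rintro ⟨s, rfl⟩; exact ⟨s, by simpa using hγ.seg 0 s⟩
  · rintro ⟨s, hs⟩; exact ⟨s, (by simpa using hγ.seg 0 s : X.Seg (γ 0) (s • v) (γ s)).unique hs⟩

/-- A closed segment can be displaced by thickening it with unchanged displacement: the two ends
move by the same `δ` and still coincide. -/
theorem isOpen_periodicPart (v : ℂ) : IsOpen (X.periodicPart v) := by
  rw [isOpen_iff_mem_nhds]
  intro x hx
  obtain ⟨c, hc, hx⟩ := mem_periodicPart_iff.1 hx
  obtain ⟨ε, hε, H⟩ := hx.exists_thickening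
  filter_upwards [eventually_short_seg hx.left_notMem hε] with x' hx'
  obtain ⟨δ, hδ, hs⟩ := hx'
  obtain ⟨y', h1, h2⟩ := H δ 0 x' hδ (by simpa) hs
  rw [add_zero] at h1 h2
  refine mem_periodicPart_iff.2 ⟨c, hc, ?_⟩
  rwa [h1.unique hs] at h2

/-- Pushing a path in the periodic part along the leaves, and shearing it. -/
theorem IsFlatOn.shear {v w : ℂ} {I : Set ℝ} {δ : ℝ → S}
    (h : X.IsFlatOn (fun t : ℝ => t • w) δ I) (hP : ∀ t ∈ I, δ t ∈ X.periodicPart v) (s a : ℝ) :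
    ∃ δ' : ℝ → S, (∀ t ∈ I, X.Seg (δ t) ((s + a * t) • v) (δ' t)) ∧
      X.IsFlatOn (fun t : ℝ => t • (w + a • v)) δ' I ∧ ∀ t ∈ I, δ' t ∈ X.periodicPart v := by
  have hex : ∀ t, ∃ y, t ∈ I → X.Seg (δ t) ((s + a * t) • v) y := fun t => by
    by_cases ht : t ∈ I
    · obtain ⟨y, hy⟩ := exists_seg_of_mem_periodicPart (hP t ht) (s + a * t)
      exact ⟨y, fun _ => hy⟩
    · exact ⟨δ t, fun h => (ht h).elim⟩
  choose δ' hδ' using hex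
  refine ⟨δ', hδ', ?_, fun t ht => (hδ' t ht).mem_periodicPart (hP t ht)⟩
  refine (h.of_seg (by fun_prop) (a := fun t : ℝ => (s + a * t) • v) (by fun_prop)
    hδ').congr_dev (c := -(s • v)) fun t _ => ?_
  simp only [Complex.real_smul]; push_cast; ring

theorem eventually_seg_injective {x : S} (hx : x ∉ X.sing) :
    ∃ ε > 0, ∀ᶠ y in 𝓝 x, ∀ (ζ ζ' : ℂ) (z : S), ‖ζ‖ < ε → ‖ζ'‖ < ε → X.Seg y ζ z →
      X.Seg y ζ' z → ζ = ζ' := by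
  obtain ⟨e, he, hxe⟩ := X.exists_chart x hx
  obtain ⟨r, hr, h⟩ := exists_ball_subset_target hxe
  refine ⟨r / 2, half_pos hr, ?_⟩
  have h1 : ∀ᶠ y in 𝓝 x, e y ∈ ball (e x) (r / 2) :=
    (e.continuousAt hxe).eventually (ball_mem_nhds _ (half_pos hr))
  filter_upwards [h1, e.open_source.mem_nhds hxe] with y hy hye ζ ζ' z h₁ h₂ hs hs'
  have hb : ∀ ζ ∈ ball (0 : ℂ) (r / 2), e y + ζ ∈ e.target := fun ζ hζ => by
    have h2 : e y + ζ = e x + ((e y - e x) + ζ) := by ring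
    rw [h2]
    apply h
    rw [mem_ball, dist_eq_norm] at hy
    rw [mem_ball, dist_zero_right] at hζ ⊢
    linarith [norm_add_le (e y - e x) ζ]
  have h3 := (hs.chart_of_le he hye hb h₁).2.1
  have h4 := (hs'.chart_of_le he hye hb h₂).2.1
  rw [h3] at h4
  exact add_left_cancel h4

/-- A closed leaf has no short transversal connections to itself. -/
theorem ClosedLine.exists_no_short_connection {v w : ℂ} (hvw : LinearIndependent ℝ ![v, w])
    {γ : ℝ → S} {c : ℝ} (h : X.ClosedLine v γ c) :
    ∃ ε > 0, ∀ a b κ : ℝ, |κ| < ε → X.Seg (γ a) (κ • w) (γ b) → κ = 0 := by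
  have hw : 0 < ‖w‖ := norm_pos_iff.2 (hvw.ne_zero 1)
  have key := ((isCompact_Icc (a := 0) (b := c)).prod
    (isCompact_Icc (a := 0) (b := c))).induction_on
    (p := fun A : Set (ℝ × ℝ) => ∃ ε > 0, ∀ a b, (a, b) ∈ A → ∀ κ : ℝ, |κ| < ε →
      X.Seg (γ a) (κ • w) (γ b) → κ = 0) ⟨1, one_pos, by simp⟩ ?_ ?_ ?_
  · obtain ⟨ε, hε, H⟩ := key
    refine ⟨ε, hε, fun a b κ hκ hs => ?_⟩
    obtain ⟨a', ha', haa⟩ := h.exists_mem_Ico a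
    obtain ⟨b', hb', hbb⟩ := h.exists_mem_Ico b
    rw [← haa, ← hbb] at hs
    exact H a' b' ⟨⟨ha'.1, ha'.2.le⟩, ⟨hb'.1, hb'.2.le⟩⟩ κ hκ hs
  · rintro s t hst ⟨r, hr, h⟩
    exact ⟨r, hr, fun a b hab => h a b (hst hab)⟩
  · rintro s t ⟨r, hr, h⟩ ⟨r', hr', h'⟩
    refine ⟨min r r', lt_min hr hr', fun a b hab κ hκ hs => ?_⟩
    rcases hab with hx | hx
    · exact h a b hx κ (hκ.trans_le (min_le_left _ _)) hs
    · exact h' a b hx κ (hκ.trans_le (min_le_right _ _)) hs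
  rintro ⟨a₀, b₀⟩ -
  have hca : Tendsto (fun p : ℝ × ℝ => γ p.1) (𝓝 (a₀, b₀)) (𝓝 (γ a₀)) :=
    (h.line.1.comp continuous_fst).tendsto (a₀, b₀)
  have hcb : Tendsto (fun p : ℝ × ℝ => γ p.2) (𝓝 (a₀, b₀)) (𝓝 (γ b₀)) :=
    (h.line.1.comp continuous_snd).tendsto (a₀, b₀)
  by_cases heq : γ a₀ = γ b₀
  -- If the two points coincide, a short connection would compete with a short piece of the leaf,
  -- against local injectivity. If they differ, the trap keeps short segments away from the second
  -- point. Compactness of the square of the period makes the bound uniform.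
  · obtain ⟨ε, hε, H⟩ := eventually_seg_injective (h.line.2.1 a₀)
    have h2 : ∀ᶠ p : ℝ × ℝ in 𝓝 (a₀, b₀), ‖((p.2 - b₀) - (p.1 - a₀)) • v‖ < ε :=
      ContinuousAt.eventually_lt (by fun_prop) continuousAt_const (by simpa)
    refine ⟨_, mem_nhdsWithin_of_mem_nhds ((hca.eventually H).and h2), ε / ‖w‖, by positivity, ?_⟩
    rintro a b ⟨h3, h4⟩ κ hκ hs
    have h5 := h.line.seg a₀ a
    have h6 := h.line.seg b₀ b
    rw [← heq] at h6
    have h7 := h3 _ _ _ h4 (by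
      rw [norm_smul, Real.norm_eq_abs]; exact (lt_div_iff₀ hw).1 hκ) (h5.sub_smul h6) hs
    have := LinearIndependent.pair_iff.1 hvw ((b - b₀) - (a - a₀)) (-κ) (by
      simp only at h7; rw [h7]; simp)
    simpa using this.2
  · obtain ⟨U, V, hU, hV, haU, hbV, hUV⟩ := t2_separation heq
    obtain ⟨V', hV', η, hη, H⟩ := X.exists_seg_trap (γ a₀) (hU.mem_nhds haU)
    refine ⟨_, mem_nhdsWithin_of_mem_nhds ((hca.eventually hV').and
      (hcb.eventually (hV.mem_nhds hbV))), η / ‖w‖, by positivity, ?_⟩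
    rintro a b ⟨h3, h4⟩ κ hκ hs
    obtain ⟨γ', -, -, h1, hm⟩ := H _ _ _ h3 hs (by
      rw [norm_smul, Real.norm_eq_abs]; exact (lt_div_iff₀ hw).1 hκ)
    have h5 : γ b ∈ U := by
      have := hm (right_mem_Icc.2 zero_le_one)
      rwa [h1] at this
    exact (hUV.le_bot ⟨h5, h4⟩).elim

/-- A closed leaf is met only finitely often by a compact piece of a transversal line. -/
theorem ClosedLine.finite_hits {v w : ℂ} (hvw : LinearIndependent ℝ ![v, w])
    {γ γ' : ℝ → S} {c : ℝ} (h : X.ClosedLine v γ c) (h' : X.IsStraightLine w γ') (A B : ℝ) :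
    ({t | γ' t ∈ range γ} ∩ Icc A B).Finite := by
  refine isCompact_Icc.finite_inter_of_isolated fun t₀ _ => ?_
  by_cases ht : γ' t₀ ∈ range γ
  · obtain ⟨ε, hε, H⟩ := h.exists_no_short_connection hvw
    obtain ⟨a, ha⟩ := ht
    have h1 : ∀ᶠ t in 𝓝[≠] t₀, |t - t₀| < ε :=
      nhdsWithin_le_nhds (ContinuousAt.eventually_lt (by fun_prop) continuousAt_const (by simpa))
    filter_upwards [h1, self_mem_nhdsWithin] with t ht hne
    rintro ⟨b, hb⟩
    have h2 := h'.seg t₀ t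
    rw [← ha, ← hb] at h2
    exact hne (sub_eq_zero.1 (H a b _ ht h2))
  · exact nhdsWithin_le_nhds (h'.1.continuousAt.eventually
      (h.isCompact_range.isClosed.isOpen_compl.mem_nhds ht))

end Periodic

end TranslationStructure

/-! ### Crossing cylinders: heights and the length formula. -/

theorem LinearIndependent.pair_add_smul {v w : ℂ} (h : LinearIndependent ℝ ![v, w]) (a : ℝ) :
    LinearIndependent ℝ ![v, w + a • v] := by
  rw [LinearIndependent.pair_iff] at h ⊢
  intro s t hst
  obtain ⟨h1, h2⟩ := h (s + t * a) t (by
    rw [← hst]; simp only [Complex.real_smul]; push_cast; ring)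
  refine ⟨?_, h2⟩
  rwa [h2, zero_mul, add_zero] at h1

namespace TranslationStructure

open Set Metric MeasureTheory

section Crossing

variable {S : Type*} [TopologicalSpace S] [T2Space S] [CompactSpace S] {X : TranslationStructure S}

/-- The times for which the line from `x` with velocity `w` stays in the union of the closed leaves
in the direction `v`. -/
def crossSet (X : TranslationStructure S) (v w : ℂ) (x : S) : Set ℝ :=
  {y | ∀ c ∈ uIcc 0 y, ∃ m ∈ X.periodicPart v, X.Seg x (c • w) m}

theorem mem_crossSet_of_mem_uIcc {v w : ℂ} {x : S} {y c : ℝ} (h : y ∈ X.crossSet v w x)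
    (hc : c ∈ uIcc 0 y) : c ∈ X.crossSet v w x :=
  fun c' hc' => h c' (uIcc_subset_uIcc left_mem_uIcc hc hc')

theorem zero_mem_crossSet {v w : ℂ} {x : S} (hx : x ∈ X.periodicPart v) :
    (0 : ℝ) ∈ X.crossSet v w x := by
  intro c hc
  obtain rfl : c = 0 := by simpa using hc
  exact ⟨x, hx, by simpa using Seg.refl (notMem_sing_of_mem_periodicPart hx)⟩

theorem ordConnected_crossSet (v w : ℂ) (x : S) : (X.crossSet v w x).OrdConnected := by
  refine ⟨fun a ha b hb c hc => ?_⟩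
  rcases le_total 0 c with h0 | h0
  · refine mem_crossSet_of_mem_uIcc hb ?_
    rw [uIcc_of_le (h0.trans hc.2)]
    exact ⟨h0, hc.2⟩
  · refine mem_crossSet_of_mem_uIcc ha ?_
    rw [uIcc_of_ge (hc.1.trans h0)]
    exact ⟨hc.1, h0⟩

theorem mem_crossSet_iff_line {v u : ℂ} {γ : ℝ → S} (h : X.IsStraightLine u γ) (τ y : ℝ) :
    y ∈ X.crossSet v u (γ τ) ↔ ∀ c ∈ uIcc 0 y, γ (τ + c) ∈ X.periodicPart v := by
  have hs : ∀ c, X.Seg (γ τ) (c • u) (γ (τ + c)) := fun c => by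
    simpa using h.seg τ (τ + c)
  refine forall₂_congr fun c _ => ⟨?_, fun hm => ⟨_, hm, hs c⟩⟩
  rintro ⟨m, hm, hm'⟩
  rwa [(hs c).unique hm']

/-- Leaves in the periodic part are infinite, so each point of a transversal can slide along its
leaf by a distance affine in the height. This yields a transversal through another point of the
starting leaf with another slope. -/
theorem crossSet_shear {v w : ℂ} {x x' : S} {s y : ℝ} (a : ℝ) (hy : y ∈ X.crossSet v w x)
    (hs : X.Seg x (s • v) x') : y ∈ X.crossSet v (w + a • v) x' ∧ ∀ m, X.Seg x (y • w) m →
      ∃ m', X.Seg m ((s + a * y) • v) m' ∧ X.Seg x' (y • (w + a • v)) m' := by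
  have hex : ∀ c, ∃ m, c ∈ uIcc 0 y → m ∈ X.periodicPart v ∧ X.Seg x (c • w) m := fun c => by
    by_cases hc : c ∈ uIcc 0 y
    · obtain ⟨m, hm, hm'⟩ := hy c hc
      exact ⟨m, fun _ => ⟨hm, hm'⟩⟩
    · exact ⟨x, fun h => (hc h).elim⟩
  choose δ hδ using hex
  have hflat : X.IsFlatOn (fun t : ℝ => t • w) δ (uIcc 0 y) :=
    IsFlatOn.of_seg_line hs.left_notMem 0 fun t ht => by simpa using (hδ t ht).2
  obtain ⟨δ', h1, h2, h3⟩ := hflat.shear (fun t ht => (hδ t ht).1) s a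
  have hδ0 : δ 0 = x := (hδ 0 left_mem_uIcc).2.unique (by simpa using Seg.refl hs.left_notMem)
  have hδ'0 : δ' 0 = x' := by
    have := h1 0 left_mem_uIcc
    rw [hδ0, mul_zero, add_zero] at this
    exact this.unique hs
  have h4 : ∀ c ∈ uIcc 0 y, X.Seg x' (c • (w + a • v)) (δ' c) := fun c hc => by
    have := h2.seg_line ordConnected_uIcc left_mem_uIcc hc
    rwa [hδ'0, sub_zero] at this
  refine ⟨fun c hc => ⟨δ' c, h3 c hc, h4 c hc⟩, fun m hm => ⟨δ' y, ?_, h4 y right_mem_uIcc⟩⟩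
  rw [hm.unique (hδ y right_mem_uIcc).2]
  exact h1 y right_mem_uIcc

/-- The width of a cylinder seen from a leaf depends neither on the point of the leaf nor on the
slope of the transversal. This allows one height to serve for all velocities `w + a • v`. -/
theorem crossSet_eq_of_seg {v w : ℂ} {x x' : S} {s : ℝ} (a : ℝ) (hs : X.Seg x (s • v) x') :
    X.crossSet v (w + a • v) x' = X.crossSet v w x := by
  ext y
  refine ⟨fun h => ?_, fun h => (crossSet_shear a h hs).1⟩
  have := (crossSet_shear (-a) h (s := -s) (x' := x) (by simpa using hs.symm)).1
  rwa [neg_smul, add_neg_cancel_right] at this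

theorem neg_mem_crossSet {v w : ℂ} {x m : S} {y : ℝ} (hy : y ∈ X.crossSet v w x)
    (hm : X.Seg x (y • w) m) : -y ∈ X.crossSet v w m := by
  intro c hc
  obtain ⟨m₁, hm₁, h₁⟩ := hy (y + c) (by
    rw [mem_uIcc] at hc ⊢
    rcases hc with hc | hc <;> [right; left] <;> constructor <;> linarith [hc.1, hc.2])
  have := hm.sub_smul h₁
  rw [add_sub_cancel_left] at this
  exact ⟨m₁, hm₁, this⟩

theorem add_mem_crossSet {v w : ℂ} {x m : S} {y y' : ℝ} (hy : y ∈ X.crossSet v w x)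
    (hm : X.Seg x (y • w) m) (hy' : y' ∈ X.crossSet v w m) : y + y' ∈ X.crossSet v w x := by
  intro c hc
  have : c ∈ uIcc 0 y ∨ c - y ∈ uIcc 0 y' := by
    rw [mem_uIcc] at *
    rw [mem_uIcc]
    by_contra! hcon
    obtain ⟨⟨h1, h2⟩, h3, h4⟩ := hcon
    rcases hc with hc | hc
    · rcases le_total c y with h | h
      · linarith [h1 hc.1]
      · linarith [h3 (by linarith)]
    · rcases le_total c y with h | h
      · linarith [h4 (by linarith)]
      · linarith [h2 h]
  rcases this with h | h
  · exact hy c h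
  · obtain ⟨m₁, hm₁, h₁⟩ := hy' _ h
    have := hm.trans_smul h₁
    rw [add_sub_cancel] at this
    exact ⟨m₁, hm₁, this⟩

/-- `x` and `x'` are related by moving transversally, within the closed leaves, and then along a
leaf. -/
def Cross (X : TranslationStructure S) (v w : ℂ) (x x' : S) : Prop :=
  ∃ y ∈ X.crossSet v w x, ∃ m, ∃ s : ℝ, X.Seg x (y • w) m ∧ X.Seg m (s • v) x'

theorem Cross.symm {v w : ℂ} {x x' : S} (h : X.Cross v w x x') : X.Cross v w x' x := by
  obtain ⟨y, hy, m, s, h1, h2⟩ := h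
  obtain ⟨h3, h4⟩ := crossSet_shear 0 (neg_mem_crossSet hy h1) h2
  simp only [zero_smul, add_zero, zero_mul] at h3 h4
  obtain ⟨m', h5, h6⟩ := h4 x (by simpa using h1.symm)
  exact ⟨-y, h3, m', -s, h6, by simpa using h5.symm⟩

theorem Cross.trans {v w : ℂ} {x x' x'' : S} (h : X.Cross v w x x') (h' : X.Cross v w x' x'') :
    X.Cross v w x x'' := by
  obtain ⟨y, hy, m, s, h1, h2⟩ := h
  obtain ⟨y', hy', m', s', h1', h2'⟩ := h'
  obtain ⟨h3, h4⟩ := crossSet_shear 0 hy' (s := -s) (x' := m) (by simpa using h2.symm)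
  simp only [zero_smul, add_zero, zero_mul] at h3 h4
  obtain ⟨m'', h5, h6⟩ := h4 m' h1'
  refine ⟨y + y', add_mem_crossSet hy h1 h3, m'', s + s', h1.trans_smul h6, ?_⟩
  exact Seg.trans_smul (by simpa using h5.symm) h2'

theorem eventually_cross {v w : ℂ} (hvw : LinearIndependent ℝ ![v, w]) {x : S}
    (hx : x ∈ X.periodicPart v) : ∀ᶠ x' in 𝓝 x, X.Cross v w x x' := by
  have hxs := notMem_sing_of_mem_periodicPart hx
  obtain ⟨α, β, hαβ, -⟩ := exists_plane_coords hvw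
  obtain ⟨ε₁, hε₁, hex, hsub⟩ := exists_seg_sub_of_small hxs
  obtain ⟨ε₂, hε₂, hP⟩ := seg_mem_nhds hxs ((isOpen_periodicPart v).mem_nhds hx)
  have h1 : ∀ᶠ ζ : ℂ in 𝓝 0, ‖β ζ • w‖ < min ε₁ ε₂ ∧ ‖ζ‖ < ε₁ := by
    refine Eventually.and ?_ ?_
    · exact ContinuousAt.eventually_lt (by fun_prop) continuousAt_const (by simp [hε₁, hε₂])
    · exact ContinuousAt.eventually_lt (by fun_prop) continuousAt_const (by simpa)
  obtain ⟨ρ, hρ, hb⟩ := Metric.mem_nhds_iff.1 h1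
  filter_upwards [eventually_short_seg hxs hρ] with x' hx'
  obtain ⟨ζ, hζ, hs⟩ := hx'
  obtain ⟨hb1, hb2⟩ := hb (show ζ ∈ ball 0 ρ by simpa using hζ)
  have hsmall : ∀ c ∈ uIcc 0 (β ζ), ‖c • w‖ < min ε₁ ε₂ := fun c hc => by
    refine lt_of_le_of_lt ?_ hb1
    rw [norm_smul, norm_smul, Real.norm_eq_abs, Real.norm_eq_abs]
    refine mul_le_mul_of_nonneg_right ?_ (norm_nonneg w)
    rw [mem_uIcc] at hc
    rcases hc with hc | hc
    · rw [abs_of_nonneg hc.1, abs_of_nonneg (hc.1.trans hc.2)]; exact hc.2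
    · rw [abs_of_nonpos hc.2, abs_of_nonpos (hc.1.trans hc.2)]; linarith [hc.1]
  refine ⟨β ζ, fun c hc => ?_, ?_⟩
  · obtain ⟨m, hm⟩ := hex _ ((hsmall c hc).trans_le (min_le_left _ _))
    exact ⟨m, hP _ _ ((hsmall c hc).trans_le (min_le_right _ _)) hm, hm⟩
  · obtain ⟨m, hm⟩ := hex _ (hb1.trans_le (min_le_left _ _))
    refine ⟨m, α ζ, hm, ?_⟩
    have := hsub _ _ _ _ (hb1.trans_le (min_le_left _ _)) hb2 hm hs
    rwa [show ζ - β ζ • w = α ζ • v by nth_rewrite 1 [hαβ ζ]; simp] at this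

/-- The point `x` lies in the cylinder `D`. -/
def InCylinder {v : ℂ} (D : X.Cylinder v) (x : S) : Prop :=
  ∃ h : x ∈ X.periodicPart v, (ConnectedComponents.mk (⟨x, h⟩ : X.periodicPart v)) = D

theorem InCylinder.eq {v : ℂ} {D D' : X.Cylinder v} {x : S} (h : InCylinder D x)
    (h' : InCylinder D' x) : D = D' := by
  obtain ⟨h1, rfl⟩ := h
  obtain ⟨h2, rfl⟩ := h'
  rfl

theorem InCylinder.of_path {T : Type*} [TopologicalSpace T] {v : ℂ} {D : X.Cylinder v}
    {δ : T → S} {I : Set T} (hI : IsPreconnected I) (hc : ContinuousOn δ I)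
    (hP : ∀ t ∈ I, δ t ∈ X.periodicPart v)
    {a b : T} (ha : a ∈ I) (hb : b ∈ I) (h : InCylinder D (δ a)) : InCylinder D (δ b) := by
  obtain ⟨h1, rfl⟩ := h
  refine ⟨hP b hb, ConnectedComponents.coe_eq_coe'.2 ?_⟩
  have hpre : IsPreconnected ((Subtype.val : X.periodicPart v → S) ⁻¹' (δ '' I)) := by
    rw [← Topology.IsInducing.subtypeVal.isPreconnected_image, Subtype.image_preimage_coe,
      inter_eq_self_of_subset_right]
    · exact hI.image _ hc
    · rintro _ ⟨t, ht, rfl⟩; exact hP t ht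
  exact hpre.subset_connectedComponent (x := ⟨δ a, h1⟩)
    (show δ a ∈ δ '' I from ⟨a, ha, rfl⟩)
    (show (⟨δ b, hP b hb⟩ : X.periodicPart v) ∈ Subtype.val ⁻¹' (δ '' I) from ⟨b, hb, rfl⟩)

theorem InCylinder.of_seg {v : ℂ} {D : X.Cylinder v} {x x' : S} {s : ℝ} (h : InCylinder D x)
    (hs : X.Seg x (s • v) x') : InCylinder D x' := by
  obtain ⟨γ, hγ, rfl, -⟩ := h.1
  have h1 : X.Seg (γ 0) (s • v) (γ s) := by simpa using hγ.seg 0 s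
  rw [hs.unique h1]
  refine InCylinder.of_path (v := v) isPreconnected_univ hγ.1.continuousOn (fun t _ => ?_)
    (mem_univ 0) (mem_univ s) h
  exact Seg.mem_periodicPart (s := t) (by simpa using hγ.seg 0 t) h.1

/-- On the periodic part `Cross` is an equivalence relation with open classes, so a connected
component lies in a single class. -/
theorem InCylinder.cross {v w : ℂ} (hvw : LinearIndependent ℝ ![v, w]) {D : X.Cylinder v}
    {x x' : S} (h : InCylinder D x) (h' : InCylinder D x') : X.Cross v w x x' := by
  obtain ⟨h1, rfl⟩ := h
  obtain ⟨h2, h3⟩ := h'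
  have h4 := ConnectedComponents.coe_eq_coe'.1 h3
  refine isPreconnected_connectedComponent.imp_of_eventually_iff (α := X.periodicPart v)
    (s := connectedComponent ⟨x, h1⟩) (p := fun z => X.Cross v w x z) (fun z _ => ?_)
    (x := ⟨x, h1⟩) (y := ⟨x', h2⟩) mem_connectedComponent h4
    (eventually_cross hvw h1).self_of_nhds
  have h5 : ∀ᶠ z' : X.periodicPart v in 𝓝 z, X.Cross v w z z' :=
    continuous_subtype_val.continuousAt.eventually (eventually_cross hvw z.2)
  filter_upwards [nhdsWithin_le_nhds h5] with z' hz'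
  exact ⟨fun h => h.trans hz'.symm, fun h => h.trans hz'⟩

/-- The base point of the waist curve. -/
noncomputable def base {v : ℂ} (D : X.Cylinder v) : S :=
  (Function.surjInv ConnectedComponents.surjective_coe D : X.periodicPart v)

theorem base_mem {v : ℂ} (D : X.Cylinder v) : base D ∈ X.periodicPart v :=
  (Function.surjInv ConnectedComponents.surjective_coe D : X.periodicPart v).2

theorem inCylinder_base {v : ℂ} (D : X.Cylinder v) : InCylinder D (base D) :=
  ⟨base_mem D, Function.surjInv_eq _ D⟩

theorem waist_eq {v : ℂ} (D : X.Cylinder v) : X.waist v D = X.leaf v (base D) := rfl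

/-- The height of a cylinder, measured along `w`. -/
noncomputable def height (w : ℂ) {v : ℂ} (D : X.Cylinder v) : ℝ :=
  (volume (X.crossSet v w (base D))).toReal

theorem ClosedLine.mem_crossSet_iff {v w : ℂ}
    {γ : ℝ → S} {c a : ℝ} (hγ : X.ClosedLine (w + a • v) γ c)
    {D : X.Cylinder v} {τ : ℝ} (hτ : γ τ ∈ X.waist v D) (y : ℝ) :
    y ∈ X.crossSet v w (base D) ↔ ∀ r ∈ uIcc 0 y, γ (τ + r) ∈ X.periodicPart v := by
  obtain ⟨s, hs⟩ := (mem_leaf_iff (base_mem D)).1 hτ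
  rw [← crossSet_eq_of_seg a hs, mem_crossSet_iff_line hγ.line]

theorem ClosedLine.inCylinder_of_mem_crossSet {v w : ℂ}
    {γ : ℝ → S} {c a : ℝ} (hγ : X.ClosedLine (w + a • v) γ c)
    {D : X.Cylinder v} {τ : ℝ}
    (hτ : γ τ ∈ X.waist v D) {y : ℝ} (hy : y ∈ X.crossSet v w (base D)) :
    InCylinder D (γ (τ + y)) := by
  rw [hγ.mem_crossSet_iff hτ] at hy
  obtain ⟨s, hs⟩ := (mem_leaf_iff (base_mem D)).1 hτ
  refine InCylinder.of_path (δ := fun r => γ (τ + r)) isPreconnected_uIcc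
    (Continuous.continuousOn (hγ.line.1.comp (by fun_prop))) hy left_mem_uIcc right_mem_uIcc ?_
  rw [add_zero]
  exact (inCylinder_base D).of_seg hs

/-- Every passage of the line through a cylinder meets the waist curve: straighten the transversal
connection to the waist given by `Cross` until it follows the line. -/
theorem ClosedLine.exists_hit_of_inCylinder {v w : ℂ} (hvw : LinearIndependent ℝ ![v, w])
    {γ : ℝ → S} {c a : ℝ} (hγ : X.ClosedLine (w + a • v) γ c)
    {D : X.Cylinder v} {t : ℝ} (h : InCylinder D (γ t)) :
    ∃ τ, γ τ ∈ X.waist v D ∧ t - τ ∈ X.crossSet v w (base D) := by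
  obtain ⟨y, hy, m, s, h1, h2⟩ := h.cross hvw (inCylinder_base D)
  obtain ⟨h3, h4⟩ := crossSet_shear a hy (s := 0) (x' := γ t)
    (by simpa using Seg.refl h1.left_notMem)
  obtain ⟨m', h5, h6⟩ := h4 m h1
  have h7 : m' = γ (t + y) := h6.unique (by simpa using hγ.line.seg t (t + y))
  subst h7
  have hτ : γ (t + y) ∈ X.waist v D :=
    (mem_leaf_iff (base_mem D)).2 ⟨_, Seg.trans_smul (a := -s) (by simpa using h2.symm) h5⟩
  refine ⟨t + y, hτ, ?_⟩
  obtain ⟨s', hs'⟩ := (mem_leaf_iff (base_mem D)).1 hτ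
  rw [← crossSet_eq_of_seg a hs', sub_add_cancel_left]
  exact neg_mem_crossSet h3 h6

theorem ClosedLine.int_mul_notMem {v w : ℂ}
    {γ : ℝ → S} {c a : ℝ} (hγ : X.ClosedLine (w + a • v) γ c)
    (h0 : γ 0 ∉ X.periodicPart v)
    (n : ℤ) : γ (n * c) ∉ X.periodicPart v := by
  have := hγ.apply_add 0 n
  rw [zero_add] at this
  rwa [this]

/-- If the passages belonging to two hits overlapped, the line would run from one hit to the next
within the cylinder. The crossing set would then contain all multiples of the time between the hits,
and the line could never leave the periodic part again, although it does so once per period. -/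
theorem ClosedLine.disjoint_cross {v w : ℂ}
    {γ : ℝ → S} {c a : ℝ} (hγ : X.ClosedLine (w + a • v) γ c)
    (h0 : γ 0 ∉ X.periodicPart v)
    {D : X.Cylinder v} {τ τ' : ℝ} (hlt : τ < τ')
    (hτ : γ τ ∈ X.waist v D) (hτ' : γ τ' ∈ X.waist v D) {y y' : ℝ}
    (hy : y ∈ X.crossSet v w (base D)) (hy' : y' ∈ X.crossSet v w (base D)) :
    τ + y ≠ τ' + y' := by
  intro heq
  have e := hγ.mem_crossSet_iff hτ
  have e' := hγ.mem_crossSet_iff hτ'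
  have hgood : ∀ r ∈ Icc 0 (τ' - τ), γ (τ + r) ∈ X.periodicPart v := by
    intro r hr
    rcases le_total r y with h | h
    · exact (e y).1 hy r (mem_uIcc.2 (Or.inl ⟨hr.1, h⟩))
    · have := (e' y').1 hy' (τ + r - τ') (mem_uIcc.2 (Or.inr ⟨by linarith, by linarith [hr.2]⟩))
      rwa [add_sub_cancel] at this
  have hmul : ∀ n : ℕ, n * (τ' - τ) ∈ X.crossSet v w (base D) := by
    intro n
    induction n with
    | zero => simpa using zero_mem_crossSet (base_mem D)
    | succ n ih =>
      have hpos : 0 ≤ n * (τ' - τ) := mul_nonneg n.cast_nonneg (by linarith)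
      have hpos' : 0 ≤ (n + 1 : ℕ) * (τ' - τ) := mul_nonneg (Nat.cast_nonneg _) (by linarith)
      rw [e]
      intro r hr
      rw [uIcc_of_le hpos'] at hr
      push_cast at hr
      rcases le_total r (τ' - τ) with h | h
      · exact hgood r ⟨hr.1, h⟩
      · have := (e' _).1 ih (τ + r - τ') (by
          rw [uIcc_of_le hpos]; exact ⟨by linarith, by linarith [hr.2]⟩)
        rwa [add_sub_cancel] at this
  obtain ⟨k, hk⟩ : ∃ k : ℤ, τ ≤ k * c := by
    obtain ⟨k, hk⟩ := exists_int_ge (τ / c)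
    exact ⟨k, (div_le_iff₀ hγ.pos).1 hk⟩
  obtain ⟨n, hn⟩ : ∃ n : ℕ, k * c - τ ≤ n * (τ' - τ) := by
    obtain ⟨n, hn⟩ := exists_nat_ge ((k * c - τ) / (τ' - τ))
    exact ⟨n, (div_le_iff₀ (by linarith)).1 hn⟩
  have := (e _).1 (hmul n) (k * c - τ) (mem_uIcc.2 (Or.inl ⟨by linarith, hn⟩))
  rw [add_sub_cancel] at this
  exact hγ.int_mul_notMem h0 k this

/-- A passage contains neither of the times `0` and `c`, at which the line is outside the periodic
part; so it lies on one side of each. -/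
theorem ClosedLine.mem_Ioo_iff {v w : ℂ}
    {γ : ℝ → S} {c a : ℝ} (hγ : X.ClosedLine (w + a • v) γ c)
    (h0 : γ 0 ∉ X.periodicPart v)
    {D : X.Cylinder v} {τ y : ℝ} (hτ : γ τ ∈ X.waist v D)
    (hy : y ∈ X.crossSet v w (base D)) : τ + y ∈ Ioo 0 c ↔ τ ∈ Ioo 0 c := by
  have e := (hγ.mem_crossSet_iff hτ y).1 hy
  have h1 : γ c ∉ X.periodicPart v := by simpa using hγ.int_mul_notMem h0 1
  have hne : ∀ r, r ∉ X.periodicPart v → r = γ 0 ∨ r = γ c → ∀ b, γ b = r →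
      ¬ (b - τ ∈ uIcc 0 y) := by
    intro r hr _ b hb hby
    have := e _ hby
    rw [add_sub_cancel, hb] at this
    exact hr this
  have n0 := hne _ h0 (Or.inl rfl) 0 rfl
  have nc := hne _ h1 (Or.inr rfl) c rfl
  rw [mem_uIcc] at n0 nc
  push Not at n0 nc
  obtain ⟨a1, a2⟩ := n0
  obtain ⟨a3, a4⟩ := nc
  constructor <;> rintro ⟨b1, b2⟩
  · constructor
    · by_contra! h; linarith [a1 (by linarith)]
    · by_contra! h
      rcases le_total y (c - τ) with h' | h'
      · linarith [a4 h']
      · linarith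
  · constructor
    · by_contra! h
      linarith [a2 (by linarith)]
    · by_contra! h
      rcases le_total 0 (c - τ) with h' | h'
      · linarith [a3 h']
      · linarith

/-- The time spent in `D` during one period is the disjoint union of the passages through `D`, one
for each intersection with the waist curve, and all are translates of the same crossing set. -/
theorem ClosedLine.volume_cylinder {v w : ℂ} (hvw : LinearIndependent ℝ ![v, w])
    {γ : ℝ → S} {c a : ℝ} (hγ : X.ClosedLine (w + a • v) γ c)
    (h0 : γ 0 ∉ X.periodicPart v)
    (D : X.Cylinder v) :
    volume {t | t ∈ Ioo 0 c ∧ InCylinder D (γ t)} =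
      ((range γ ∩ X.waist v D).ncard : ENNReal) * volume (X.crossSet v w (base D)) := by
  have hv : v ≠ 0 := hvw.ne_zero 0
  obtain ⟨ℓ, c', hℓ, hℓ0⟩ := exists_closedLine hv (base_mem D)
  have hw : X.waist v D = range ℓ := by rw [waist_eq, ← hℓ0, leaf_eq_range hℓ.line]
  have hind := hvw.pair_add_smul a
  set H := {t | γ t ∈ X.waist v D} ∩ Ioo 0 c with hH
  have hHfin : H.Finite := by
    refine (hℓ.finite_hits hind hγ.line 0 c).subset ?_
    rw [← hw]
    exact inter_subset_inter_right _ Ioo_subset_Icc_self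
  have hcard : (range γ ∩ X.waist v D).ncard = H.ncard := by
    have : range γ ∩ X.waist v D = γ '' H := by
      ext x
      constructor
      · rintro ⟨⟨t, rfl⟩, ht⟩
        obtain ⟨b, hb, hbt⟩ := hγ.exists_mem_Ico t
        refine ⟨b, ⟨by rw [mem_ofPred_eq, hbt]; exact ht, lt_of_le_of_ne hb.1 ?_, hb.2⟩, hbt⟩
        rintro rfl
        rw [← hbt, waist_eq] at ht
        obtain ⟨s, hs⟩ := (mem_leaf_iff (base_mem D)).1 ht
        exact h0 (hs.mem_periodicPart (base_mem D))
      · rintro ⟨t, ht, rfl⟩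
        exact ⟨mem_range_self t, ht.1⟩
    rw [this, InjOn.ncard_image]
    intro t ht t' ht' htt
    obtain ⟨n, hn⟩ := (hγ.eq_iff _ _).1 htt
    have hc := hγ.pos
    have h1 : |(n : ℝ)| < 1 := by
      have : |(n : ℝ)| * c < 1 * c := by
        rw [← abs_of_pos hc, ← abs_mul, ← hn, abs_of_pos hc, abs_lt]
        constructor <;> linarith [ht.2.1, ht.2.2, ht'.2.1, ht'.2.2]
      exact lt_of_mul_lt_mul_right this hc.le
    have h2 : n = 0 := Int.abs_lt_one_iff.1 (by exact_mod_cast h1)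
    rw [h2, Int.cast_zero, zero_mul] at hn
    linarith
  have hset : {t | t ∈ Ioo 0 c ∧ InCylinder D (γ t)} =
      ⋃ τ ∈ hHfin.toFinset, (fun y => τ + y) '' X.crossSet v w (base D) := by
    ext t
    simp only [Finite.mem_toFinset, mem_iUnion, mem_ofPred_eq, exists_prop]
    constructor
    · rintro ⟨ht, hD⟩
      obtain ⟨τ, hτ, hy⟩ := hγ.exists_hit_of_inCylinder hvw hD
      refine ⟨τ, ⟨hτ, ?_⟩, t - τ, hy, by simp⟩
      rw [← hγ.mem_Ioo_iff h0 hτ hy]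
      simpa using ht
    · rintro ⟨τ, ⟨hτ, hτI⟩, y, hy, rfl⟩
      exact ⟨(hγ.mem_Ioo_iff h0 hτ hy).2 hτI, hγ.inCylinder_of_mem_crossSet hτ hy⟩
  have hmeas : MeasurableSet (X.crossSet v w (base D)) :=
    (ordConnected_crossSet v w (base D)).measurableSet
  rw [hset, measure_biUnion_finset, hcard, ncard_eq_toFinset_card _ hHfin]
  · simp only [image_add_left, measure_preimage_add, Finset.sum_const, nsmul_eq_mul]
  · intro τ hτ τ' hτ' hne
    simp only [Finite.coe_toFinset] at hτ hτ'
    rw [Function.onFun, disjoint_left]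
    rintro _ ⟨y, hy, rfl⟩ ⟨y', hy', h⟩
    rcases lt_or_gt_of_ne hne with hlt | hlt
    · exact hγ.disjoint_cross h0 hlt hτ.1 hτ'.1 hy hy' h.symm
    · exact hγ.disjoint_cross h0 hlt hτ'.1 hτ.1 hy' hy h
  · intro τ _
    rw [image_add_left]
    exact hmeas.preimage (by fun_prop)

/-- The length of a closed transversal line in terms of the heights of the cylinders it crosses. -/
theorem ClosedLine.length_eq_of_notMem {v w : ℂ} (hvw : LinearIndependent ℝ ![v, w]) {γ : ℝ → S}
    {c a : ℝ} (hγ : X.ClosedLine (w + a • v) γ c) [Fintype (X.Cylinder v)] {t₀ : ℝ}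
    (h0 : γ t₀ ∉ X.periodicPart v) (hcount : {t | γ t ∉ X.periodicPart v}.Countable) :
    c = ∑ D : X.Cylinder v, ((range γ ∩ X.waist v D).ncard : ℝ) * height w D := by
  wlog ht₀ : t₀ = 0 generalizing γ t₀
  · have hr : range (fun t => γ (t₀ + t)) = range γ :=
      (Equiv.addLeft t₀).surjective.range_comp γ
    have := this (hγ.comp_add t₀) (t₀ := 0) (by simpa using h0) ?_ rfl
    · rwa [hr] at this
    · exact hcount.preimage (add_right_injective t₀)
  subst ht₀
  -- Up to a countable set of times the open period interval is partitioned by the cylinders.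
  have h1 : volume (Ioo 0 c) =
      volume (⋃ D : X.Cylinder v, {t | t ∈ Ioo 0 c ∧ InCylinder D (γ t)}) := by
    refine measure_congr ?_
    have hae : ∀ᵐ t : ℝ, t ∉ {t | γ t ∉ X.periodicPart v} :=
      measure_eq_zero_iff_ae_notMem.1 (hcount.measure_zero volume)
    filter_upwards [hae] with t ht
    simp only [not_not] at ht
    refine propext (show t ∈ Ioo 0 c ↔ t ∈ ⋃ D : X.Cylinder v, _ from ?_)
    simp only [mem_iUnion, mem_ofPred_eq, exists_and_left]
    exact ⟨fun h => ⟨h, _, ht, rfl⟩, fun h => h.1⟩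
  have hfin : ∀ D : X.Cylinder v, volume {t | t ∈ Ioo 0 c ∧ InCylinder D (γ t)} ≠ ⊤ := fun D =>
    ((measure_mono (fun t ht => ht.1)).trans_lt (by simp : volume (Ioo 0 c) < ⊤)).ne
  have hmeas : ∀ D : X.Cylinder v, MeasurableSet {t | t ∈ Ioo 0 c ∧ InCylinder D (γ t)} := by
    intro D
    refine measurableSet_Ioo.inter ?_
    refine (isOpen_iff_mem_nhds.2 fun t ht => ?_ : IsOpen {t | InCylinder D (γ t)}).measurableSet
    have hP : {t | γ t ∈ X.periodicPart v} ∈ 𝓝 t :=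
      hγ.line.1.continuousAt.eventually ((isOpen_periodicPart v).mem_nhds ht.1)
    obtain ⟨ε, hε, hb⟩ := Metric.mem_nhds_iff.1 hP
    refine mem_of_superset (ball_mem_nhds t hε) fun t' ht' => ?_
    exact InCylinder.of_path (v := v) (convex_ball t ε).isPreconnected hγ.line.1.continuousOn
      (fun r hr => hb hr) (mem_ball_self hε) ht' ht
  rw [measure_iUnion _ hmeas, tsum_fintype] at h1
  · have h2 := congrArg ENNReal.toReal h1
    rw [Real.volume_Ioo, sub_zero, ENNReal.toReal_ofReal hγ.pos.le,
      ENNReal.toReal_sum fun D _ => hfin D] at h2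
    rw [h2]
    refine Finset.sum_congr rfl fun D _ => ?_
    rw [hγ.volume_cylinder hvw h0 D, ENNReal.toReal_mul, ENNReal.toReal_natCast, height]
  · intro D D' hne
    rw [Function.onFun, disjoint_left]
    exact fun t ht ht' => hne (ht.2.eq ht'.2)

end Crossing

end TranslationStructure

/-! ### The complement of the cylinders in the direction of a twist. -/

namespace TranslationStructure

open Set Metric MeasureTheory

section Heights

variable {S : Type*} [TopologicalSpace S] [T2Space S] [CompactSpace S] {X : TranslationStructure S}

theorem IsCompletelyPeriodic.hits {v : ℂ} (hv : X.IsCompletelyPeriodic v) {x : S}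
    (hx : x ∉ X.sing) (h : x ∉ X.periodicPart v) : X.Hits v x := by
  by_contra hh
  obtain ⟨γ, hγ, h0⟩ := not_hits_exists_line hx hh
  exact h ⟨γ, hγ, h0, hv.2 γ hγ⟩

theorem Twist.apply_eq {v w : ℂ} {t : ℝ} {L : ℂ →ₗ[ℝ] ℂ} {g : S ≃ₜ S}
    (h : X.Twist v w t L g) (hv : X.IsCompletelyPeriodic v) {x : S} (hx : x ∉ X.sing)
    (hP : x ∉ X.periodicPart v) : g x = x :=
  h.fixed x (hv.hits hx hP)

/-- Regular points outside the periodic part are fixed by the twist, so near `y` they can only have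
the `w`-coordinate of `y`. -/
theorem Twist.exists_mem_periodicPart {v w : ℂ} {t : ℝ} {L : ℂ →ₗ[ℝ] ℂ} {g : S ≃ₜ S}
    (h : X.Twist v w t L g) (hv : X.IsCompletelyPeriodic v) {y : S} (hy : y ∉ X.sing) :
    ∃ ε > 0, ∀ (a b : ℝ) (m : S), ‖a • v + b • w‖ < ε → X.Seg y (a • v + b • w) m → b ≠ 0 →
      m ∈ X.periodicPart v := by
  obtain ⟨ε, hε, H⟩ := h.fixed_isolated hy
  refine ⟨ε, hε, fun a b m hn hs hb => ?_⟩
  by_contra hm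
  exact hb ((h.map_eq_self_iff hv.1 a b).1 (H _ m hn hs (h.apply_eq hv hs.right_notMem hm)))

theorem Twist.countable_notMem {v w : ℂ} {t : ℝ} {L : ℂ →ₗ[ℝ] ℂ} {g : S ≃ₜ S}
    (h : X.Twist v w t L g) (hv : X.IsCompletelyPeriodic v) {γ : ℝ → S} {a : ℝ}
    (hγ : X.IsStraightLine (w + a • v) γ) : {t | γ t ∉ X.periodicPart v}.Countable := by
  have key : ∀ n : ℕ, ({t | γ t ∉ X.periodicPart v} ∩ Icc (-n : ℝ) n).Finite := fun n => by
    refine isCompact_Icc.finite_inter_of_isolated fun t₀ _ => ?_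
    obtain ⟨ε, hε, H⟩ := h.exists_mem_periodicPart hv (hγ.2.1 t₀)
    have h1 : ∀ᶠ t in 𝓝 t₀, ‖(t - t₀) • (w + a • v)‖ < ε :=
      ContinuousAt.eventually_lt (by fun_prop) continuousAt_const (by simpa)
    filter_upwards [nhdsWithin_le_nhds h1, self_mem_nhdsWithin] with t ht hne
    have e : (t - t₀) • (w + a • v) = ((t - t₀) * a) • v + (t - t₀) • w := by
      rw [smul_add, smul_smul, add_comm]
    rw [e] at ht
    have hs := hγ.seg t₀ t
    rw [e] at hs
    simpa using H _ _ _ ht hs (sub_ne_zero.2 hne)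
  refine (countable_iUnion fun n => (key n).countable).mono fun t ht => ?_
  obtain ⟨n, hn⟩ := exists_nat_ge |t|
  exact mem_iUnion.2 ⟨n, ht, abs_le.1 hn⟩

/-- In the direction of a twist there are only finitely many cylinders. -/
theorem Twist.finite_cylinder {v w : ℂ} {t : ℝ} {L : ℂ →ₗ[ℝ] ℂ} {g : S ≃ₜ S}
    (h : X.Twist v w t L g) (hv : X.IsCompletelyPeriodic v) (hvw : LinearIndependent ℝ ![v, w]) :
    Finite (X.Cylinder v) := by
  obtain ⟨α, β, hαβ, -⟩ := exists_plane_coords hvw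
  obtain ⟨K, hK, hKs, hKm⟩ := X.exists_isCompact_regular
  have loc : ∀ y, y ∉ X.sing → ∃ F : Set (X.Cylinder v), F.Finite ∧
      ∀ᶠ z in 𝓝 y, ∀ D : X.Cylinder v, InCylinder D z → D ∈ F := by
    intro y hy
    obtain ⟨ε₁, hε₁, H⟩ := h.exists_mem_periodicPart hv hy
    obtain ⟨ε₂, hε₂, hex⟩ := exists_short_seg hy
    obtain ⟨ε, hε, hεle⟩ : ∃ ε > 0, ε ≤ min ε₁ ε₂ := ⟨_, lt_min hε₁ hε₂, le_rfl⟩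
    have : Nonempty S := ⟨y⟩
    choose! Φ hΦ using hex
    have hΦc : ContinuousOn Φ (ball 0 ε) :=
      (IsFlatOn.of_seg_const hy (a := id) continuousOn_id fun ζ hζ =>
        hΦ ζ ((mem_ball_zero_iff.1 hζ).trans_le (hεle.trans (min_le_right _ _)))).continuousOn
    -- Each half disc beside the leaf through `y` is convex and lies in the periodic part, hence in
    -- a single cylinder. Points on the leaf itself can only add the cylinder containing `y`.
    have key : ∀ A : Set ℂ, Convex ℝ A → (∀ ζ ∈ A, β ζ ≠ 0) → ∃ F : Set (X.Cylinder v), F.Finite ∧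
        ∀ ζ ∈ ball 0 ε ∩ A, ∀ D : X.Cylinder v, InCylinder D (Φ ζ) → D ∈ F := by
      intro A hA hA0
      have hP : ∀ ζ ∈ ball 0 ε ∩ A, Φ ζ ∈ X.periodicPart v := by
        rintro ζ ⟨hζ, hζA⟩
        rw [mem_ball_zero_iff] at hζ
        have hs := hΦ ζ (hζ.trans_le (hεle.trans (min_le_right _ _)))
        have hn := hζ.trans_le (hεle.trans (min_le_left _ _))
        rw [hαβ ζ] at hn hs
        rw [← hαβ ζ] at hs
        refine H (α ζ) (β ζ) _ hn ?_ (hA0 ζ hζA)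
        rw [← hαβ ζ]
        exact hΦ ζ (hζ.trans_le (hεle.trans (min_le_right _ _)))
      rcases (ball 0 ε ∩ A).eq_empty_or_nonempty with he | ⟨ζ₀, hζ₀⟩
      · exact ⟨∅, finite_empty, by simp [he]⟩
      · refine ⟨{ConnectedComponents.mk (⟨_, hP ζ₀ hζ₀⟩ : X.periodicPart v)}, finite_singleton _,
          fun ζ hζ D hD => ?_⟩
        have hc : ContinuousOn Φ (ball 0 ε ∩ A) := hΦc.mono inter_subset_left
        exact hD.eq (InCylinder.of_path (v := v) ((convex_ball _ _).inter hA).isPreconnected hc hP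
          hζ₀ hζ ⟨_, rfl⟩)
    obtain ⟨F₁, hF₁, H₁⟩ := key {ζ | 0 < β ζ} (convex_halfSpace_gt β.isLinear 0)
      fun ζ hζ => ne_of_gt hζ
    obtain ⟨F₂, hF₂, H₂⟩ := key {ζ | β ζ < 0} (convex_halfSpace_lt β.isLinear 0)
      fun ζ hζ => ne_of_lt hζ
    refine ⟨F₁ ∪ F₂ ∪ {D | InCylinder D y}, (hF₁.union hF₂).union
      (Set.Subsingleton.finite fun D hD D' hD' => InCylinder.eq hD hD'), ?_⟩
    filter_upwards [eventually_short_seg hy hε] with z hz D hD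
    obtain ⟨ζ, hζ, hs⟩ := hz
    have hz : z = Φ ζ := hs.unique (hΦ ζ (hζ.trans_le (hεle.trans (min_le_right _ _))))
    have hζb : ζ ∈ ball (0 : ℂ) ε := mem_ball_zero_iff.2 hζ
    rcases lt_trichotomy (β ζ) 0 with hb | hb | hb
    · exact Or.inl (Or.inr (H₂ ζ ⟨hζb, hb⟩ D (hz ▸ hD)))
    · right
      rw [hαβ ζ, hb, zero_smul, add_zero] at hs
      exact hD.of_seg (s := -α ζ) (by simpa using hs.symm)
    · exact Or.inl (Or.inl (H₁ ζ ⟨hζb, hb⟩ D (hz ▸ hD)))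
  have fin : ∃ F : Set (X.Cylinder v), F.Finite ∧
      ∀ z ∈ K, ∀ D : X.Cylinder v, InCylinder D z → D ∈ F := by
    refine hK.induction_on (p := fun K => ∃ F : Set (X.Cylinder v), F.Finite ∧
      ∀ z ∈ K, ∀ D : X.Cylinder v, InCylinder D z → D ∈ F) ⟨∅, finite_empty, by simp⟩ ?_ ?_ ?_
    · rintro s t hst ⟨F, hF, h⟩
      exact ⟨F, hF, fun z hz => h z (hst hz)⟩
    · rintro s t ⟨F, hF, h⟩ ⟨F', hF', h'⟩
      exact ⟨F ∪ F', hF.union hF', fun z hz D hD => hz.imp (fun hz => h z hz D hD)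
        (fun hz => h' z hz D hD)⟩
    · intro x hx
      obtain ⟨F, hF, h⟩ := loc x (hKs x hx)
      exact ⟨_, nhdsWithin_le_nhds h, F, hF, fun z hz => hz⟩
  obtain ⟨F, hF, hFm⟩ := fin
  -- Every cylinder meets `K`, because its waist curve returns there.
  have : F = univ := by
    refine eq_univ_of_forall fun D => ?_
    obtain ⟨γ, hγ, h0, -⟩ := base_mem D
    obtain ⟨r, -, hr⟩ := hKm v γ hv.1 hγ 0
    refine hFm _ hr D ((inCylinder_base D).of_seg (s := r) ?_)
    rw [← h0]
    simpa using hγ.seg 0 r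
  rw [this] at hF
  exact finite_univ_iff.1 hF

/-- If the surface has singular points, transversal closed lines leave the union of the closed
leaves. -/
theorem ClosedLine.exists_notMem_periodicPart [ConnectedSpace S] {v w : ℂ}
    (hvw : LinearIndependent ℝ ![v, w]) (hne : X.sing.Nonempty) {γ : ℝ → S} {c : ℝ}
    (hγ : X.ClosedLine w γ c) : ∃ t, γ t ∉ X.periodicPart v := by
  by_contra! hP
  obtain ⟨p, hp⟩ := hne
  have hcr : ∀ τ y, y ∈ X.crossSet v w (γ τ) := fun τ y =>
    (mem_crossSet_iff_line hγ.line τ y).2 fun r _ => hP _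
  obtain ⟨c', hc', hs⟩ := mem_periodicPart_iff.1 (hP 0)
  have hs' : ∀ τ, X.Seg (γ τ) (c' • v) (γ τ) := fun τ => by
    obtain ⟨m', h1, h2⟩ := (crossSet_shear 0 (hcr 0 τ) hs).2 (γ τ) (by simpa using hγ.line.seg 0 τ)
    simp only [zero_mul, add_zero, zero_smul] at h1 h2
    rwa [← (show X.Seg (γ 0) (τ • w) (γ τ) by simpa using hγ.line.seg 0 τ).unique h2] at h1
  have hex : ∀ q : ℝ × ℝ, ∃ z, X.Seg (γ q.1) (q.2 • v) z := fun q =>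
    exists_seg_of_mem_periodicPart (hP q.1) q.2
  choose Φ hΦ using hex
  -- Otherwise the leaves through `γ` sweep out an immersed torus. Its image is compact, and open as
  -- a class of `Cross`, so by connectedness it is all of `S`, although it avoids the singular
  -- points.
  have hΦc : Continuous Φ := by
    rw [← continuousOn_univ]
    refine (IsFlatOn.of_seg (Z := ℝ × ℝ) (d := fun q => q.1 • w) (Ψ := fun q => γ q.1)
      (a := fun q => q.2 • v) ?_ (by fun_prop) (by fun_prop) fun q _ => hΦ q).continuousOn
    exact hγ.line.isFlatOn.comp (h := Prod.fst) continuousOn_fst fun _ _ => trivial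
  have himg : range Φ = Φ '' (Icc 0 c ×ˢ Icc 0 c') := by
    refine Subset.antisymm ?_ (image_subset_range _ _)
    rintro _ ⟨⟨τ, s⟩, rfl⟩
    obtain ⟨b, hb, hbτ⟩ := hγ.exists_mem_Ico τ
    have hn : ∀ n : ℕ, X.Seg (γ b) ((n * c') • v) (γ b) := fun n => by
      induction n with
      | zero => simpa using Seg.refl (hγ.line.2.1 b)
      | succ n ih =>
        have := ih.trans_smul (hs' b)
        rw [show (n : ℝ) * c' + c' = (n + 1 : ℕ) * c' by push_cast; ring] at this
        exact this
    have hz : ∀ n : ℤ, X.Seg (γ b) ((n * c') • v) (γ b) := fun n => by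
      obtain ⟨k, rfl | rfl⟩ := n.eq_nat_or_neg
      · simpa using hn k
      · simpa using (hn k).symm
    refine ⟨(b, toIcoMod hc' 0 s), ⟨⟨hb.1, hb.2.le⟩, ?_⟩, ?_⟩
    · have := toIcoMod_mem_Ico hc' 0 s
      rw [zero_add] at this
      exact ⟨this.1, this.2.le⟩
    · have h2 := hΦ (b, toIcoMod hc' 0 s)
      have h3 := hΦ (τ, s)
      simp only at h2 h3
      rw [← hbτ] at h3
      have h4 := (hz (-toIcoDiv hc' 0 s)).symm
      rw [← neg_smul] at h4
      have h5 := h4.trans_smul h2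
      have e : -((-toIcoDiv hc' 0 s : ℤ) * c') + toIcoMod hc' 0 s = s := by
        have := toIcoMod_add_toIcoDiv_zsmul hc' 0 s
        rw [zsmul_eq_mul] at this
        push_cast; linarith
      rw [e] at h5
      exact h5.unique h3
  have hclosed : IsClosed (range Φ) := by
    rw [himg]
    exact ((isCompact_Icc.prod isCompact_Icc).image hΦc).isClosed
  have hopen : IsOpen (range Φ) := by
    have hcross : range Φ = {z | X.Cross v w (γ 0) z} := by
      ext z
      constructor
      · rintro ⟨q, rfl⟩
        exact ⟨q.1, hcr 0 q.1, γ q.1, q.2, by simpa using hγ.line.seg 0 q.1, hΦ q⟩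
      · rintro ⟨y, -, m, s, h1, h2⟩
        obtain rfl : γ y = m :=
          (by simpa using hγ.line.seg 0 y : X.Seg (γ 0) (y • w) (γ y)).unique h1
        exact ⟨(y, s), (hΦ (y, s)).unique h2⟩
    rw [isOpen_iff_mem_nhds]
    rintro _ ⟨q, rfl⟩
    have hq : Φ q ∈ X.periodicPart v := (hΦ q).mem_periodicPart (hP q.1)
    rw [hcross]
    filter_upwards [eventually_cross hvw hq] with z hz
    have : Φ q ∈ {z | X.Cross v w (γ 0) z} := hcross ▸ mem_range_self q
    exact Cross.trans this hz
  have huniv := IsClopen.eq_univ ⟨hclosed, hopen⟩ (range_nonempty Φ)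
  obtain ⟨q, hq⟩ : p ∈ range Φ := huniv ▸ mem_univ p
  exact (hΦ q).right_notMem (hq ▸ hp)

end Heights

end TranslationStructure

/-! ### Dehn twists: heights against circumferences, and the case of the torus. -/

namespace TranslationStructure

open Set Metric MeasureTheory

section Modulus

variable {S : Type*} [TopologicalSpace S] [T2Space S] [CompactSpace S] {X : TranslationStructure S}

/-- Near a fixed point the twist is the linear shear: a point at height `y - τ` slides along its
leaf by `(y - τ) * t`. -/
theorem Twist.eventually_seg {v w : ℂ} {t : ℝ} {L : ℂ →ₗ[ℝ] ℂ} {g : S ≃ₜ S}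
    (h : X.Twist v w t L g) {γ : ℝ → S} (hγ : X.IsStraightLine w γ) {τ : ℝ}
    (hτ : g (γ τ) = γ τ) : ∀ᶠ y in 𝓝 τ, X.Seg (γ y) (((y - τ) * t) • v) (g (γ y)) := by
  obtain ⟨ε, hε, -, H⟩ := exists_seg_sub_of_small (hγ.2.1 τ)
  have h1 : ∀ᶠ y in 𝓝 τ, ‖(y - τ) • w‖ < ε :=
    ContinuousAt.eventually_lt (by fun_prop) continuousAt_const (by simpa)
  have h2 : ∀ᶠ y in 𝓝 τ, ‖(y - τ) • (w + t • v)‖ < ε :=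
    ContinuousAt.eventually_lt (by fun_prop) continuousAt_const (by simpa)
  filter_upwards [h1, h2] with y h1 h2
  have h3 := h.affine.2 _ _ _ (hγ.seg τ y)
  rw [hτ, map_smul, h.map_right] at h3
  have := H _ _ _ _ h1 h2 (hγ.seg τ y) h3
  rwa [smul_add, add_sub_cancel_left, smul_smul] at this

theorem ClosedLine.eq_int_mul_of_seg {v : ℂ} {γ : ℝ → S} {c : ℝ} (h : X.ClosedLine v γ c) {r : ℝ}
    (hr : X.Seg (γ 0) (r • v) (γ 0)) : ∃ n : ℤ, r = n * c := by
  have h1 : X.Seg (γ 0) (r • v) (γ r) := by simpa using h.line.seg 0 r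
  simpa using (h.eq_iff 0 r).1 (hr.unique h1)

theorem seg_self_of_crossSet {v w : ℂ} {x m : S} {y r : ℝ} (hy : y ∈ X.crossSet v w x)
    (hm : X.Seg x (y • w) m) (hr : X.Seg x (r • v) x) : X.Seg m (r • v) m := by
  obtain ⟨m', h1, h2⟩ := (crossSet_shear 0 hy hr).2 m hm
  simp only [zero_mul, add_zero, zero_smul] at h1 h2
  rwa [← hm.unique h2] at h1

/-- The twist restricts to a multiple Dehn twist of every cylinder. -/
theorem Twist.mul_height [ConnectedSpace S] {v w : ℂ} {t t' : ℝ} {L L' : ℂ →ₗ[ℝ] ℂ} {g g' : S ≃ₜ S}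
    (h : X.Twist v w t L g) (h' : X.Twist w v t' L' g') (hv : X.IsCompletelyPeriodic v)
    (hw : X.IsCompletelyPeriodic w) (hvw : LinearIndependent ℝ ![v, w]) (hne : X.sing.Nonempty)
    (D : X.Cylinder v) {ℓ : ℝ → S} {c : ℝ} (hℓ : X.ClosedLine v ℓ c) (h0 : ℓ 0 = base D) :
    ∃ n : ℤ, t * height w D = n * c := by
  -- A transversal through the cylinder that is a complete closed line is needed. It exists because
  -- nearby points of the waist curve are periodic for `w`, thanks to the second twist.
  obtain ⟨s, γ, c', hγ, hs⟩ : ∃ (s : ℝ) (γ : ℝ → S) (c' : ℝ), X.ClosedLine w γ c' ∧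
      X.Seg (base D) (s • v) (γ 0) := by
    obtain ⟨ε, hε, H⟩ := h'.exists_mem_periodicPart hw
      (notMem_sing_of_mem_periodicPart (base_mem D))
    have hvn : 0 < ‖v‖ := norm_pos_iff.2 hv.1
    obtain ⟨m, hm⟩ := exists_seg_of_mem_periodicPart (base_mem D) (ε / (2 * ‖v‖))
    have hm' := H 0 (ε / (2 * ‖v‖)) m (by
      rw [zero_smul, zero_add, norm_smul, Real.norm_eq_abs, abs_of_pos (by positivity)]
      field_simp; linarith) (by simpa using hm) (by positivity)
    obtain ⟨γ, c', hγ, rfl⟩ := exists_closedLine hw.1 hm'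
    exact ⟨_, γ, c', hγ, hm⟩
  have hP0 : γ 0 ∈ X.periodicPart v := hs.mem_periodicPart (base_mem D)
  obtain ⟨t₀, ht₀⟩ := hγ.exists_notMem_periodicPart hvw hne
  set Z := {y | γ y ∉ X.periodicPart v} with hZ
  have hZc : IsClosed Z := ((isOpen_periodicPart v).preimage hγ.line.1).isClosed_compl
  have hZn : ∀ n : ℤ, t₀ + n * c' ∈ Z := fun n => by
    change γ _ ∉ _
    rwa [hγ.apply_add]
  -- `q` and, below, `p` are the times at which the transversal leaves the cylinder on its two
  -- sides; there it passes through fixed points of the twist.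
  obtain ⟨q, ⟨hqZ, hq0⟩, hq⟩ : ∃ q, IsLeast (Z ∩ Ici 0) q := by
    refine ⟨_, (hZc.inter isClosed_Ici).isLeast_csInf ?_ ⟨0, fun x hx => hx.2⟩⟩
    obtain ⟨k, hk⟩ := exists_int_ge (-t₀ / c')
    exact ⟨_, hZn k, by have := (div_le_iff₀ hγ.pos).1 hk; rw [mem_Ici]; linarith⟩
  obtain ⟨p, ⟨hpZ, hp0⟩, hp⟩ : ∃ p, IsGreatest (Z ∩ Iic 0) p := by
    refine ⟨_, (hZc.inter isClosed_Iic).isGreatest_csSup ?_ ⟨0, fun x hx => hx.2⟩⟩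
    obtain ⟨k, hk⟩ := exists_int_le (-t₀ / c')
    exact ⟨_, hZn k, by have := (le_div_iff₀ hγ.pos).1 hk; rw [mem_Iic]; linarith⟩
  rw [mem_Ici] at hq0
  rw [mem_Iic] at hp0
  have hq0 : 0 < q := lt_of_le_of_ne hq0 (by rintro rfl; exact hqZ hP0)
  have hp0 : p < 0 := lt_of_le_of_ne hp0 (by rintro rfl; exact hpZ hP0)
  have hgood : ∀ y ∈ Ioo p q, γ y ∈ X.periodicPart v := by
    rintro y ⟨h1, h2⟩
    by_contra hy
    rcases le_total 0 y with h3 | h3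
    · exact absurd (hq ⟨hy, h3⟩) (not_le.2 h2)
    · exact absurd (hp ⟨hy, h3⟩) (not_le.2 h1)
  have hcr : ∀ y ∈ Ioo p q, ∀ y' ∈ Ioo p q, y' - y ∈ X.crossSet v w (γ y) := by
    intro y hy y' hy'
    rw [mem_crossSet_iff_line hγ.line]
    intro r hr
    refine hgood _ ?_
    rw [mem_uIcc] at hr
    rcases hr with hr | hr
    · exact ⟨by linarith [hy.1], by linarith [hy'.2]⟩
    · exact ⟨by linarith [hy'.1], by linarith [hy.2]⟩
  have hJ : X.crossSet v w (base D) = Ioo p q := by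
    have := crossSet_eq_of_seg (w := w) 0 hs
    rw [zero_smul, add_zero] at this
    rw [← this]
    ext y
    constructor
    · intro hy
      have e := (mem_crossSet_iff_line hγ.line 0 y).1 hy
      simp only [zero_add] at e
      constructor
      · by_contra! hle
        exact hpZ (e p (mem_uIcc.2 (Or.inr ⟨hle, hp0.le⟩)))
      · by_contra! hle
        exact hqZ (e q (mem_uIcc.2 (Or.inl ⟨hq0.le, hle⟩)))
    · intro hy
      simpa using hcr 0 ⟨hp0, hq0⟩ y hy
  have hh : height w D = q - p := by
    rw [height, hJ, Real.volume_Ioo, ENNReal.toReal_ofReal (by linarith)]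
  have hpq : p < q := hp0.trans hq0
  obtain ⟨y₀, hy₀, hs₀⟩ : ∃ y ∈ Ioo p q, X.Seg (γ y) (((y - q) * t) • v) (g (γ y)) := by
    have h1 := nhdsWithin_le_nhds (s := Iio q)
      (h.eventually_seg hγ.line (h.apply_eq hv (hγ.line.2.1 q) hqZ))
    obtain ⟨y, hy, hy'⟩ := (Filter.Eventually.and h1 (Ioo_mem_nhdsLT hpq)).exists
    exact ⟨y, hy', hy⟩
  obtain ⟨y₁, hy₁, hs₁⟩ : ∃ y ∈ Ioo p q, X.Seg (γ y) (((y - p) * t) • v) (g (γ y)) := by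
    have h1 := nhdsWithin_le_nhds (s := Ioi p)
      (h.eventually_seg hγ.line (h.apply_eq hv (hγ.line.2.1 p) hpZ))
    obtain ⟨y, hy, hy'⟩ := (Filter.Eventually.and h1 (Ioo_mem_nhdsGT hpq)).exists
    exact ⟨y, hy', hy⟩
  -- The sliding of the leaves seen from the side of `q` is carried across the cylinder to `y₁`,
  -- where it is also known from the side of `p`. The two differ by `(q - p) * t`, which must be a
  -- period of the leaf.
  have key : X.Seg (γ y₁) (((y₁ - q) * t) • v) (g (γ y₁)) := by
    obtain ⟨m', h1, h2⟩ := (crossSet_shear t (hcr y₀ hy₀ y₁ hy₁) hs₀).2 _ (hγ.line.seg y₀ y₁)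
    have h3 := h.affine.2 _ _ _ (hγ.line.seg y₀ y₁)
    rw [map_smul, h.map_right] at h3
    rw [h2.unique h3] at h1
    convert h1 using 2
    ring
  have h1 : X.Seg (γ y₁) ((t * (q - p)) • v) (γ y₁) := by
    have h2 := key.symm
    rw [← neg_smul] at h2
    have := hs₁.trans_smul h2
    convert this using 2
    ring
  have h2 : X.Seg (γ 0) ((t * (q - p)) • v) (γ 0) :=
    seg_self_of_crossSet (hcr y₁ hy₁ 0 ⟨hp0, hq0⟩) (hγ.line.seg y₁ 0) h1
  have h3 : X.Seg (ℓ 0) ((t * (q - p)) • v) (ℓ 0) := by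
    have h4 := hs.symm
    rw [← neg_smul] at h4
    have := (hs.trans_smul h2).trans_smul h4
    rw [h0]
    convert this using 2
    ring
  rw [hh]
  exact hℓ.eq_int_mul_of_seg h3

theorem exists_seg_of_sing_eq_empty (hS : X.sing = ∅) (x : S) (ζ : ℂ) : ∃ y, X.Seg x ζ y := by
  rcases hitsAt_or_forall_seg (X := X) (x := x) (by simp [hS]) ζ with ⟨T, hT, γ, hγ, p, hp, -⟩ | hT
  · simp [hS] at hp
  · simpa using hT 1 zero_le_one

theorem Seg.sub_of_sing_eq_empty (hS : X.sing = ∅) {x y₁ y₂ : S} {ζ₁ ζ₂ : ℂ} (h₁ : X.Seg x ζ₁ y₁)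
    (h₂ : X.Seg x ζ₂ y₂) : X.Seg y₁ (ζ₂ - ζ₁) y₂ :=
  h₁.sub h₂ fun ζ _ => exists_seg_of_sing_eq_empty hS x ζ

theorem Seg.add_of_sing_eq_empty (hS : X.sing = ∅) {x y z : S} {ζ₁ ζ₂ : ℂ} (h₁ : X.Seg x ζ₁ y)
    (h₂ : X.Seg y ζ₂ z) : X.Seg x (ζ₁ + ζ₂) z := by
  have := Seg.sub_of_sing_eq_empty hS h₁.symm h₂
  rwa [sub_neg_eq_add, add_comm] at this

/-- Closed segments can be translated on a torus. -/
theorem seg_self_of_sing_eq_empty (hS : X.sing = ∅) [ConnectedSpace S] {x y : S} {ζ : ℂ}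
    (h : X.Seg x ζ x) :
    X.Seg y ζ y := by
  refine isPreconnected_univ.imp_of_eventually_iff (p := fun z => X.Seg z ζ z) (fun z _ => ?_)
    (mem_univ x) (mem_univ y) h
  have tr : ∀ z z' η, X.Seg z η z' → X.Seg z ζ z → X.Seg z' ζ z' := fun z z' η h1 h2 => by
    have := Seg.sub_of_sing_eq_empty hS h1 (Seg.add_of_sing_eq_empty hS h2 h1)
    rwa [add_sub_cancel_right] at this
  filter_upwards [nhdsWithin_le_nhds (eventually_short_seg (X := X) (x := z) (by simp [hS])
    one_pos)] with z' hz'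
  obtain ⟨η, -, hη⟩ := hz'
  exact ⟨tr _ _ _ hη.symm, tr _ _ _ hη⟩

/-- Without singular points the crossing set is all of `ℝ` and has no finite length. The height is
instead the generator of the group of `w`-coordinates of closed geodesics through the base point,
discrete because the waist has no short transversal connections. -/
theorem exists_height_of_sing_eq_empty (hS : X.sing = ∅) [ConnectedSpace S]
    {v w : ℂ} {t : ℝ} {L : ℂ →ₗ[ℝ] ℂ}
    {g : S ≃ₜ S} (h : X.Twist v w t L g) (hv : X.IsCompletelyPeriodic v)
    (hvw : LinearIndependent ℝ ![v, w]) [Fintype (X.Cylinder v)] :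
    ∃ ht : X.Cylinder v → ℝ,
      (∀ (a : ℝ) (γ : ℝ → S) (c : ℝ), X.ClosedLine (w + a • v) γ c →
        c = ∑ D, ((range γ ∩ X.waist v D).ncard : ℝ) * ht D) ∧
      ∀ D, ∀ (ℓ : ℝ → S) (c : ℝ), X.ClosedLine v ℓ c → ℓ 0 = base D →
        ∃ n : ℤ, t * ht D = n * c := by
  have hper : ∀ x, x ∈ X.periodicPart v := fun x => by
    by_contra hx
    obtain ⟨T, -, ⟨γ, -, p, hp, -⟩ | ⟨γ, -, p, hp, -⟩⟩ := hv.hits (x := x) (by simp [hS]) hx <;>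
      simp [hS] at hp
  have huniv : X.periodicPart v = univ := eq_univ_of_forall hper
  have hsub : Subsingleton (X.Cylinder v) := by
    have : PreconnectedSpace (X.periodicPart v) := by
      rw [← isPreconnected_iff_preconnectedSpace, huniv]
      exact isPreconnected_univ
    infer_instance
  obtain ⟨D⟩ : Nonempty (X.Cylinder v) :=
    ⟨ConnectedComponents.mk ⟨Classical.arbitrary S, hper _⟩⟩
  obtain ⟨ℓ, c, hℓ, hℓ0⟩ := exists_closedLine hv.1 (base_mem D)
  have hreg : ∀ x, x ∉ X.sing := fun x => by simp [hS]
  let R : AddSubgroup ℝ :=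
    { carrier := {r | ∃ s : ℝ, X.Seg (base D) (r • w + s • v) (base D)}
      zero_mem' := ⟨0, by simpa using Seg.refl (hreg _)⟩
      add_mem' := by
        rintro r r' ⟨s, hs⟩ ⟨s', hs'⟩
        refine ⟨s + s', ?_⟩
        have := Seg.add_of_sing_eq_empty hS hs hs'
        convert this using 1
        module
      neg_mem' := by
        rintro r ⟨s, hs⟩
        refine ⟨-s, ?_⟩
        have := hs.symm
        convert this using 1
        module }
  have hRmem : ∀ r, r ∈ R ↔ ∃ s : ℝ, X.Seg (base D) (r • w + s • v) (base D) := fun r => Iff.rfl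
  obtain ⟨ε, hε, hiso⟩ := hℓ.exists_no_short_connection hvw
  have hR : ∀ r ∈ R, |r| < ε → r = 0 := by
    rintro r ⟨s, hs⟩ hr
    have h1 : X.Seg (ℓ 0) (s • v) (ℓ s) := by simpa using hℓ.line.seg 0 s
    rw [hℓ0] at h1
    have h2 := Seg.sub_of_sing_eq_empty hS h1 hs
    rw [add_sub_cancel_right, ← hℓ0] at h2
    exact hiso _ _ _ hr h2
  obtain ⟨h₁, hh₁⟩ : ∃ b, R = AddSubgroup.closure {b} := by
    refine AddSubgroup.cyclic_of_isolated_zero hε ?_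
    rw [Set.disjoint_left]
    rintro r hr ⟨h1, h2⟩
    exact h1.ne' (hR r hr (by rwa [abs_of_pos h1]))
  have hcyc : ∀ r, r ∈ R ↔ ∃ n : ℤ, r = n * |h₁| := fun r => by
    rw [hh₁, AddSubgroup.mem_closure_singleton]
    rcases abs_choice h₁ with e | e <;> rw [e]
    · simp only [zsmul_eq_mul, eq_comm]
    · constructor
      · rintro ⟨n, rfl⟩
        exact ⟨-n, by rw [zsmul_eq_mul]; push_cast; ring⟩
      · rintro ⟨n, rfl⟩
        exact ⟨-n, by rw [zsmul_eq_mul]; push_cast; ring⟩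
  refine ⟨fun _ => |h₁|, ?_, ?_⟩
  · intro a γ L hγ
    rw [Fintype.sum_subsingleton _ D]
    obtain ⟨τ, hτ, -⟩ := hγ.exists_hit_of_inCylinder hvw (t := 0) (D := D)
      ⟨hper _, Subsingleton.elim _ _⟩
    obtain ⟨s₀, hs₀⟩ := (mem_leaf_iff (base_mem D)).1 hτ
    -- The line meets the waist exactly at the multiples of the height, so a period `L = n * |h₁|`
    -- contains `n` hits.
    have hhit : ∀ r, γ (τ + r) ∈ X.waist v D ↔ r ∈ R := fun r => by
      have h1 := hγ.line.seg τ (τ + r)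
      rw [add_sub_cancel_left] at h1
      have h2 := Seg.add_of_sing_eq_empty hS hs₀ h1
      rw [waist_eq, mem_leaf_iff (base_mem D), hRmem]
      constructor
      · rintro ⟨s, hs⟩
        refine ⟨s₀ + r * a - s, ?_⟩
        have := Seg.add_of_sing_eq_empty hS h2 hs.symm
        convert this using 1
        module
      · rintro ⟨s, hs⟩
        refine ⟨s₀ + r * a - s, ?_⟩
        have := Seg.sub_of_sing_eq_empty hS hs h2
        convert this using 1
        module
    have hLR : L ∈ R := by
      rw [← hhit]
      have := hγ.apply_add τ 1
      rw [Int.cast_one, one_mul] at this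
      rwa [this]
    obtain ⟨n, hn⟩ := (hcyc L).1 hLR
    have hb : 0 < |h₁| := by
      refine lt_of_le_of_ne (abs_nonneg _) fun h0 => ?_
      rw [← h0, mul_zero] at hn
      exact hγ.pos.ne' hn
    have hn0 : 0 < n := by
      have := hγ.pos
      rw [hn] at this
      exact_mod_cast pos_of_mul_pos_left this hb.le
    lift n to ℕ using hn0.le
    have himg : range γ ∩ X.waist v D =
        (fun k : ℕ => γ (τ + k * |h₁|)) '' (Finset.range n : Set ℕ) := by
      ext x
      constructor
      · rintro ⟨⟨r, rfl⟩, hr⟩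
        obtain ⟨b, hb1, hb2⟩ := (hγ.comp_add τ).exists_mem_Ico (r - τ)
        simp only [add_sub_cancel] at hb2
        rw [← hb2, hhit, hcyc] at hr
        obtain ⟨k, rfl⟩ := hr
        have hk0 : 0 ≤ k := by
          have := hb1.1
          by_contra! hk
          have : (k : ℝ) * |h₁| < 0 := mul_neg_of_neg_of_pos (by exact_mod_cast hk) hb
          linarith
        lift k to ℕ using hk0
        refine ⟨k, ?_, by simpa using hb2⟩
        have := hb1.2
        rw [hn] at this
        simpa using (lt_of_mul_lt_mul_right this hb.le)
      · rintro ⟨k, -, rfl⟩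
        exact ⟨mem_range_self _, (hhit _).2 ((hcyc _).2 ⟨k, by simp⟩)⟩
    rw [himg, InjOn.ncard_image, ncard_coe_finset, Finset.card_range]
    · exact_mod_cast hn
    · intro k hk k' hk' hkk
      simp only [Finset.coe_range, mem_Iio] at hk hk'
      obtain ⟨m, hm⟩ := (hγ.eq_iff _ _).1 hkk
      rw [hn] at hm
      have e : ((k' : ℤ) - k - m * n : ℤ) = 0 := by
        have : (((k' : ℤ) - k - m * n : ℤ) : ℝ) * |h₁| = 0 := by
          push_cast at hm ⊢
          linarith
        exact_mod_cast (mul_eq_zero.1 this).resolve_right hb.ne'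
      have hm0 : m = 0 := by
        rcases lt_trichotomy m 0 with hm | hm | hm
        · nlinarith
        · exact hm
        · nlinarith
      subst hm0
      omega
  · intro D' ℓ' c' hℓ' h0
    -- Subtracting a closed geodesic of height `|h₁|` from its image under the twist, translated
    -- back to the base point, leaves the closed vector `(t * |h₁|) • v`.
    obtain ⟨s, hs⟩ := (hRmem _).1 ((hcyc |h₁|).2 ⟨1, by simp⟩)
    have h1 := h.affine.2 _ _ _ hs
    rw [map_add, map_smul, map_smul, h.map_left, h.map_right] at h1
    have h2 : X.Seg (base D) (|h₁| • (w + t • v) + s • v) (base D) :=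
      seg_self_of_sing_eq_empty hS h1
    have h3 := Seg.sub_of_sing_eq_empty hS hs h2
    refine hℓ'.eq_int_mul_of_seg (seg_self_of_sing_eq_empty hS (x := base D) ?_)
    convert h3 using 1
    module

/-- The heights of the cylinders in the direction of a twist: they compute the lengths of the
transversal closed lines, and their multiples by the twist number are multiples of the
circumferences. -/
theorem Twist.exists_height [ConnectedSpace S] {v w : ℂ} {t t' : ℝ} {L L' : ℂ →ₗ[ℝ] ℂ}
    {g g' : S ≃ₜ S} (h : X.Twist v w t L g) (h' : X.Twist w v t' L' g')
    (hv : X.IsCompletelyPeriodic v) (hw : X.IsCompletelyPeriodic w)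
    (hvw : LinearIndependent ℝ ![v, w]) [Fintype (X.Cylinder v)] :
    ∃ ht : X.Cylinder v → ℝ,
      (∀ (a : ℝ) (γ : ℝ → S) (c : ℝ), X.ClosedLine (w + a • v) γ c →
        c = ∑ D, ((range γ ∩ X.waist v D).ncard : ℝ) * ht D) ∧
      ∀ D, ∀ (ℓ : ℝ → S) (c : ℝ), X.ClosedLine v ℓ c → ℓ 0 = base D →
        ∃ n : ℤ, t * ht D = n * c := by
  rcases X.sing.eq_empty_or_nonempty with h0 | h0
  · exact exists_height_of_sing_eq_empty h0 h hv hvw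
  · refine ⟨height w, fun a γ c hγ => ?_, fun D ℓ c hℓ hD => h.mul_height h' hv hw hvw h0 D hℓ hD⟩
    obtain ⟨t₀, ht₀⟩ := hγ.exists_notMem_periodicPart (hvw.pair_add_smul a) h0
    exact hγ.length_eq_of_notMem hvw ht₀ (h.countable_notMem hv hγ.line)

end Modulus

end TranslationStructure

/-! ### Linear algebra over the rationals. -/

open Module Submodule in
/-- A field generated by elements which preserve a nonzero finite dimensional subspace. -/
theorem IntermediateField.finrank_adjoin_le_of_mul_mem {F E : Type*} [Field F] [Field E]
    [Algebra F E] {V : Submodule F E} [FiniteDimensional F V] (hV : V ≠ ⊥) {T : Set E}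
    (h : ∀ x ∈ T, ∀ y ∈ V, x * y ∈ V) :
    FiniteDimensional F (IntermediateField.adjoin F T) ∧
      finrank F (IntermediateField.adjoin F T) ≤ finrank F V := by
  -- The multipliers of `V` form an algebra which embeds linearly into `V` by evaluation at a
  -- nonzero vector `y`. Being algebraic over `F`, it is a field, so it contains the field generated
  -- by `T`.
  let M : Subalgebra F E :=
    { carrier := {x | ∀ y ∈ V, x * y ∈ V}
      mul_mem' := fun {a b} ha hb y hy => by rw [mul_assoc]; exact ha _ (hb y hy)
      add_mem' := fun {a b} ha hb y hy => by rw [add_mul]; exact V.add_mem (ha y hy) (hb y hy)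
      algebraMap_mem' := fun r y hy => by rw [← Algebra.smul_def]; exact V.smul_mem r hy }
  obtain ⟨y, hy, hy0⟩ := V.exists_mem_ne_zero_of_ne_bot hV
  let φ : M →ₗ[F] V :=
    { toFun := fun x => ⟨x * y, x.2 y hy⟩
      map_add' := fun a b => by ext; simp [add_mul]
      map_smul' := fun r a => by ext; simp }
  have hφ : Function.Injective φ := fun a b hab => by
    have := congrArg Subtype.val hab
    exact Subtype.ext (mul_right_cancel₀ hy0 this)
  have hfin : FiniteDimensional F M := FiniteDimensional.of_injective φ hφ
  have hint : Algebra.IsAlgebraic F M := inferInstance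
  let N : IntermediateField F E := Algebra.IsAlgebraic.toIntermediateField M
  have hle : IntermediateField.adjoin F T ≤ N :=
    IntermediateField.adjoin_le_iff.2 fun x hx => h x hx
  let ψ : IntermediateField.adjoin F T →ₗ[F] M :=
    { toFun := fun x => ⟨x, hle x.2⟩
      map_add' := fun _ _ => rfl
      map_smul' := fun _ _ => rfl }
  have hψ : Function.Injective ψ := fun a b hab => Subtype.ext (congrArg (fun z : M => (z : E)) hab)
  have hinj : Function.Injective (φ ∘ₗ ψ) := hφ.comp hψ
  exact ⟨FiniteDimensional.of_injective _ hinj, LinearMap.finrank_le_finrank_of_injective hinj⟩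

open Module Submodule in
-- Multiplication by `t` or `s` preserves dimensions, so the hypotheses give a cycle `dim k ≤ dim x
-- ≤ dim h ≤ dim y ≤ dim k`, and all inclusions are equalities.
theorem Submodule.span_range_eq_of_mul_mem {F E ι κ : Type*} [Field F] [Field E] [Algebra F E]
    [Finite ι] [Finite κ] {x k : ι → E} {y h : κ → E} {t s : E} (ht0 : t ≠ 0) (hs0 : s ≠ 0)
    (hx : ∀ i, x i ∈ span F (Set.range h)) (hy : ∀ j, y j ∈ span F (Set.range k))
    (hk : ∀ i, t * k i ∈ span F (Set.range x)) (hh : ∀ j, s * h j ∈ span F (Set.range y)) :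
    span F (Set.range x) = span F (Set.range h) ∧ span F (Set.range y) = span F (Set.range k) ∧
      (span F (Set.range k)).map (LinearMap.mulLeft F t) = span F (Set.range h) := by
  have hfr : ∀ {r : E}, r ≠ 0 → ∀ V : Submodule F E,
      finrank F (V.map (LinearMap.mulLeft F r)) = finrank F V := fun hr V =>
    (LinearEquiv.finrank_eq (V.equivMapOfInjective _ fun a b hab => mul_left_cancel₀ hr hab)).symm
  have : FiniteDimensional F (span F (Set.range x)) :=
    FiniteDimensional.span_of_finite F (Set.finite_range x)
  have : FiniteDimensional F (span F (Set.range y)) :=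
    FiniteDimensional.span_of_finite F (Set.finite_range y)
  have : FiniteDimensional F (span F (Set.range h)) :=
    FiniteDimensional.span_of_finite F (Set.finite_range h)
  have : FiniteDimensional F (span F (Set.range k)) :=
    FiniteDimensional.span_of_finite F (Set.finite_range k)
  have h1 : (span F (Set.range k)).map (LinearMap.mulLeft F t) ≤ span F (Set.range x) := by
    rw [map_le_iff_le_comap, span_le, Set.range_subset_iff]; exact hk
  have h2 : (span F (Set.range h)).map (LinearMap.mulLeft F s) ≤ span F (Set.range y) := by
    rw [map_le_iff_le_comap, span_le, Set.range_subset_iff]; exact hh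
  have hx := span_le.2 (Set.range_subset_iff.2 hx)
  have hy := span_le.2 (Set.range_subset_iff.2 hy)
  have e1 := finrank_mono h1
  have e2 := finrank_mono h2
  have e3 := finrank_mono hx
  have e4 := finrank_mono hy
  rw [hfr ht0] at e1
  rw [hfr hs0] at e2
  have c1 := eq_of_le_of_finrank_le hx (by omega)
  refine ⟨c1, eq_of_le_of_finrank_le hy (by omega), ?_⟩
  rw [← c1]
  exact eq_of_le_of_finrank_le h1 (by rw [hfr ht0]; omega)

open Module Submodule in
-- The span is the image of the row space of `A` under the linear map sending the `j`-th unit vector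
-- to `h j`.
theorem Matrix.finrank_span_le_eRank {ι κ E : Type*} [Finite ι] [Fintype κ] [Field E]
    [CharZero E] (A : Matrix ι κ ℚ) (h : κ → E) :
    ((finrank ℚ (span ℚ (Set.range fun i => ∑ j, (A i j : E) * h j)) : ℕ) : ℕ∞) ≤ A.eRank := by
  have : Fintype ι := Fintype.ofFinite ι
  have hne : A.eRank ≠ ⊤ := ne_top_of_le_ne_top (ENat.natCast_ne_top (Fintype.card κ)) (by
    simpa using A.eRank_le_card_width)
  rw [← ENat.natCast_toNat hne, Matrix.eRank_toNat_eq_rank, Matrix.rank_eq_finrank_span_row]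
  let φ : (κ → ℚ) →ₗ[ℚ] E := ∑ j, (LinearMap.toSpanSingleton ℚ E (h j)).comp (LinearMap.proj j)
  have : span ℚ (Set.range fun i => ∑ j, (A i j : E) * h j) = (span ℚ (Set.range A.row)).map φ := by
    rw [map_span, ← Set.range_comp]
    congr 2
    ext i
    change _ = φ (A i)
    simp [φ, Rat.smul_def]
  rw [this]
  exact_mod_cast finrank_map_le φ _

theorem planeAct_trace {v w : ℂ} (hvw : LinearIndependent ℝ ![v, w])
    (A : Matrix (Fin 2) (Fin 2) ℝ) : ∃ a b c d : ℝ, planeAct A v = a • v + b • w ∧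
      planeAct A w = c • v + d • w ∧ A.trace = a + d := by
  let B := basisOfLinearIndependentOfCardEqFinrank hvw (by simp)
  have hv : B 0 = v := by simp [B]
  have hw : B 1 = w := by simp [B]
  have hB : ∀ ζ, ζ = B.repr ζ 0 • v + B.repr ζ 1 • w := fun ζ => by
    have := B.sum_repr ζ
    rw [Fin.sum_univ_two, hv, hw] at this
    exact this.symm
  refine ⟨_, _, _, _, hB _, hB _, ?_⟩
  have h1 : LinearMap.trace ℝ ℂ (planeAct A) = A.trace := by
    rw [LinearMap.trace_eq_matrix_trace ℝ Complex.basisOneI, planeAct, LinearMap.toMatrix_toLin]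
  rw [← h1, LinearMap.trace_eq_matrix_trace ℝ B, Matrix.trace_fin_two, LinearMap.toMatrix_apply,
    LinearMap.toMatrix_apply, hv, hw]

/-! ### The bound on the degree of the trace field. -/

namespace TranslationStructure

open Set Metric

section Prelattice

variable {S : Type*} [TopologicalSpace S] [T2Space S] [CompactSpace S] {X : TranslationStructure S}

/-- A cone point is the only singular point in its coordinate patch, which contains other points. -/
theorem exists_notMem_sing [ConnectedSpace S] (X : TranslationStructure S) : ∃ x, x ∉ X.sing := by
  by_contra! hall
  obtain ⟨p⟩ := (inferInstance : Nonempty S)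
  obtain ⟨k, -, φ, hp, h0, hs, -⟩ := X.cone p (hall p)
  have h1 : ∀ᶠ ζ in 𝓝[≠] (0 : ℂ), ζ ∈ φ.target :=
    nhdsWithin_le_nhds (φ.open_target.mem_nhds (h0 ▸ φ.map_source hp))
  obtain ⟨ζ, hζ, hζ0⟩ := (h1.and self_mem_nhdsWithin).exists
  have h2 : φ.symm ζ ∈ φ.source ∩ X.sing := ⟨φ.map_target hζ, hall _⟩
  rw [hs, mem_singleton_iff] at h2
  apply hζ0
  rw [mem_singleton_iff, ← h0, ← h2, φ.right_inv hζ]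

/-- The inverse of `P` is parabolic with the same eigenvalue `a` and the opposite shear `-c`. -/
theorem exists_twists {P : Matrix.SpecialLinearGroup (Fin 2) ℝ} (hP : P ∈ X.veechGroup) {v w : ℂ}
    {a c : ℝ} (ha : a ^ 2 = 1) (hc : c ≠ 0) (hv : planeAct P v = a • v)
    (hw : planeAct P w = a • w + c • v) : ∃ (t t' : ℝ) (L L' : ℂ →ₗ[ℝ] ℂ) (g g' : S ≃ₜ S),
      X.Twist v w t L g ∧ X.Twist v w t' L' g' ∧ t * t' < 0 := by
  obtain ⟨f', hf'⟩ := X.veechGroup.inv_mem hP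
  obtain ⟨f, hf⟩ := hP
  have hinv : ∀ ζ, planeAct (P⁻¹ : Matrix.SpecialLinearGroup (Fin 2) ℝ) (planeAct P ζ) = ζ := by
    intro ζ
    have : planeAct (P⁻¹ : Matrix.SpecialLinearGroup (Fin 2) ℝ) ∘ₗ planeAct P = LinearMap.id := by
      rw [planeAct, planeAct, ← Matrix.toLin_mul, ← Matrix.SpecialLinearGroup.coe_mul]
      simp
    exact LinearMap.congr_fun this ζ
  have hv' : planeAct (P⁻¹ : Matrix.SpecialLinearGroup (Fin 2) ℝ) v = a • v := by
    have := hinv (a • v)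
    rwa [map_smul, hv, smul_smul, ← sq, ha, one_smul] at this
  have hw' : planeAct (P⁻¹ : Matrix.SpecialLinearGroup (Fin 2) ℝ) w = a • w + (-c) • v := by
    have h1 := hinv w
    rw [hw, map_add, map_smul, map_smul, hv'] at h1
    have h2 := congrArg (fun z => a • z) h1
    simp only [smul_add, smul_smul] at h2
    rw [← sq, ha, one_smul, mul_left_comm, ← sq, ha, mul_one] at h2
    rw [neg_smul, ← h2, add_neg_cancel_right]
  obtain ⟨t, L, g, ht, h⟩ := exists_twist hf.isAffine ha hc hv hw
  obtain ⟨t', L', g', ht', h'⟩ := exists_twist hf'.isAffine ha (neg_ne_zero.2 hc) hv' hw'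
  refine ⟨t, t', L, L', g, g', h, h', ?_⟩
  have h1 := mul_pos ht ht'
  have h2 : t * (a * c) * (t' * (a * -c)) = -((t * t') * (a ^ 2 * c ^ 2)) := by ring
  rw [h2, ha, one_mul] at h1
  have := sq_nonneg c
  nlinarith

open Module Submodule in
/-- Transverse parabolic directions: the trace field acts on the span of the heights. -/
theorem Twist.finrank_traceField_le [ConnectedSpace S] {v w : ℂ} {t t' : ℝ} {L L' : ℂ →ₗ[ℝ] ℂ}
    {g g' : S ≃ₜ S} (h : X.Twist v w t L g) (h' : X.Twist w v t' L' g')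
    (hv : X.IsCompletelyPeriodic v) (hw : X.IsCompletelyPeriodic w)
    (hvw : LinearIndependent ℝ ![v, w]) : FiniteDimensional ℚ X.traceField ∧
      ((finrank ℚ X.traceField : ℕ) : ℕ∞) ≤ (X.intersectionMatrix v w).eRank := by
  have hwv : LinearIndependent ℝ ![w, v] := LinearIndependent.pair_symm_iff.1 hvw
  have := h.finite_cylinder hv hvw
  have := h'.finite_cylinder hw hwv
  have := Fintype.ofFinite (X.Cylinder v)
  have := Fintype.ofFinite (X.Cylinder w)
  obtain ⟨k, hk, hkt⟩ := h.exists_height h' hv hw hvw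
  obtain ⟨η, hη, hηt⟩ := h'.exists_height h hw hv hwv
  choose γ c hγ hγ0 using fun C : X.Cylinder v => exists_closedLine hv.1 (base_mem C)
  choose δ d hδ hδ0 using fun D : X.Cylinder w => exists_closedLine hw.1 (base_mem D)
  have hwγ : ∀ C, X.waist v C = range (γ C) := fun C => by
    rw [waist_eq, ← hγ0, leaf_eq_range (hγ C).line]
  have hwδ : ∀ D, X.waist w D = range (δ D) := fun D => by
    rw [waist_eq, ← hδ0, leaf_eq_range (hδ D).line]
  have hc : ∀ C, c C = ∑ D, ((X.intersectionMatrix v w C D : ℚ) : ℝ) * η D := fun C => by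
    rw [hη 0 (γ C) (c C) (by simpa using hγ C)]
    simp [intersectionMatrix, hwγ]
  have hmemη : ∀ (a : ℝ) (ℓ : ℝ → S) (r : ℝ), X.ClosedLine (v + a • w) ℓ r →
      r ∈ span ℚ (range η) := fun a ℓ r hℓ => by
    rw [hη a ℓ r hℓ]
    refine sum_mem fun D _ => ?_
    rw [← nsmul_eq_mul]
    exact nsmul_mem (subset_span (mem_range_self D)) _
  have hmemk : ∀ (a : ℝ) (ℓ : ℝ → S) (r : ℝ), X.ClosedLine (w + a • v) ℓ r →
      r ∈ span ℚ (range k) := fun a ℓ r hℓ => by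
    rw [hk a ℓ r hℓ]
    refine sum_mem fun D _ => ?_
    rw [← nsmul_eq_mul]
    exact nsmul_mem (subset_span (mem_range_self D)) _
  -- Circumferences are combinations of the transversal heights by the length formula, and multiples
  -- of heights are multiples of circumferences by the Dehn twist relation.
  obtain ⟨hW, hU, hT⟩ := span_range_eq_of_mul_mem (F := ℚ) (x := c) (k := k) (y := d) (h := η)
    h.ne_zero h'.ne_zero (fun C => hmemη 0 (γ C) (c C) (by simpa using hγ C))
    (fun D => hmemk 0 (δ D) (d D) (by simpa using hδ D))
    (fun C => by
      obtain ⟨n, hn⟩ := hkt C _ _ (hγ C) (hγ0 C)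
      rw [hn, ← zsmul_eq_mul]
      exact zsmul_mem (subset_span (mem_range_self C)) _)
    (fun D => by
      obtain ⟨n, hn⟩ := hηt D _ _ (hδ D) (hδ0 D)
      rw [hn, ← zsmul_eq_mul]
      exact zsmul_mem (subset_span (mem_range_self D)) _)
  -- There is at least one cylinder, and its circumference is a positive element of the span.
  have hne : span ℚ (range η) ≠ ⊥ := by
    obtain ⟨x, hx⟩ := X.exists_notMem_sing
    obtain ⟨ε, hε, H⟩ := h.exists_mem_periodicPart hv hx
    obtain ⟨ε', hε', H'⟩ := exists_short_seg hx
    have hwn : 0 < ‖w‖ := norm_pos_iff.2 hw.1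
    have hmin : 0 < min ε ε' := lt_min hε hε'
    obtain ⟨r, hr, hlt⟩ : ∃ r : ℝ, 0 < r ∧ ‖r • w‖ < min ε ε' := by
      refine ⟨min ε ε' / (2 * ‖w‖), by positivity, ?_⟩
      rw [norm_smul, Real.norm_eq_abs, abs_of_pos (by positivity)]
      field_simp; linarith
    obtain ⟨m, hm⟩ := H' _ (hlt.trans_le (min_le_right _ _))
    have hmP := H 0 r m (by rw [zero_smul, zero_add]; exact hlt.trans_le (min_le_left _ _))
      (by rwa [zero_smul, zero_add]) hr.ne'
    have hpos := (hγ (ConnectedComponents.mk ⟨m, hmP⟩)).pos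
    intro hbot
    have h0 := subset_span (R := ℚ) (mem_range_self (f := c) (ConnectedComponents.mk ⟨m, hmP⟩))
    rw [hW, hbot, SetLike.mem_coe, Submodule.mem_bot] at h0
    exact hpos.ne' h0
  have : FiniteDimensional ℚ (span ℚ (range η)) :=
    FiniteDimensional.span_of_finite ℚ (finite_range η)
  -- Periods are positive, so images of closed lines only show `|r|`; the sign is absorbed by the
  -- subspace.
  have hstep : ∀ {ι : Type _} {x : ι → ℝ} {V : Submodule ℚ ℝ} {r : ℝ}, (∀ i, |r| * x i ∈ V) →
      ∀ z ∈ span ℚ (range x), r * z ∈ V := fun {ι x V r} hx z hz => by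
    have h1 : (span ℚ (range x)) ≤ V.comap (LinearMap.mulLeft ℚ r) := by
      refine span_le.2 (range_subset_iff.2 fun i => ?_)
      have := hx i
      rcases abs_choice r with e | e <;> rw [e] at this
      · exact this
      · rw [neg_mul] at this
        exact V.neg_mem_iff.1 this
    exact h1 hz
  -- The image of a closed line of velocity `u` has velocity `a • u + b • u'` and the same period;
  -- dividing the velocity by `a` multiplies the period by `|a|`.
  have hline : ∀ {u u' : ℂ} {A : ℂ →ₗ[ℝ] ℂ} {f : S ≃ₜ S} {a b : ℝ}, X.IsAffine A f →
      A u = a • u + b • u' → a ≠ 0 → ∀ {ℓ : ℝ → S} {r : ℝ}, X.ClosedLine u ℓ r →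
      ∃ (e : ℝ) (ℓ' : ℝ → S), X.ClosedLine (u + e • u') ℓ' (|a| * r) := by
    intro u u' A f a b hf hA ha ℓ r hℓ
    have h1 := (hℓ.map hf).comp_mul (inv_ne_zero ha)
    rw [hA, smul_add, smul_smul, smul_smul, inv_mul_cancel₀ ha, one_smul, abs_inv, div_inv_eq_mul,
      mul_comm r] at h1
    exact ⟨_, _, h1⟩
  have htr : ∀ x ∈ {x : ℝ | ∃ A ∈ X.veechGroup, x = Matrix.trace (A : Matrix (Fin 2) (Fin 2) ℝ)},
      ∀ y ∈ span ℚ (range η), x * y ∈ span ℚ (range η) := by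
    rintro _ ⟨A, ⟨f, hf⟩, rfl⟩ y hy
    obtain ⟨a, b, a', b', h1, h2, h3⟩ := planeAct_trace hvw A
    rw [h3, add_mul]
    refine add_mem ?_ ?_
    · rcases eq_or_ne a 0 with rfl | ha
      · simp
      · rw [← hW] at hy
        refine hstep (fun C => ?_) y hy
        obtain ⟨e, ℓ', hℓ'⟩ := hline hf.isAffine h1 ha (hγ C)
        exact hmemη e ℓ' _ hℓ'
    · rcases eq_or_ne b' 0 with rfl | hb
      · simp
      -- The second diagonal entry acts on the span of the `k`, and this action is transported to
      -- the span of the `η` through multiplication by `t`.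
      · rw [← hT] at hy
        obtain ⟨z, hz, rfl⟩ := hy
        rw [SetLike.mem_coe, ← hU] at hz
        rw [LinearMap.mulLeft_apply, mul_left_comm, ← hT]
        refine mem_map_of_mem (f := LinearMap.mulLeft ℚ t) (hstep (fun D => ?_) z hz)
        rw [add_comm] at h2
        obtain ⟨e, ℓ', hℓ'⟩ := hline hf.isAffine h2 hb (hδ D)
        exact hmemk e ℓ' _ hℓ'
  obtain ⟨hfd, hle⟩ := IntermediateField.finrank_adjoin_le_of_mul_mem hne htr
  refine ⟨hfd, le_trans (Nat.cast_le.2 hle) ?_⟩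
  rw [← hW, show c = fun C => ∑ D, ((X.intersectionMatrix v w C D : ℚ) : ℝ) * η D from funext hc]
  exact Matrix.finrank_span_le_eRank _ η

theorem IsPrelattice.exists_twists (hX : X.IsPrelattice) : ∃ (v w : ℂ) (t t' : ℝ)
    (L L' : ℂ →ₗ[ℝ] ℂ) (g g' : S ≃ₜ S), X.Twist v w t L g ∧ X.Twist w v t' L' g' ∧
      X.IsCompletelyPeriodic v ∧ X.IsCompletelyPeriodic w ∧ LinearIndependent ℝ ![v, w] := by
  obtain ⟨P, hP, Q, hQ, hPp, hQp, htrans⟩ := hX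
  obtain ⟨v, hv0, a, ha, hv, hvP⟩ := hPp.exists_eigenvector P.2
  obtain ⟨w, hw0, b, hb, hw, hwQ⟩ := hQp.exists_eigenvector Q.2
  have hvw : LinearIndependent ℝ ![v, w] := by
    rw [LinearIndependent.pair_iff' hv0]
    rintro r rfl
    have hr : r ≠ 0 := by rintro rfl; simp at hw0
    refine htrans ⟨v, a, b, ⟨Module.End.mem_eigenspace_iff.2 hv, hv0⟩,
      ⟨Module.End.mem_eigenspace_iff.2 ?_, hv0⟩⟩
    rw [map_smul, smul_comm] at hw
    exact smul_right_injective ℂ hr hw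
  have hwv : LinearIndependent ℝ ![w, v] := LinearIndependent.pair_symm_iff.1 hvw
  obtain ⟨c, hc, hPw⟩ := hvP w hvw
  obtain ⟨d, hd, hQv⟩ := hwQ v hwv
  obtain ⟨t₁, t₂, L₁, L₂, g₁, g₂, h₁, h₂, ht⟩ := TranslationStructure.exists_twists hP ha hc hv hPw
  obtain ⟨s₁, s₂, M₁, M₂, f₁, f₂, k₁, k₂, hs⟩ := TranslationStructure.exists_twists hQ hb hd hw hQv
  exact ⟨v, w, t₁, s₁, L₁, M₁, g₁, f₁, h₁, k₁, h₁.isCompletelyPeriodic h₂ ht hvw,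
    k₁.isCompletelyPeriodic k₂ hs hwv, hvw⟩

theorem IsPrelattice.finrank_traceField_le [ConnectedSpace S] (hX : X.IsPrelattice) :
    FiniteDimensional ℚ X.traceField ∧
      ((Module.finrank ℚ X.traceField : ℕ) : ℕ∞) ≤ X.homologicalRank := by
  obtain ⟨v, w, t, t', L, L', g, g', h, h', hv, hw, hvw⟩ := hX.exists_twists
  obtain ⟨h1, h2⟩ := h.finrank_traceField_le h' hv hw hvw
  exact ⟨h1, h2.trans (le_iSup₂_of_le v w (le_iSup₂_of_le hv hw (le_iSup_of_le hvw le_rfl)))⟩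

end Prelattice

end TranslationStructure

/-! ### Maps to the circle that count intersections with a closed line. -/

/-- The piecewise linear function which increases from `0` to `1` on `[-ρ, ρ]`. -/
noncomputable def ramp (ρ y : ℝ) : ℝ := max 0 (min 1 (y / (2 * ρ) + 1 / 2))

theorem continuous_ramp (ρ : ℝ) : Continuous (ramp ρ) := by
  unfold ramp; fun_prop

theorem ramp_of_le {ρ y : ℝ} (hρ : 0 < ρ) (h : y ≤ -ρ) : ramp ρ y = 0 := by
  have : y / (2 * ρ) + 1 / 2 ≤ 0 := by
    have : y / (2 * ρ) ≤ -ρ / (2 * ρ) := by gcongr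
    have e : -ρ / (2 * ρ) = -(1 / 2) := by field_simp
    linarith
  rw [ramp, max_eq_left (min_le_of_right_le this)]

theorem ramp_of_ge {ρ y : ℝ} (hρ : 0 < ρ) (h : ρ ≤ y) : ramp ρ y = 1 := by
  have : 1 ≤ y / (2 * ρ) + 1 / 2 := by
    have : ρ / (2 * ρ) ≤ y / (2 * ρ) := by gcongr
    have e : ρ / (2 * ρ) = 1 / 2 := by field_simp
    linarith
  rw [ramp, min_eq_left this, max_eq_right zero_le_one]

theorem coe_ramp_of_le_abs {ρ y : ℝ} (hρ : 0 < ρ) (h : ρ ≤ |y|) :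
    (ramp ρ y : AddCircle (1 : ℝ)) = 0 := by
  rcases le_abs.1 h with h | h
  · rw [ramp_of_ge hρ h, AddCircle.coe_period]
  · rw [ramp_of_le hρ (by linarith), AddCircle.coe_zero]

namespace TranslationStructure

open Set Metric

section Strip

variable {S : Type*} [TopologicalSpace S] [T2Space S] [CompactSpace S] {X : TranslationStructure S}

theorem ClosedLine.ncard_inter_range {w : ℂ} {δ : ℝ → S} {c : ℝ} (hδ : X.ClosedLine w δ c)
    (A : Set S) : (range δ ∩ A).ncard = ({t | δ t ∈ A} ∩ Ico 0 c).ncard := by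
  have : range δ ∩ A = δ '' ({t | δ t ∈ A} ∩ Ico 0 c) := by
    ext x
    constructor
    · rintro ⟨⟨t, rfl⟩, ht⟩
      obtain ⟨b, hb, hbt⟩ := hδ.exists_mem_Ico t
      exact ⟨b, ⟨by rw [mem_ofPred_eq, hbt]; exact ht, hb⟩, hbt⟩
    · rintro ⟨t, ht, rfl⟩
      exact ⟨mem_range_self t, ht.1⟩
  rw [this, InjOn.ncard_image]
  intro t ht t' ht' htt
  obtain ⟨n, hn⟩ := (hδ.eq_iff _ _).1 htt
  have hc := hδ.pos
  have h1 : |(n : ℝ)| < 1 := by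
    have : |(n : ℝ)| * c < 1 * c := by
      rw [← abs_of_pos hc, ← abs_mul, ← hn, abs_of_pos hc, abs_lt]
      constructor <;> linarith [ht.2.1, ht.2.2, ht'.2.1, ht'.2.2]
    exact lt_of_mul_lt_mul_right this hc.le
  have h2 : n = 0 := Int.abs_lt_one_iff.1 (by exact_mod_cast h1)
  rw [h2, Int.cast_zero, zero_mul] at hn
  linarith

/-- The data of a thin strip around a closed line. -/
structure ThinStrip (X : TranslationStructure S) (v w : ℂ) (ℓ : ℝ → S) (ρ : ℝ) (Θ : ℝ × ℝ → S) :
    Prop where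
  pos : 0 < ρ
  sep : ∀ a b κ : ℝ, |κ| < 4 * ρ → X.Seg (ℓ a) (κ • w) (ℓ b) → κ = 0
  seg : ∀ a y : ℝ, |y| < 4 * ρ → X.Seg (ℓ a) (y • w) (Θ (a, y))
  flat : X.IsFlatOn (fun q : ℝ × ℝ => q.1 • v + q.2 • w) Θ (univ ×ˢ Ioo (-(4 * ρ)) (4 * ρ))

theorem ClosedLine.exists_thinStrip {v w : ℂ} (hvw : LinearIndependent ℝ ![v, w]) {ℓ : ℝ → S}
    {c : ℝ} (hℓ : X.ClosedLine v ℓ c) : ∃ ρ Θ, X.ThinStrip v w ℓ ρ Θ := by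
  obtain ⟨ε, hε, H⟩ := hℓ.exists_no_short_connection hvw
  obtain ⟨r, hr, hb⟩ := exists_uniform_flat_ball hℓ.isCompact_range
    (by rintro _ ⟨t, rfl⟩; exact hℓ.line.2.1 t)
  have hw : 0 < ‖w‖ := norm_pos_iff.2 (hvw.ne_zero 1)
  -- The factor `4` leaves room: heights below `2 * ρ` have differences below `4 * ρ`, where
  -- transversal connections are excluded, so the height of a point in the strip is unique.
  set ρ := min ε (r / ‖w‖) / 4 with hρ
  have hmin : 0 < min ε (r / ‖w‖) := lt_min hε (by positivity)
  have h4 : 4 * ρ = min ε (r / ‖w‖) := by rw [hρ]; ring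
  have hex : ∀ q : ℝ × ℝ, ∃ m, |q.2| < 4 * ρ → X.Seg (ℓ q.1) (q.2 • w) m := fun q => by
    obtain ⟨b, hb0, hbf⟩ := hb _ (mem_range_self q.1)
    refine ⟨b (q.2 • w), fun hq => ?_⟩
    have hball : q.2 • w ∈ ball (0 : ℂ) r := by
      rw [mem_ball_zero_iff, norm_smul, Real.norm_eq_abs, ← lt_div_iff₀ hw]
      exact hq.trans_le (h4.le.trans (min_le_right _ _))
    have := hbf.seg_of_convex (a := 0) (b := q.2 • w)
      ((convex_ball 0 r).segment_subset (mem_ball_self hr) hball) (fun t => by simp)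
    simpa [hb0] using this
  choose Θ hΘ using hex
  refine ⟨ρ, Θ, by rw [hρ]; positivity, fun a b κ hκ => H a b κ
    (hκ.trans_le (h4.le.trans (min_le_left _ _))), fun a y hy => hΘ (a, y) hy, ?_⟩
  refine IsFlatOn.of_seg (Ψ := fun q : ℝ × ℝ => ℓ q.1) ?_ (by fun_prop) (by fun_prop)
    fun q hq => hΘ q (abs_lt.2 hq.2)
  exact hℓ.line.isFlatOn.comp (h := Prod.fst) continuousOn_fst fun _ _ => trivial

variable {v w : ℂ} {ℓ : ℝ → S} {ρ : ℝ} {Θ : ℝ × ℝ → S}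

theorem ThinStrip.seg_of_seg (h : X.ThinStrip v w ℓ ρ Θ) {a y α β : ℝ} {m m' : S}
    (hy : |y| < 4 * ρ) (hy' : |y + β| < 4 * ρ) (hm : X.Seg (ℓ a) (y • w) m)
    (hm' : X.Seg m (α • v + β • w) m') : X.Seg (ℓ (a + α)) ((y + β) • w) m' := by
  have h1 := h.flat.seg_of_convex (a := (a, y)) (b := (a + α, y + β))
    ((convex_univ.prod (convex_Ioo _ _)).segment_subset ⟨trivial, abs_lt.1 hy⟩
      ⟨trivial, abs_lt.1 hy'⟩) (fun t => by
      simp only [Prod.fst_add, Prod.snd_add, Prod.fst_sub, Prod.snd_sub, Prod.smul_fst,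
        Prod.smul_snd, add_sub_cancel_left, smul_eq_mul]
      module)
  have h2 : (a + α) • v + (y + β) • w - (a • v + y • w) = α • v + β • w := by module
  rw [(h.seg a y hy).unique hm] at h1
  simp only [h2] at h1
  rw [hm'.unique h1]
  exact h.seg _ _ hy'

theorem ThinStrip.height_unique (h : X.ThinStrip v w ℓ ρ Θ) {a b y y' : ℝ} {m : S}
    (hy : |y| < 2 * ρ) (hy' : |y'| < 2 * ρ) (hm : X.Seg (ℓ a) (y • w) m)
    (hm' : X.Seg (ℓ b) (y' • w) m) : y = y' := by
  have h1 := hm'.symm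
  rw [← neg_smul] at h1
  have h2 := h.sep _ _ _ ?_ (hm.trans_smul h1)
  · linarith
  · rw [abs_lt] at *
    constructor <;> linarith [hy.1, hy.2, hy'.1, hy'.2]

open Classical in
/-- The collapse of the complement of a strip around a closed line to a point. -/
noncomputable def stripMap (X : TranslationStructure S) (w : ℂ) (ℓ : ℝ → S) (ρ : ℝ) (m : S) :
    AddCircle (1 : ℝ) :=
  if h : ∃ y : ℝ, |y| < 2 * ρ ∧ ∃ a, X.Seg (ℓ a) (y • w) m then
    (ramp ρ h.choose : AddCircle (1 : ℝ))
  else 0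

theorem ThinStrip.stripMap_eq (h : X.ThinStrip v w ℓ ρ Θ) {a y : ℝ} {m : S} (hy : |y| < 2 * ρ)
    (hm : X.Seg (ℓ a) (y • w) m) : X.stripMap w ℓ ρ m = (ramp ρ y : AddCircle (1 : ℝ)) := by
  have hex : ∃ y : ℝ, |y| < 2 * ρ ∧ ∃ a, X.Seg (ℓ a) (y • w) m := ⟨y, hy, a, hm⟩
  rw [stripMap, dif_pos hex]
  obtain ⟨h1, b, h2⟩ := hex.choose_spec
  rw [h.height_unique h1 hy h2 hm]

theorem ThinStrip.stripMap_eq_zero (h : X.ThinStrip v w ℓ ρ Θ) {m : S}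
    (hm : ∀ a y : ℝ, |y| < ρ → ¬ X.Seg (ℓ a) (y • w) m) : X.stripMap w ℓ ρ m = 0 := by
  by_cases hex : ∃ y : ℝ, |y| < 2 * ρ ∧ ∃ a, X.Seg (ℓ a) (y • w) m
  · obtain ⟨y, hy, a, hs⟩ := hex
    rw [h.stripMap_eq hy hs]
    exact coe_ramp_of_le_abs h.pos (not_lt.1 fun hlt => hm a y hlt hs)
  · rw [stripMap, dif_neg hex]

/-- Inside the strip of half-width `2 * ρ` the map is a continuous function of the height. Already
for heights from `ρ` on it is zero on the circle, so it extends by zero across the complement of the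
compact core. -/
theorem ThinStrip.continuous_stripMap (h : X.ThinStrip v w ℓ ρ Θ)
    (hvw : LinearIndependent ℝ ![v, w]) {c : ℝ} (hℓ : X.ClosedLine v ℓ c) :
    Continuous (X.stripMap w ℓ ρ) := by
  obtain ⟨α, β, hαβ, -⟩ := exists_plane_coords hvw
  have hρ := h.pos
  rw [continuous_iff_continuousAt]
  intro m
  by_cases hex : ∃ y : ℝ, |y| < 2 * ρ ∧ ∃ a, X.Seg (ℓ a) (y • w) m
  · obtain ⟨y, hy, a, hm⟩ := hex
    rw [ContinuousAt, h.stripMap_eq hy hm]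
    intro V hV
    have h1 : ContinuousAt (fun ζ : ℂ => (ramp ρ (y + β ζ) : AddCircle (1 : ℝ))) 0 :=
      ((AddCircle.continuous_mk' 1).comp
        ((continuous_ramp ρ).comp (continuous_const.add β.continuous))).continuousAt
    have h2 : ∀ᶠ ζ : ℂ in 𝓝 0, (ramp ρ (y + β ζ) : AddCircle (1 : ℝ)) ∈ V ∧ |y + β ζ| < 2 * ρ := by
      refine (h1.eventually (by simpa using hV)).and ?_
      exact ContinuousAt.eventually_lt (by fun_prop) continuousAt_const (by simpa)
    obtain ⟨η, hη, hb⟩ := Metric.mem_nhds_iff.1 h2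
    change ∀ᶠ m' in 𝓝 m, X.stripMap w ℓ ρ m' ∈ V
    filter_upwards [eventually_short_seg hm.right_notMem hη] with m' hm'
    obtain ⟨ζ, hζ, hs⟩ := hm'
    obtain ⟨h3, h4⟩ := hb (show ζ ∈ ball (0 : ℂ) η by simpa using hζ)
    rw [hαβ ζ] at hs
    rw [h.stripMap_eq h4 (h.seg_of_seg (by linarith) (by linarith) hm hs)]
    exact h3
  · have h0 : X.stripMap w ℓ ρ m = 0 := by rw [stripMap, dif_neg hex]
    have hsub : Icc 0 c ×ˢ Icc (-ρ) ρ ⊆ (univ : Set ℝ) ×ˢ Ioo (-(4 * ρ)) (4 * ρ) :=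
      prod_mono (subset_univ _) fun y hy => ⟨by linarith [hy.1], by linarith [hy.2]⟩
    have hC : IsClosed (Θ '' (Icc 0 c ×ˢ Icc (-ρ) ρ)) :=
      ((isCompact_Icc.prod isCompact_Icc).image_of_continuousOn
        (h.flat.continuousOn.mono hsub)).isClosed
    have hmC : m ∈ (Θ '' (Icc 0 c ×ˢ Icc (-ρ) ρ))ᶜ := by
      rintro ⟨⟨a, y⟩, ⟨-, hy⟩, rfl⟩
      have : |y| ≤ ρ := abs_le.2 hy
      exact hex ⟨y, by linarith, a, h.seg a y (by linarith)⟩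
    refine ContinuousAt.congr (f := fun _ => 0) continuousAt_const ?_
    filter_upwards [hC.isOpen_compl.mem_nhds hmC] with m' hm'
    refine (h.stripMap_eq_zero fun a y hy hs => hm' ?_).symm
    obtain ⟨b, hb, hba⟩ := hℓ.exists_mem_Ico a
    rw [← hba] at hs
    exact ⟨(b, y), ⟨⟨hb.1, hb.2.le⟩, abs_le.1 hy.le⟩, (h.seg b y (by linarith)).unique hs⟩

/-- A line parallel to the strip keeps its height in it, or never enters it. This makes parallel
waist curves pair to zero. -/
theorem ThinStrip.stripMap_line (h : X.ThinStrip v w ℓ ρ Θ) {δ : ℝ → S}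
    (hδ : X.IsStraightLine v δ) (t t' : ℝ) :
    X.stripMap w ℓ ρ (δ t) = X.stripMap w ℓ ρ (δ t') := by
  have key : ∀ t t' a y : ℝ, |y| < 2 * ρ → X.Seg (ℓ a) (y • w) (δ t) →
      X.Seg (ℓ (a + (t' - t))) (y • w) (δ t') := fun t t' a y hy hs => by
    have h1 := hδ.seg t t'
    have := h.pos
    have := h.seg_of_seg (α := t' - t) (β := 0) (m' := δ t') (by linarith)
      (by rw [add_zero]; linarith) hs (by simpa using h1)
    rwa [add_zero] at this
  by_cases hex : ∃ y : ℝ, |y| < 2 * ρ ∧ ∃ a, X.Seg (ℓ a) (y • w) (δ t)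
  · obtain ⟨y, hy, a, hs⟩ := hex
    rw [h.stripMap_eq hy hs, h.stripMap_eq hy (key t t' a y hy hs)]
  · have hex' : ¬ ∃ y : ℝ, |y| < 2 * ρ ∧ ∃ a, X.Seg (ℓ a) (y • w) (δ t') := by
      rintro ⟨y, hy, a, hs⟩
      exact hex ⟨y, hy, _, key t' t a y hy hs⟩
    rw [stripMap, stripMap, dif_neg hex, dif_neg hex']

/-- The lift is a sum of ramps centred at the hitting times. Every crossing has the same velocity
`w`, so each ramp rises by `+1` and there are no cancellations. -/
theorem ThinStrip.exists_lift (h : X.ThinStrip v w ℓ ρ Θ) (hvw : LinearIndependent ℝ ![v, w])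
    {c c' : ℝ} (hℓ : X.ClosedLine v ℓ c) {δ : ℝ → S} (hδ : X.ClosedLine w δ c') :
    ∃ G : ℝ → ℝ, Continuous G ∧
      (∀ t ∈ Icc 0 c', (G t : AddCircle (1 : ℝ)) = X.stripMap w ℓ ρ (δ t)) ∧
      G c' - G 0 = (range δ ∩ range ℓ).ncard := by
  have hρ := h.pos
  have hc' := hδ.pos
  have hfin : ({t | δ t ∈ range ℓ} ∩ Ico 0 c').Finite :=
    (hℓ.finite_hits hvw hδ.line 0 c').subset (inter_subset_inter_right _ Ico_subset_Icc_self)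
  set A := hfin.toFinset with hA
  have hAmem : ∀ τ, τ ∈ A ↔ δ τ ∈ range ℓ ∧ τ ∈ Ico 0 c' := fun τ => by
    rw [hA, Finite.mem_toFinset]; rfl
  have hsep : ∀ τ τ', δ τ ∈ range ℓ → δ τ' ∈ range ℓ → |τ' - τ| < 4 * ρ → τ = τ' := by
    rintro τ τ' ⟨a, ha⟩ ⟨b, hb⟩ hlt
    have h1 := hδ.line.seg τ τ'
    rw [← ha, ← hb] at h1
    linarith [h.sep a b _ hlt h1]
  have hper : ∀ τ (n : ℤ), δ (τ + n * c') = δ τ := fun τ n => hδ.apply_add τ n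
  have hbig : ∀ τ, δ τ ∈ range ℓ → 4 * ρ ≤ c' := by
    intro τ hτ
    by_contra! hlt
    have := hsep τ (τ + (1 : ℤ) * c') hτ (by rwa [hper]) (by
      rw [add_sub_cancel_left, Int.cast_one, one_mul, abs_of_pos hc']; exact hlt)
    rw [Int.cast_one, one_mul] at this
    linarith
  -- Hits just before `0` or just after `c'` also influence the interval, so the two neighbouring
  -- periods are included.
  set P := A ×ˢ Finset.Icc (-1 : ℤ) 1 with hP
  refine ⟨fun t => ∑ p ∈ P, ramp ρ (t - (p.1 + p.2 * c')), ?_, ?_, ?_⟩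
  · exact continuous_finsetSum _ fun p _ => (continuous_ramp ρ).comp (by fun_prop)
  · intro t ht
    have hcast : ((∑ p ∈ P, ramp ρ (t - (p.1 + p.2 * c')) : ℝ) : AddCircle (1 : ℝ)) =
        ∑ p ∈ P, (ramp ρ (t - (p.1 + p.2 * c')) : AddCircle (1 : ℝ)) :=
      map_sum (QuotientAddGroup.mk' (AddSubgroup.zmultiples (1 : ℝ))) _ _
    rw [hcast]
    by_cases hex : ∃ τ, δ τ ∈ range ℓ ∧ |t - τ| < ρ
    · obtain ⟨τ, hτ, htτ⟩ := hex
      have h4 := hbig τ hτ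
      have h1 : X.stripMap w ℓ ρ (δ t) = (ramp ρ (t - τ) : AddCircle (1 : ℝ)) := by
        obtain ⟨a, ha⟩ := hτ
        refine h.stripMap_eq (a := a) (by linarith) ?_
        rw [ha]
        exact hδ.line.seg τ t
      obtain ⟨b, n, hb, hbn⟩ : ∃ (b : ℝ) (n : ℤ), b ∈ Ico 0 c' ∧ τ = b + n * c' := by
        refine ⟨toIcoMod hc' 0 τ, toIcoDiv hc' 0 τ, by simpa using toIcoMod_mem_Ico hc' 0 τ, ?_⟩
        have := toIcoMod_add_toIcoDiv_zsmul hc' 0 τ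
        rw [zsmul_eq_mul] at this
        exact this.symm
      have hbA : b ∈ A := (hAmem b).2 ⟨by rwa [hbn, hper] at hτ, hb⟩
      rw [abs_lt] at htτ
      have hn : n ∈ Finset.Icc (-1 : ℤ) 1 := by
        have h2 : (-2 : ℝ) < n := by
          by_contra! hle
          have : (n : ℝ) * c' ≤ -2 * c' := mul_le_mul_of_nonneg_right hle hc'.le
          linarith [ht.1, hb.2, htτ.2]
        have h3 : (n : ℝ) < 2 := by
          by_contra! hle
          have : 2 * c' ≤ (n : ℝ) * c' := mul_le_mul_of_nonneg_right hle hc'.le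
          linarith [ht.2, hb.1, htτ.1]
        have h2' : -2 < n := by exact_mod_cast h2
        have h3' : n < 2 := by exact_mod_cast h3
        rw [Finset.mem_Icc]; omega
      rw [Finset.sum_eq_single_of_mem (b, n) (Finset.mk_mem_product hbA hn), h1, hbn]
      rintro ⟨b', n'⟩ hp hne
      refine coe_ramp_of_le_abs hρ (not_lt.1 fun hlt => hne ?_)
      rw [Finset.mem_product, hAmem] at hp
      rw [abs_lt] at hlt
      have h5 := hsep τ (b' + n' * c') hτ (by rw [hper]; exact hp.1.1) (by
        rw [abs_lt]; constructor <;> linarith [hlt.1, hlt.2, htτ.1, htτ.2])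
      -- At most one hit is closer than `ρ` to `t`, and it has a unique representation by a point of
      -- the fundamental period; all other ramps are integers.
      have h6 := (existsUnique_add_zsmul_mem_Ico hc' τ 0).unique (y₁ := -n) (y₂ := -n')
        (by rw [zero_add, zsmul_eq_mul]; push_cast; convert hb using 1; linarith)
        (by rw [zero_add, zsmul_eq_mul]; push_cast; convert hp.1.2 using 1; linarith)
      have h7 : n = n' := neg_injective h6
      subst h7
      have h8 : b' = b := by linarith
      rw [h8]
    · push Not at hex
      rw [h.stripMap_eq_zero]
      · refine Finset.sum_eq_zero fun p hp => coe_ramp_of_le_abs hρ (hex _ ?_)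
        rw [hP, Finset.mem_product, hAmem] at hp
        rw [hper]
        exact hp.1.1
      · intro a y hy hs
        have h1 := hδ.line.seg t (t - y)
        have h2 := hs.symm
        rw [← neg_smul] at h2
        rw [sub_sub_cancel_left] at h1
        have := hex (t - y) ⟨a, h2.unique h1⟩
        rw [sub_sub_cancel] at this
        linarith
  · rw [hδ.ncard_inter_range, ncard_eq_toFinset_card _ hfin, ← hA, ← Finset.sum_sub_distrib, hP,
      Finset.sum_product, Finset.card_eq_sum_ones, Nat.cast_sum]
    refine Finset.sum_congr rfl fun τ hτ => ?_
    rw [hAmem] at hτ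
    have h4 := hbig τ hτ.1
    -- For each hit the increments of the three ramps telescope to `1 - 0`.
    rw [show Finset.Icc (-1 : ℤ) 1 = {-1, 0, 1} by decide, Finset.sum_insert (by decide),
      Finset.sum_insert (by decide), Finset.sum_singleton]
    push_cast
    have e1 : ramp ρ (c' - (τ + -1 * c')) = 1 := ramp_of_ge hρ (by linarith [hτ.2.2])
    have e2 : ramp ρ (0 - (τ + 1 * c')) = 0 := ramp_of_le hρ (by linarith [hτ.2.1])
    rw [e1, e2, show c' - (τ + 0 * c') = 0 - (τ + -1 * c') by ring,
      show c' - (τ + 1 * c') = 0 - (τ + 0 * c') by ring]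
    ring

/-- Intersection with a closed line, as a map to the circle. -/
theorem ClosedLine.exists_intersection_map (hvw : LinearIndependent ℝ ![v, w]) {c : ℝ}
    (hℓ : X.ClosedLine v ℓ c) : ∃ F : C(S, AddCircle (1 : ℝ)),
      (∀ (δ : ℝ → S) (c' : ℝ), X.ClosedLine w δ c' → ∃ G : ℝ → ℝ, Continuous G ∧
        (∀ t ∈ Icc 0 c', (G t : AddCircle (1 : ℝ)) = F (δ t)) ∧
        G c' - G 0 = (range δ ∩ range ℓ).ncard) ∧
      ∀ δ : ℝ → S, X.IsStraightLine v δ → ∀ t t', F (δ t) = F (δ t') := by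
  obtain ⟨ρ, Θ, h⟩ := hℓ.exists_thinStrip hvw
  exact ⟨⟨_, h.continuous_stripMap hvw hℓ⟩, fun δ c' hδ => h.exists_lift hvw hℓ hδ,
    fun δ hδ => h.stripMap_line hδ⟩

end Strip

end TranslationStructure

/-! ### Winding numbers on the fundamental group and on first homology. -/

section Winding

open unitInterval

variable {S : Type*} [TopologicalSpace S] (F : C(S, AddCircle (1 : ℝ)))

/-- The variation of a lift to `ℝ` of a circle valued map along a path. -/
def HasWinding {x y : S} (p : Path x y) (r : ℝ) : Prop :=
  ∃ Γ : C(I, ℝ), (∀ t, (Γ t : AddCircle (1 : ℝ)) = F (p t)) ∧ Γ 1 - Γ 0 = r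

variable {F} {x y z : S} {p : Path x y} {r r' : ℝ}

/-- Homotopy lifting for the covering `ℝ → ℝ/ℤ`. The two lifts may start at different points of the
fibre, which is corrected by the constant `k` without changing the variation. -/
theorem HasWinding.of_homotopic {p' : Path x y} (h : HasWinding F p r) (hp : p.Homotopic p')
    (h' : HasWinding F p' r') : r = r' := by
  obtain ⟨Γ, hΓ, rfl⟩ := h
  obtain ⟨Γ', hΓ', rfl⟩ := h'
  have cov := AddCircle.isCoveringMap_coe (1 : ℝ)
  have h0 : F (p' 0) = (Γ 0 : AddCircle (1 : ℝ)) := by rw [hΓ, p.source, p'.source]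
  set f : C(I, AddCircle (1 : ℝ)) := F.comp p.toContinuousMap
  set f' : C(I, AddCircle (1 : ℝ)) := F.comp p'.toContinuousMap
  have hh : f.HomotopicRel f' {0, 1} := ⟨hp.some.compContinuousMap F⟩
  have e := cov.liftPath_apply_one_eq_of_homotopicRel hh (Γ 0) (hΓ 0).symm h0
  have e1 : Γ = cov.liftPath f (Γ 0) (hΓ 0).symm := (cov.eq_liftPath_iff' _).2 ⟨funext hΓ, rfl⟩
  obtain ⟨k, hk⟩ : ∃ k : ℝ, (k : AddCircle (1 : ℝ)) = 0 ∧ Γ' 0 + k = Γ 0 := by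
    refine ⟨Γ 0 - Γ' 0, ?_, by ring⟩
    rw [AddCircle.coe_sub, hΓ, hΓ', p.source, p'.source, sub_self]
  have e2 : Γ' + ContinuousMap.const I k = cov.liftPath f' (Γ 0) h0 := by
    refine (cov.eq_liftPath_iff' _).2 ⟨funext fun t => ?_, ?_⟩
    · simp only [Function.comp, ContinuousMap.add_apply, ContinuousMap.const_apply,
        AddCircle.coe_add, hk.1, add_zero, hΓ' t]
      rfl
    · simpa using hk.2
  rw [← e1, ← e2] at e
  rw [e, ← hk.2]
  simp

theorem HasWinding.unique (h : HasWinding F p r) (h' : HasWinding F p r') : r = r' :=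
  h.of_homotopic (Path.Homotopic.refl p) h'

theorem exists_hasWinding (F : C(S, AddCircle (1 : ℝ))) (p : Path x y) :
    ∃ r, HasWinding F p r := by
  have cov := AddCircle.isCoveringMap_coe (1 : ℝ)
  obtain ⟨e, he⟩ := QuotientAddGroup.mk_surjective (F (p 0))
  obtain ⟨Γ, hΓ, -⟩ := cov.exists_path_lifts (F.comp p.toContinuousMap) e he.symm
  exact ⟨_, Γ, fun t => congrFun hΓ t, rfl⟩

theorem HasWinding.trans {q : Path y z} (h : HasWinding F p r) (h' : HasWinding F q r') :
    HasWinding F (p.trans q) (r + r') := by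
  obtain ⟨Γ, hΓ, rfl⟩ := h
  obtain ⟨Γ', hΓ', rfl⟩ := h'
  set k := Γ 1 - Γ' 0
  have hk : (k : AddCircle (1 : ℝ)) = 0 := by
    rw [AddCircle.coe_sub, hΓ, hΓ', p.target, q.source, sub_self]
  let P : Path (Γ 0) (Γ 1) := ⟨Γ, rfl, rfl⟩
  let Q : Path (Γ 1) (Γ' 1 + k) :=
    ⟨Γ' + ContinuousMap.const I k, by simp [k], by simp⟩
  refine ⟨(P.trans Q).toContinuousMap, fun t => ?_, ?_⟩
  · change ((P.trans Q t : ℝ) : AddCircle (1 : ℝ)) = F (p.trans q t)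
    rw [Path.trans_apply, Path.trans_apply]
    split_ifs
    · exact hΓ _
    · change ((Γ' _ + k : ℝ) : AddCircle (1 : ℝ)) = _
      rw [AddCircle.coe_add, hk, add_zero]
      exact hΓ' _
  · change P.trans Q 1 - P.trans Q 0 = _
    rw [(P.trans Q).source, (P.trans Q).target]
    simp only [k]; ring

theorem HasWinding.symm (h : HasWinding F p r) : HasWinding F p.symm (-r) := by
  obtain ⟨Γ, hΓ, rfl⟩ := h
  refine ⟨Γ.comp ⟨σ, continuous_symm⟩, fun t => hΓ _, ?_⟩
  simp

/-- The winding number homomorphism on the fundamental group. -/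
noncomputable def windingHom (F : C(S, AddCircle (1 : ℝ))) (x : S) :
    FundamentalGroup S x →* Multiplicative ℝ where
  toFun g := Multiplicative.ofAdd (Quotient.lift (s := Path.Homotopic.setoid x x)
    (fun p => (exists_hasWinding F p).choose)
    (fun p p' h => (exists_hasWinding F p).choose_spec.of_homotopic h
      (exists_hasWinding F p').choose_spec) g)
  map_one' := by
    rw [FundamentalGroup.one_def]
    have h : HasWinding F (Path.refl x) 0 := by
      obtain ⟨e, he⟩ := QuotientAddGroup.mk_surjective (F x)
      exact ⟨ContinuousMap.const I e, fun t => he, by simp⟩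
    exact congrArg Multiplicative.ofAdd ((exists_hasWinding F (Path.refl x)).choose_spec.unique h)
  map_mul' g g' := by
    rw [FundamentalGroup.mul_def, ← ofAdd_add]
    induction g using Quotient.inductionOn with | _ p => ?_
    induction g' using Quotient.inductionOn with | _ q => ?_
    have h := (exists_hasWinding F q).choose_spec.trans (exists_hasWinding F p).choose_spec
    refine congrArg Multiplicative.ofAdd ?_
    rw [add_comm]
    exact (exists_hasWinding F (q.trans p)).choose_spec.unique h

/-- The winding number of a circle valued map on the first homology. -/
noncomputable def windingMap (F : C(S, AddCircle (1 : ℝ))) (x : S) :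
    Additive (Abelianization (FundamentalGroup S x)) →ₗ[ℤ] ℝ :=
  (MonoidHom.toAdditiveLeft (Abelianization.lift (windingHom F x))).toIntLinearMap

/-- The homology class of a loop. -/
noncomputable def loopClass {x : S} (p : Path x x) :
    Additive (Abelianization (FundamentalGroup S x)) :=
  Additive.ofMul (Abelianization.of (FundamentalGroup.fromPath (Path.Homotopic.Quotient.mk p)))

theorem windingMap_loopClass {p : Path x x} (h : HasWinding F p r) :
    windingMap F x (loopClass p) = r := by
  have h1 : windingMap F x (loopClass p) = (exists_hasWinding F p).choose := by
    simp only [windingMap, loopClass, AddMonoidHom.coe_toIntLinearMap]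
    change (Abelianization.lift (windingHom F x) (Abelianization.of _)).toAdd = _
    rw [Abelianization.lift_apply_of]
    rfl
  rw [h1]
  exact (exists_hasWinding F p).choose_spec.unique h

end Winding

/-! ### Homology classes of closed lines. -/

namespace TranslationStructure

open Set Metric

section Homology

variable {S : Type*} [TopologicalSpace S] {X : TranslationStructure S}

theorem pathConnectedSpace [ConnectedSpace S] (X : TranslationStructure S) :
    PathConnectedSpace S := by
  have hex : ∀ x : S, ∃ e : OpenPartialHomeomorph S ℂ, x ∈ e.source := fun x => by
    by_cases hx : x ∈ X.sing
    · obtain ⟨k, -, φ, h, -⟩ := X.cone x hx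
      exact ⟨φ, h⟩
    · obtain ⟨e, -, h⟩ := X.exists_chart x hx
      exact ⟨e, h⟩
  choose e he using hex
  let _ : ChartedSpace ℂ S :=
    { atlas := univ
      chartAt := e
      mem_chart_source := he
      chart_mem_atlas := fun _ => mem_univ _ }
  have := ChartedSpace.locallyPathConnectedSpace ℂ S
  exact pathConnectedSpace_iff_connectedSpace.2 inferInstance

variable [T2Space S] [CompactSpace S]

/-- The path along a closed line. -/
noncomputable def ClosedLine.path {v : ℂ} {γ : ℝ → S} {c : ℝ} (h : X.ClosedLine v γ c) :
    Path (γ 0) (γ 0) where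
  toFun t := γ (c * t)
  continuous_toFun := h.line.1.comp (by fun_prop)
  source' := by simp
  target' := by
    have := h.apply_add 0 1
    simpa using this

/-- Closed lines have homology classes, on which the winding numbers can be computed. -/
theorem ClosedLine.exists_class [ConnectedSpace S] {v : ℂ} {γ : ℝ → S} {c : ℝ}
    (h : X.ClosedLine v γ c) (x : S) :
    ∃ a : Additive (Abelianization (FundamentalGroup S x)),
      ∀ F : C(S, AddCircle (1 : ℝ)), ∀ G : ℝ → ℝ, Continuous G →
        (∀ t ∈ Icc 0 c, (G t : AddCircle (1 : ℝ)) = F (γ t)) → windingMap F x a = G c - G 0 := by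
  have := X.pathConnectedSpace
  let q := PathConnectedSpace.somePath x (γ 0)
  -- The connection to the base point is run through in both directions, so its winding numbers
  -- cancel.
  refine ⟨loopClass (q.trans (h.path.trans q.symm)), fun F G hG hGF => ?_⟩
  obtain ⟨r, hr⟩ := exists_hasWinding F q
  have h1 : HasWinding F h.path (G c - G 0) := by
    refine ⟨⟨fun t => G (c * t), hG.comp (by fun_prop)⟩, fun t => hGF _ ?_, by simp⟩
    exact ⟨mul_nonneg h.pos.le t.2.1, mul_le_of_le_one_right h.pos.le t.2.2⟩
  have := windingMap_loopClass (hr.trans (h1.trans hr.symm))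
  rw [this]
  ring

end Homology

end TranslationStructure

/-! ### The rank of an intersection matrix and the genus. -/

open Module Submodule Cardinal in
theorem Matrix.exists_linearIndependent_col {m n K : Type*} [Field K] (A : Matrix m n K) {k : ℕ}
    (h : (k : ℕ∞) ≤ A.eRank) : ∃ D : Fin k → n, LinearIndependent K fun j => A.col (D j) := by
  obtain ⟨b, hb, hspan, hli⟩ := exists_linearIndependent K (Set.range A.col)
  rw [Matrix.eRank, Matrix.cRank, ← hspan, rank_span_set hli, natCast_le_toENat] at h
  have h1 : Cardinal.lift #(Fin k) ≤ Cardinal.lift #b := by simpa using h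
  obtain ⟨φ⟩ := Cardinal.lift_mk_le'.1 h1
  choose D hD using fun j => hb (φ j).2
  refine ⟨D, ?_⟩
  simp only [hD]
  exact hli.comp φ φ.injective

open Module Submodule Cardinal in
-- If the rows did not span, a nonzero functional vanishing on them would be a linear relation
-- between the columns. So the rows span a space of dimension `k`, even when there are infinitely
-- many of them.
theorem Matrix.exists_linearIndependent_row {m K : Type*} [Field K] {k : ℕ}
    (B : Matrix m (Fin k) K) (h : LinearIndependent K B.col) :
    ∃ C : Fin k → m, LinearIndependent K fun i => B (C i) := by
  have htop : span K (Set.range B) = ⊤ := by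
    by_contra hne
    obtain ⟨f, hf, hle⟩ := Submodule.exists_le_ker_of_lt_top _ (lt_top_iff_ne_top.2 hne)
    refine hf (LinearMap.pi_ext' fun j => LinearMap.ext_ring ?_)
    refine Fintype.linearIndependent_iff.1 h (fun j => f (Pi.single j 1)) ?_ j
    funext i
    have h1 : f (B i) = 0 := hle (subset_span (Set.mem_range_self i))
    rw [← LinearMap.sum_single_apply (fun _ => K) (B i), map_sum] at h1
    simp only [Finset.sum_apply, Pi.smul_apply, smul_eq_mul, Matrix.col_apply, Pi.zero_apply]
    rw [← h1]
    refine Finset.sum_congr rfl fun j _ => ?_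
    have : (Pi.single j (B i j) : Fin k → K) = B i j • Pi.single j (1 : K) := by
      ext l; simp [Pi.single_apply]
    rw [this, map_smul, smul_eq_mul, mul_comm]
  refine (Matrix.transpose B).exists_linearIndependent_col ?_
  have : Set.range (Matrix.transpose B).col = Set.range B := rfl
  rw [Matrix.eRank, Matrix.cRank, this, htop, rank_top]
  simp

namespace TranslationStructure

open Set

section Genus

variable {S : Type*} [TopologicalSpace S] [T2Space S] [CompactSpace S] [ConnectedSpace S]
  {X : TranslationStructure S}

/-- The pairing between homology classes of waist curves: the two families of classes and the
families of winding numbers which are dual to them. -/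
theorem exists_classes {v w : ℂ} (hvw : LinearIndependent ℝ ![v, w]) (x : S) :
    ∃ (a : X.Cylinder v → Additive (Abelianization (FundamentalGroup S x)))
      (f : X.Cylinder v → Additive (Abelianization (FundamentalGroup S x)) →ₗ[ℤ] ℝ)
      (b : X.Cylinder w → Additive (Abelianization (FundamentalGroup S x)))
      (g : X.Cylinder w → Additive (Abelianization (FundamentalGroup S x)) →ₗ[ℤ] ℝ),
      (∀ C D, f C (b D) = X.intersectionMatrix v w C D) ∧
      (∀ C D, g D (a C) = X.intersectionMatrix v w C D) ∧
      (∀ C C', f C (a C') = 0) ∧ ∀ D D', g D (b D') = 0 := by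
  have hwv : LinearIndependent ℝ ![w, v] := LinearIndependent.pair_symm_iff.1 hvw
  have hv : v ≠ 0 := hvw.ne_zero 0
  have hw : w ≠ 0 := hvw.ne_zero 1
  choose γ c hγ hγ0 using fun C : X.Cylinder v => exists_closedLine hv (base_mem C)
  choose δ d hδ hδ0 using fun D : X.Cylinder w => exists_closedLine hw (base_mem D)
  have hwγ : ∀ C, X.waist v C = range (γ C) := fun C => by
    rw [waist_eq, ← hγ0, leaf_eq_range (hγ C).line]
  have hwδ : ∀ D, X.waist w D = range (δ D) := fun D => by
    rw [waist_eq, ← hδ0, leaf_eq_range (hδ D).line]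
  choose F hF hF0 using fun C => (hγ C).exists_intersection_map hvw
  choose G hG hG0 using fun D => (hδ D).exists_intersection_map hwv
  choose a ha using fun C => (hγ C).exists_class x
  choose b hb using fun D => (hδ D).exists_class x
  refine ⟨a, fun C => windingMap (F C) x, b, fun D => windingMap (G D) x, fun C D => ?_,
    fun C D => ?_, fun C C' => ?_, fun D D' => ?_⟩
  · obtain ⟨H, hH, h1, h2⟩ := hF C _ _ (hδ D)
    rw [hb D (F C) H hH h1, h2, intersectionMatrix, Matrix.of_apply, hwγ, hwδ, inter_comm]
    simp
  · obtain ⟨H, hH, h1, h2⟩ := hG D _ _ (hγ C)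
    rw [ha C (G D) H hH h1, h2, intersectionMatrix, Matrix.of_apply, hwγ, hwδ]
    simp
  · obtain ⟨e, he⟩ := QuotientAddGroup.mk_surjective (F C (γ C' 0))
    rw [ha C' (F C) (fun _ => e) continuous_const
      fun t _ => he.trans (hF0 C _ (hγ C').line 0 t), sub_self]
  · obtain ⟨e, he⟩ := QuotientAddGroup.mk_surjective (G D (δ D' 0))
    rw [hb D' (G D) (fun _ => e) continuous_const
      fun t _ => he.trans (hG0 D _ (hδ D').line 0 t), sub_self]

/-- The rank of an intersection matrix is at most the genus. -/
theorem eRank_intersectionMatrix_le {v w : ℂ} (hvw : LinearIndependent ℝ ![v, w])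
    (hg : surfaceGenus S ≠ 0) : (X.intersectionMatrix v w).eRank ≤ surfaceGenus S := by
  by_contra! hlt
  have hle : ((surfaceGenus S + 1 : ℕ) : ℕ∞) ≤ (X.intersectionMatrix v w).eRank := by
    push_cast
    exact Order.add_one_le_of_lt hlt
  obtain ⟨D, hD⟩ := Matrix.exists_linearIndependent_col _ hle
  obtain ⟨C, hC⟩ := Matrix.exists_linearIndependent_row
    (Matrix.of fun C j => X.intersectionMatrix v w C (D j)) hD
  obtain ⟨a, f, b, g, hfb, hga, hfa, hgb⟩ := exists_classes (X := X) hvw (Classical.arbitrary S)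
  -- The winding numbers `f` vanish on the classes `a`, so a relation restricts to one between the
  -- chosen columns. Once these coefficients vanish, the winding numbers `g` give a relation between
  -- the chosen rows.
  have hli : LinearIndependent ℤ (Sum.elim (fun i => a (C i)) (fun j => b (D j))) := by
    rw [Fintype.linearIndependent_iff]
    intro z hz
    rw [Fintype.sum_sum_type] at hz
    simp only [Sum.elim_inl, Sum.elim_inr] at hz
    have h1 : ∀ j, ((z (Sum.inr j) : ℤ) : ℚ) = 0 := by
      refine Fintype.linearIndependent_iff.1 hD (fun j => ((z (Sum.inr j) : ℤ) : ℚ)) ?_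
      funext C'
      have := congrArg (f C') hz
      simp only [map_add, map_sum, map_zsmul, hfa, hfb, smul_zero, Finset.sum_const_zero, zero_add,
        map_zero, zsmul_eq_mul] at this
      simp only [Finset.sum_apply, Pi.smul_apply, smul_eq_mul, Matrix.col_apply, Pi.zero_apply]
      exact_mod_cast this
    have h2 : ∀ i, ((z (Sum.inl i) : ℤ) : ℚ) = 0 := by
      refine Fintype.linearIndependent_iff.1 hC (fun i => ((z (Sum.inl i) : ℤ) : ℚ)) ?_
      funext j
      have := congrArg (g (D j)) hz
      simp only [map_add, map_sum, map_zsmul, hga, hgb, smul_zero, Finset.sum_const_zero, add_zero,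
        map_zero, zsmul_eq_mul] at this
      simp only [Finset.sum_apply, Pi.smul_apply, smul_eq_mul, Matrix.of_apply, Pi.zero_apply]
      exact_mod_cast this
    rintro (i | j)
    · exact_mod_cast h2 i
    · exact_mod_cast h1 j
  have hcard := hli.cardinal_lift_le_rank
  have hfin : Module.finrank ℤ (Additive (Abelianization
      (FundamentalGroup S (Classical.arbitrary S)))) = firstBetti S := rfl
  -- `finrank` is zero for infinite rank, so a nonzero genus ensures that the first Betti number is
  -- the true rank of the homology.
  have hne : firstBetti S ≠ 0 := fun h0 => hg (by rw [surfaceGenus, h0])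
  have hrank : Module.rank ℤ (Additive (Abelianization
      (FundamentalGroup S (Classical.arbitrary S)))) = firstBetti S := by
    rw [← hfin, Module.finrank, Cardinal.cast_toNat_of_lt_aleph0]
    rw [← hfin, Module.finrank] at hne
    exact (Cardinal.toNat_ne_zero.1 hne).2
  rw [hrank] at hcard
  have h3 : (surfaceGenus S + 1) + (surfaceGenus S + 1) ≤ firstBetti S := by
    simp only [Cardinal.mk_fintype, Fintype.card_sum, Fintype.card_fin,
      Cardinal.lift_natCast] at hcard
    exact_mod_cast hcard
  rw [surfaceGenus] at h3
  omega

theorem homologicalRank_le (hg : surfaceGenus S ≠ 0) : X.homologicalRank ≤ surfaceGenus S :=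
  iSup₂_le fun _ _ => iSup₂_le fun _ _ => iSup_le fun hvw => eRank_intersectionMatrix_le hvw hg

end Genus

end TranslationStructure

theorem mainTheorem12 {S : Type*} [TopologicalSpace S] [T2Space S] [CompactSpace S]
    [ConnectedSpace S] (X : TranslationStructure S) (hX : X.IsPrelattice) :
    FiniteDimensional ℚ X.traceField ∧
      ((Module.finrank ℚ X.traceField : ℕ) : ℕ∞) ≤ X.homologicalRank ∧
      (X.IsAlgebraicallyPrimitive → X.HasMaximalHomologicalRank) := by
  obtain ⟨hfin, hle⟩ := hX.finrank_traceField_le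
  refine ⟨hfin, hle, fun hprim => ?_⟩
  -- Algebraic primitivity makes the genus equal to the degree of a finite extension, which is
  -- positive.
  have hg : surfaceGenus S ≠ 0 := by
    rw [← (hprim : _ = _)]
    exact Module.finrank_pos.ne'
  refine le_antisymm (TranslationStructure.homologicalRank_le hg) ?_
  rwa [← (hprim : _ = _)]
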